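/- All alphabets are finite; a class of languages consists of languages $L\subseteq X^*$ over alphabets $X$. For a monoid $M$, a valence automaton over $M$ with input alphabet $X$ has a finite set $Q$ of states, a finite set of edges $E\subseteq Q\times X^*\times M\times Q$, an initial state $q_0$ and a set of final states. A step from $(q,w,m)$ along an edge $(q,v,n,q')$ leads to $(q',wv,mn)$. The automaton accepts the words $w$ for which $(f,w,1)$ is reachable from $(q_0,\varepsilon,1)$ for some final state $f$. $\mathsf{VA}(M)$ is the class of languages accepted by valence automata over $M$, and $\mathsf{VA}(\mathcal M)=\bigcup_{M\in\mathcal M}\mathsf{VA}(M)$ for a class $\mathcal M$ of monoids. Let $\mathbb B=\langle a,\bar a\mid a\bar a=1\rangle$ be the bicyclic monoid, and let $\mathsf{SC}^{\pm}$ be the smallest isomorphism-closed class of monoids that contains $\mathbb B^n$ for every $n\ge 0$ and, with every $M$, also the free product $\mathbb B * M$ and the direct product $M\times\mathbb Z$. A $d$-dimensional labeled Petri net over $X$ consists of a finite set $T\subseteq (X\cup\{\varepsilon\})\times\mathbb Z^d$ of transitions, an initial marking $\mu_0\in\mathbb N^d$ and a finite set of final markings in $\mathbb N^d$. It generates the words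 $x_1\cdots x_n$ for which there are transitions $(x_i,\nu_i)\in T$ and markings $\mu_1,\dots,\mu_n\in\mathbb N^d$ with $\mu_i=\mu_{i-1}+\nu_i$ and $\mu_n$ final. Let $\mathsf P$ be the class of languages generated by labeled Petri nets (with any $d\ge 0$). For a class $\mathcal C$ of languages, the algebraic extension $\mathsf{Alg}(\mathcal C)$ is the class of languages generated by $\mathcal C$-grammars, that is, grammars with finitely many productions $(A,K)$, where $A$ is a nonterminal and $K\in\mathcal C$ is a language over the (disjoint) nonterminals and terminals, and where a derivation step replaces an occurrence of $A$ by some word of $K$. $\mathsf{HomSLI}(\mathcal C)$ is the class of languages $h(L\cap\Psi^{-1}(S))$, where $L\subseteq X^*$ is in $\mathcal C$, $h\colon X^*\to Y^*$ is a morphism, $\Psi\colon X^*\to\mathbb N^X$ is the Parikh map and $S\subseteq\mathbb N^X$ is semilinear. Let $$\mathsf F_0=\mathsf P,\qquad \mathsf F_{i+1}=\mathsf{HomSLI}(\mathsf{Alg}(\mathsf F_i)),\qquad \mathsf F=\bigcup_{i\ge 0}\mathsf F_i .$$ **Proposition.** $\mathsf{VA}(\mathsf{SC}^{\pm})=\mathsf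 F$. Moreover, this equality is effective. Represent a language in $\mathsf{VA}(\mathsf{SC}^{\pm})$ by an expression that builds a monoid in $\mathsf{SC}^{\pm}$ from some $\mathbb B^n$, together with a valence automaton whose monoid elements are given as words over the standard generators. Represent a language in $\mathsf F$ by a level $i$ together with a labeled Petri net if $i=0$, and otherwise with a grammar whose right-hand sides are given recursively by representations of languages in $\mathsf F_{i-1}$, a morphism, and a semilinear set given by base and period vectors. Then there are computable functions which turn a representation of a language in either class, over the alphabet with $k$ letters (where $k$ is part of the input), into a representation of the same language in the other class. -/

import Mathlib

namespace ValenceLang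

/-! ### Language classes -/

/-- A class of languages: for every alphabet (finite type of symbols) `X`, a set of languages
`L ⊆ X^*`. -/
def LangClass : Type 1 := (X : Type) → [Finite X] → Set (Language X)

/-! ### Valence automata -/

/-- A valence automaton over the monoid `M` with input alphabet `X`. -/
structure ValenceAutomaton (X M : Type) where
  Q : Type
  finite_Q : Finite Q
  edges : Set (Q × List X × M × Q)
  finite_edges : edges.Finite
  start : Q
  final : Set Q

/-- The one-step relation on the configurations `(q, w, m)`. -/
def ValenceAutomaton.Step {X M : Type} [Monoid M] (A : ValenceAutomaton X M)
    (c c' : A.Q × List X × M) : Prop :=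
  ∃ e ∈ A.edges, c.1 = e.1 ∧ c'.1 = e.2.2.2 ∧ c'.2.1 = c.2.1 ++ e.2.1 ∧
    c'.2.2 = c.2.2 * e.2.2.1

/-- The accepted language. -/
def ValenceAutomaton.lang {X M : Type} [Monoid M] (A : ValenceAutomaton X M) : Language X :=
  {w | ∃ f ∈ A.final, Relation.ReflTransGen A.Step (A.start, [], 1) (f, w, 1)}

/-- `VA(M)`. -/
def VA (M : Type) [Monoid M] : LangClass := fun X _ =>
  {L | ∃ A : ValenceAutomaton X M, A.lang = L}

/-! ### The monoids `SC±` -/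

/-- The relation `a ā = 1`, where `a` is `true` and `ā` is `false`. -/
inductive BicyclicRel : FreeMonoid Bool → FreeMonoid Bool → Prop
  | cancel : BicyclicRel (FreeMonoid.of true * FreeMonoid.of false) 1

/-- The bicyclic monoid `𝔹 = ⟨a, ā ∣ a ā = 1⟩`. -/
abbrev Bicyclic : Type := PresentedMonoid BicyclicRel

/-- The generator `a`. -/
def Bicyclic.a : Bicyclic := PresentedMonoid.of BicyclicRel true

/-- The generator `ā`. -/
def Bicyclic.abar : Bicyclic := PresentedMonoid.of BicyclicRel false

/-- `SC±`: the smallest isomorphism-closed class of monoids that contains every `𝔹^n` and is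
closed under `M ↦ 𝔹 * M` (free product) and `M ↦ M × ℤ`. -/
inductive SCpm : (M : Type) → Monoid M → Prop
  | bicyclic_pow (n : ℕ) : SCpm (Fin n → Bicyclic) inferInstance
  | stack (M : Type) [inst : Monoid M] : SCpm M inst → SCpm (Monoid.Coprod Bicyclic M) inferInstance
  | blind (M : Type) [inst : Monoid M] : SCpm M inst → SCpm (M × Multiplicative ℤ) inferInstance
  | iso (M N : Type) [instM : Monoid M] [instN : Monoid N] (e : M ≃* N) :
      SCpm M instM → SCpm N instN

/-- `VA(SC±)`, the union of the classes `VA(M)` over the monoids `M` in `SC±`. -/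
def VASCpm : LangClass := fun X _ =>
  {L | ∃ (M : Type) (inst : Monoid M), SCpm M inst ∧ L ∈ VA M X}

/-! ### Petri net languages -/

/-- A `d`-dimensional labeled Petri net with alphabet `X`; the label `none` is the empty word. -/
structure PetriNet (X : Type) (d : ℕ) where
  trans : Set (Option X × (Fin d → ℤ))
  finite_trans : trans.Finite
  init : Fin d → ℕ
  final : Set (Fin d → ℕ)
  finite_final : final.Finite

/-- `N.Run μ w μ'`: the word `w` labels a firing sequence from the marking `μ` to `μ'`. -/
inductive PetriNet.Run {X : Type} {d : ℕ} (N : PetriNet X d) :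
    (Fin d → ℕ) → List X → (Fin d → ℕ) → Prop
  | nil (μ : Fin d → ℕ) : N.Run μ [] μ
  | cons {μ μ' μ'' : Fin d → ℕ} {x : Option X} {ν : Fin d → ℤ} {w : List X} :
      (x, ν) ∈ N.trans → (∀ i, (μ' i : ℤ) = μ i + ν i) → N.Run μ' w μ'' →
      N.Run μ (x.toList ++ w) μ''

/-- The language generated by a labeled Petri net. -/
def PetriNet.lang {X : Type} {d : ℕ} (N : PetriNet X d) : Language X :=
  {w | ∃ μ ∈ N.final, N.Run N.init w μ}

/-- The class `P` of Petri net languages. -/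
def PetriLang : LangClass := fun X _ =>
  {L | ∃ (d : ℕ) (N : PetriNet X d), N.lang = L}

/-! ### Algebraic extensions -/

/-- A grammar with nonterminals `N`, terminals `T` and finitely many productions `(A, K)`, where
`K ⊆ (N ∪ T)^*` is a language of right-hand sides; `N ∪ T` is a disjoint union. -/
structure Grammar (N T : Type) where
  prods : Set (N × Language (N ⊕ T))
  finite_prods : prods.Finite
  start : N

/-- The one-step derivation relation. -/
def Grammar.Step {N T : Type} (G : Grammar N T) (x y : List (N ⊕ T)) : Prop :=
  ∃ p ∈ G.prods, ∃ u v, ∃ w ∈ p.2, x = u ++ [Sum.inl p.1] ++ v ∧ y = u ++ w ++ v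

/-- The generated language. -/
def Grammar.lang {N T : Type} (G : Grammar N T) : Language T :=
  {w | Relation.ReflTransGen G.Step [Sum.inl G.start] (w.map Sum.inr)}

/-- The algebraic extension `Alg(C)`: the languages generated by the grammars all of whose
right-hand sides belong to `C`. -/
def Alg (C : LangClass) : LangClass := fun X _ =>
  {L | ∃ (N : Type) (_ : Finite N) (G : Grammar N X),
    (∀ p ∈ G.prods, p.2 ∈ C (N ⊕ X)) ∧ G.lang = L}

/-! ### Semilinear intersections and morphisms -/

open Classical in
/-- The Parikh map `Ψ : X^* → X^⊕`. -/
noncomputable def parikh {X : Type} (w : List X) : X → ℕ := fun x => w.count x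

/-- The language `h(K ∩ Ψ⁻¹(S))`, where `h : X^* → Y^*` is the morphism that extends the given
map on letters. -/
def homSLIImage {X Y : Type} (h : X → List Y) (K : Language X) (S : Set (X → ℕ)) : Language Y :=
  {v | ∃ w ∈ K, parikh w ∈ S ∧ v = w.flatMap h}

/-- The class of the languages `h(K ∩ Ψ⁻¹(S))` with `K` in `C`, `S` semilinear and `h` a
morphism. -/
def HomSLI (C : LangClass) : LangClass := fun Y _ =>
  {L | ∃ (X : Type) (_ : Finite X) (h : X → List Y) (K : Language X) (S : Set (X → ℕ)),
    K ∈ C X ∧ IsSemilinearSet S ∧ homSLIImage h K S = L}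

/-! ### The hierarchy -/

/-- `F₀ = P` and `F_{i+1} = HomSLI(Alg(F_i))`. -/
def Flevel : ℕ → LangClass
  | 0 => PetriLang
  | i + 1 => HomSLI (Alg (Flevel i))

/-- `F = ⋃ F_i`. -/
def F : LangClass := fun X _ => {L | ∃ i, L ∈ Flevel i X}

/-! ### Finite representations

Equality of language classes is effective: from a finite representation of a language in one class
one can compute a finite representation of the same language in the other. The representations are
the obvious ones, over the alphabets `Fin k`; entries of a list that mention a letter, state or
nonterminal which does not exist are ignored. -/

/-- The word over `Fin k` given by a list of numbers. -/
def wordOf (k : ℕ) (l : List ℕ) : List (Fin k) :=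
  l.filterMap fun j => if h : j < k then some ⟨j, h⟩ else none

/-- The vector of length `d` given by a list, padded with zeros. -/
def vecOf {α : Type} [Zero α] (d : ℕ) (l : List α) : Fin d → α := fun i => l.getD i 0

/-- A monoid with a sequence of elements (which are going to generate it). -/
structure GenMonoid where
  carrier : Type
  monoid : Monoid carrier
  gen : ℕ → carrier

attribute [instance] GenMonoid.monoid

/-- The monoids in `SC±`, up to isomorphism, with generators. The list of operations is read from
the outside to the inside: `true` is `M ↦ 𝔹 * M` and `false` is `M ↦ M × ℤ`. In `𝔹^n`, the numbers
`2i` and `2i + 1` stand for `a` and `ā` of the `i`-th factor; each operation puts two new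
generators (`a` and `ā`, or `1` and `-1` of `ℤ`) in front of the old ones. -/
noncomputable def scMonoid (n : ℕ) : List Bool → GenMonoid
  | [] =>
    { carrier := Fin n → Bicyclic
      monoid := inferInstance
      gen := fun j => if h : j / 2 < n then
          Pi.mulSingle ⟨j / 2, h⟩ (if j % 2 = 0 then Bicyclic.a else Bicyclic.abar)
        else 1 }
  | true :: ops =>
    let G := scMonoid n ops
    { carrier := Monoid.Coprod Bicyclic G.carrier
      monoid := inferInstance
      gen := fun j => match j with
        | 0 => Monoid.Coprod.inl Bicyclic.a
        | 1 => Monoid.Coprod.inl Bicyclic.abar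
        | j + 2 => Monoid.Coprod.inr (G.gen j) }
  | false :: ops =>
    let G := scMonoid n ops
    { carrier := G.carrier × Multiplicative ℤ
      monoid := inferInstance
      gen := fun j => match j with
        | 0 => (1, Multiplicative.ofAdd 1)
        | 1 => (1, Multiplicative.ofAdd (-1))
        | j + 2 => (G.gen j, 1) }

/-- The element given by a word over the generators. -/
def GenMonoid.eval (G : GenMonoid) (u : List ℕ) : G.carrier :=
  (u.map G.gen).prod

/-- `(n, ops, r, edges, finals)`: a valence automaton over the monoid `scMonoid n ops` with the
states `0, …, r` and the initial state `0`. An edge is `(p, w, u, q)`, where `w` is the input word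
and `u` is a word over the generators of the monoid. -/
abbrev VACode : Type := ℕ × List Bool × ℕ × List (ℕ × List ℕ × List ℕ × ℕ) × List ℕ

/-- The valence automaton over the alphabet `Fin k` represented by a code. -/
def vaOfCode (k : ℕ) (G : GenMonoid) (r : ℕ) (edges : List (ℕ × List ℕ × List ℕ × ℕ))
    (finals : List ℕ) : ValenceAutomaton (Fin k) G.carrier where
  Q := Fin (r + 1)
  finite_Q := inferInstance
  edges := {e | ∃ u : List ℕ, ((e.1 : ℕ), e.2.1.map Fin.val, u, (e.2.2.2 : ℕ)) ∈ edges ∧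
    e.2.2.1 = G.eval u}
  finite_edges := by
    refine Set.Finite.subset ((edges.toFinset.finite_toSet).biUnion (t := fun t =>
      Set.univ ×ˢ ({wordOf k t.2.1} ×ˢ ({G.eval t.2.2.1} ×ˢ Set.univ))) fun t _ =>
        Set.finite_univ.prod ((Set.finite_singleton _).prod
          ((Set.finite_singleton _).prod Set.finite_univ))) ?_
    rintro ⟨p, w, m, q⟩ ⟨u, hu, rfl⟩
    simp only [Set.mem_iUnion]
    refine ⟨_, List.mem_toFinset.2 hu, ?_⟩
    have hw : wordOf k (w.map Fin.val) = w := by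
      induction w with
      | nil => rfl
      | cons x w ih => simp [wordOf, List.filterMap_map]
    simp [hw]
  start := 0
  final := {q | (q : ℕ) ∈ finals}

/-- The language over the alphabet `Fin k` represented by a code. -/
noncomputable def vaLang (k : ℕ) : VACode → Language (Fin k)
  | (n, ops, r, edges, finals) =>
    (vaOfCode k (scMonoid n ops) r edges finals).lang

/-- `(d, ts, init, finals)`: a `d`-dimensional labeled Petri net. -/
abbrev PetriCode : Type := ℕ × List (Option ℕ × List ℤ) × List ℕ × List (List ℕ)

/-- The Petri net with alphabet `Fin k` represented by a code. -/
def petriOfCode (k d : ℕ) (ts : List (Option ℕ × List ℤ)) (init : List ℕ)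
    (finals : List (List ℕ)) : PetriNet (Fin k) d where
  trans := {t | ∃ s ∈ ts, s.1 = t.1.map Fin.val ∧ t.2 = vecOf d s.2}
  finite_trans := by
    refine Set.Finite.subset ((ts.toFinset.finite_toSet).biUnion (t := fun s =>
      Set.univ ×ˢ {vecOf d s.2}) fun s _ => Set.finite_univ.prod (Set.finite_singleton _)) ?_
    rintro ⟨x, ν⟩ ⟨s, hs, -, rfl⟩
    simp only [Set.mem_iUnion]
    exact ⟨s, List.mem_toFinset.2 hs, by simp⟩
  init := vecOf d init
  final := {μ | ∃ l ∈ finals, μ = vecOf d l}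
  finite_final := by
    refine ((finals.toFinset.finite_toSet).image (vecOf d)).subset ?_
    rintro μ ⟨l, hl, rfl⟩
    exact ⟨l, List.mem_toFinset.2 hl, rfl⟩

/-- The language over the alphabet `Fin k` represented by a code. -/
def petriLang (k : ℕ) : PetriCode → Language (Fin k)
  | (d, ts, init, finals) => (petriOfCode k d ts init finals).lang

/-- The grammar with nonterminals `0, …, n`, start symbol `0` and terminals `Fin m` that has a
production `(A, K)` for every pair `(A, c)` in the list, where `K` is the language represented by
`c`. In `K`, the nonterminals are the letters `0, …, n` and the terminals are the
letters `n + 1, …, n + m`. -/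
def grammarOfCode (n m : ℕ) (prods : List (ℕ × ℕ)) (lang : ℕ → Language (Fin (n + 1 + m))) :
    Grammar (Fin (n + 1)) (Fin m) where
  prods := {p | ∃ c : ℕ, ((p.1 : ℕ), c) ∈ prods ∧ p.2 = {w | w.map finSumFinEquiv ∈ lang c}}
  finite_prods := by
    refine Set.Finite.subset ((prods.toFinset.finite_toSet).biUnion (t := fun s =>
      Set.univ ×ˢ {({w | w.map finSumFinEquiv ∈ lang s.2} : Language (Fin (n + 1) ⊕ Fin m))})
        fun s _ => Set.finite_univ.prod (Set.finite_singleton _)) ?_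
    rintro ⟨A, K⟩ ⟨c, hc, rfl⟩
    simp only [Set.mem_iUnion]
    exact ⟨_, List.mem_toFinset.2 hc, by simp⟩
  start := 0

/-- The semilinear set given by a list of linear sets, each of which is given by its base vector
and the list of its period vectors. -/
def semilinearOf (m : ℕ) (S : List (List ℕ × List (List ℕ))) : Set (Fin m → ℕ) :=
  {v | ∃ s ∈ S, ∃ x ∈ AddSubmonoid.closure {y | ∃ l ∈ s.2, y = vecOf m l},
    v = vecOf m s.1 + x}

/-- `(n, m, prods, hs, S)`: a grammar with productions `prods` (see `grammarOfCode`), the list `hs`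
of the images of the letters of `Fin m` under a morphism, and a semilinear set `S`. -/
abbrev StepCode : Type :=
  ℕ × ℕ × List (ℕ × ℕ) × List (List ℕ) × List (List ℕ × List (List ℕ))

/-- The language over the alphabet `Fin k` in the level `F_i` that is represented by the number
`c`. On level `0`, `c` is the Gödel number of a Petri net. On level `i + 1`, it is the Gödel number
of a `StepCode`, whose productions contain numbers that represent languages in `F_i`. -/
def fLang : ℕ → (k : ℕ) → ℕ → Language (Fin k)
  | 0, k, c => petriLang k (Denumerable.ofNat PetriCode c)
  | i + 1, k, c =>
    match Denumerable.ofNat StepCode c with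
    | (n, m, prods, hs, S) =>
      homSLIImage (fun x : Fin m => wordOf k (hs.getD x []))
        (grammarOfCode n m prods (fLang i (n + 1 + m))).lang (semilinearOf m S)

end ValenceLang

/-! ### Word problems of the monoids in `SC±` -/

namespace ValenceLang

/-! ### The bicyclic monoid as a counter -/

/-! Both inclusions are proved by explicit translations of codes. The equality of the classes then
follows by renaming every alphabet to some `Fin k` (`vaSCpm_eq_F`).

Triviality of a word over the generators is decided by a simple machine. For `𝔹` it is a counter
that never becomes negative and returns to zero (`bicyclic_prod_eq_one_iff`). For `M × ℤ` an
equality of two counts is added. For `𝔹 * M` it is a stack of elements of `M`, on which `a` pushes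
`1` and `ā` pops a trivial top. Hence a word over `𝔹 * M` is trivial exactly if deleting well-nested
blocks `a u ā` with trivial `u` leaves a trivial word over `M` (`stackGen_eval_eq_one_iff`).

From automata to the hierarchy, one operation of the monoid costs one level (`accepts_cons_iff`,
`fWord_codeTable_iff`). For `𝔹 * M` there is a nonterminal for every pair of states. On a path, each
outermost block `a u ā` shrinks to the letter that names the two states between which `u` runs. What
remains is a path over `M`, so the right-hand sides are languages of automata over `M`. For `M × ℤ`
the two generators of `ℤ` become marker letters; that they occur equally often is a semilinear
condition, and the morphism erases them. At `𝔹^n` an automaton is a Petri net with the state as a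
token (`fWord_netCode_iff`).

Conversely, a Petri net is an automaton over `𝔹^M` (`fWord_zero_iff`). A grammar whose right-hand
sides are given by automata over a monoid is run with a call stack over `𝔹 * (_ × ℤ)`: a call opens
a fresh copy of the monoid, and the `ℤ`-component stores the return address in unary
(`accepts_grammarEdges_iff`). The semilinear condition is checked by additional blind counters
(`accepts_imageEdges_iff`). All right-hand sides of a level need a common monoid; it exists because
a Gödel number bounds all parameters that occur in it (`fWord_edgeTable_iff`).

Both translations iterate the construction of finite tables and are therefore primitive recursive
(`primrec_levelCode`, `primrec_autCode`). -/

/-- The partial action of a generator of `𝔹` on the natural numbers. -/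
def counterStep : Bool → ℕ → Option ℕ
  | true, k => some (k + 1)
  | false, 0 => none
  | false, k + 1 => some k

/-- The partial action of a word over the generators of `𝔹` on the natural numbers. -/
def counterRun : List Bool → ℕ → Option ℕ
  | [], k => some k
  | b :: u, k => (counterStep b k).bind (counterRun u)

theorem counterRun_append (u v : List Bool) (k : ℕ) :
    counterRun (u ++ v) k = (counterRun u k).bind (counterRun v) := by
  induction u generalizing k with
  | nil => rfl
  | cons b u ih =>
    simp only [List.cons_append, counterRun]
    cases counterStep b k with
    | none => rfl
    | some k' => simp [ih]

/-- The transformations which are given by the generators of `𝔹`. -/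
def counterEnd (b : Bool) : Function.End (Option ℕ) := fun o => o.bind (counterStep b)

/-- The partial action of `𝔹` on the natural numbers. -/
noncomputable def counterHom : Bicyclic →* (Function.End (Option ℕ))ᵐᵒᵖ :=
  -- The first letter of a word has to act first, so the action is a homomorphism into the opposite
  -- of the monoid of endomaps.
  PresentedMonoid.lift (fun b => MulOpposite.op (counterEnd b)) (by
    rintro _ _ ⟨⟩
    simp only [map_mul, FreeMonoid.lift_eval_of, map_one]
    apply MulOpposite.unop_injective
    funext o
    cases o <;> rfl)

theorem counterHom_prod (u : List Bool) (o : Option ℕ) :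
    (counterHom (u.map (PresentedMonoid.of BicyclicRel)).prod).unop o =
      o.bind (counterRun u) := by
  induction u generalizing o with
  | nil => cases o <;> simp [counterRun] <;> rfl
  | cons b u ih =>
    have h : (counterHom (PresentedMonoid.of BicyclicRel b)).unop o = o.bind (counterStep b) := by
      simp [counterHom]; rfl
    rw [List.map_cons, List.prod_cons, map_mul, MulOpposite.unop_mul]
    change (counterHom _).unop ((counterHom _).unop o) = _
    rw [h, ih]
    cases o <;> rfl

theorem Bicyclic.a_mul_abar : Bicyclic.a * Bicyclic.abar = 1 :=
  PresentedMonoid.mk_eq_mk_of_rel BicyclicRel.cancel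

/-- The counter value `k` is recorded as `a ^ k`: a push appends an `a`, and a successful pop
cancels the last `a` against `ā`. -/
theorem pow_mul_prod_of_counterRun {u : List Bool} {k k' : ℕ} (h : counterRun u k = some k') :
    Bicyclic.a ^ k * (u.map (PresentedMonoid.of BicyclicRel)).prod = Bicyclic.a ^ k' := by
  induction u generalizing k with
  | nil => simp_all [counterRun]
  | cons b u ih =>
    rw [List.map_cons, List.prod_cons, ← mul_assoc]
    cases b with
    | true =>
      rw [← ih (k := k + 1) h, pow_succ]; rfl
    | false =>
      cases k with
      | zero => simp [counterRun, counterStep] at h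
      | succ k =>
        rw [← ih (k := k) h, pow_succ]
        change Bicyclic.a ^ k * Bicyclic.a * Bicyclic.abar * _ = _
        rw [mul_assoc (Bicyclic.a ^ k), Bicyclic.a_mul_abar, mul_one]

/-- The neutral element fixes the counter value `0`, which gives one direction. The other is the
case `k = k' = 0` of `pow_mul_prod_of_counterRun`. -/
theorem bicyclic_prod_eq_one_iff (u : List Bool) :
    (u.map (PresentedMonoid.of BicyclicRel)).prod = 1 ↔ counterRun u 0 = some 0 := by
  constructor
  · intro h
    have := counterHom_prod u (some 0)
    rw [h, map_one] at this
    exact this.symm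
  · intro h
    simpa using pow_mul_prod_of_counterRun h

/-! ### The three constructions of `SC±` -/

/-- `𝔹^n` with its generators. -/
noncomputable abbrev powGen (n : ℕ) : GenMonoid where
  carrier := Fin n → Bicyclic
  monoid := inferInstance
  gen := fun j => if h : j / 2 < n then
      Pi.mulSingle ⟨j / 2, h⟩ (if j % 2 = 0 then Bicyclic.a else Bicyclic.abar)
    else 1

/-- `𝔹 * M` with its generators. -/
noncomputable abbrev stackGen (G : GenMonoid) : GenMonoid where
  carrier := Monoid.Coprod Bicyclic G.carrier
  monoid := inferInstance
  gen := fun j => match j with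
    | 0 => Monoid.Coprod.inl Bicyclic.a
    | 1 => Monoid.Coprod.inl Bicyclic.abar
    | j + 2 => Monoid.Coprod.inr (G.gen j)

/-- `M × ℤ` with its generators. -/
abbrev blindGen (G : GenMonoid) : GenMonoid where
  carrier := G.carrier × Multiplicative ℤ
  monoid := inferInstance
  gen := fun j => match j with
    | 0 => (1, Multiplicative.ofAdd 1)
    | 1 => (1, Multiplicative.ofAdd (-1))
    | j + 2 => (G.gen j, 1)

theorem scMonoid_true (n : ℕ) (ops : List Bool) :
    scMonoid n (true :: ops) = stackGen (scMonoid n ops) := rfl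
theorem scMonoid_false (n : ℕ) (ops : List Bool) :
    scMonoid n (false :: ops) = blindGen (scMonoid n ops) := rfl

@[simp] theorem GenMonoid.eval_nil (G : GenMonoid) : G.eval [] = 1 := rfl
@[simp] theorem GenMonoid.eval_append (G : GenMonoid) (u v : List ℕ) :
    G.eval (u ++ v) = G.eval u * G.eval v := by simp [GenMonoid.eval]
@[simp] theorem GenMonoid.eval_cons (G : GenMonoid) (j : ℕ) (v : List ℕ) :
    G.eval (j :: v) = G.gen j * G.eval v := by simp [GenMonoid.eval]

/-- The effect of a word over the generators of `𝔹^n` on the counter `i`. -/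
def coordWord (i : ℕ) (u : List ℕ) : List Bool :=
  u.filterMap fun j => if j / 2 = i then some (decide (j % 2 = 0)) else none

@[simp] theorem coordWord_append (i : ℕ) (u v : List ℕ) :
    coordWord i (u ++ v) = coordWord i u ++ coordWord i v := by simp [coordWord]

theorem powGen_eval_apply (n : ℕ) (u : List ℕ) (i : Fin n) :
    (powGen n).eval u i = ((coordWord i u).map (PresentedMonoid.of BicyclicRel)).prod := by
  induction u with
  | nil => rfl
  | cons j u ih =>
    have h1 : (powGen n).eval (j :: u) i = (powGen n).gen j i * (powGen n).eval u i := by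
      rw [GenMonoid.eval_cons]; rfl
    rw [h1, ih]
    have h2 : (powGen n).gen j i = if j / 2 = (i : ℕ) then
        PresentedMonoid.of BicyclicRel (decide (j % 2 = 0)) else 1 := by
      simp only
      by_cases hi : j / 2 = (i : ℕ)
      · have hj : j / 2 < n := hi ▸ i.2
        have : i = ⟨j / 2, hj⟩ := Fin.ext hi.symm
        rw [dif_pos hj, if_pos hi, this, Pi.mulSingle_eq_same]
        by_cases h : j % 2 = 0 <;> simp [h, Bicyclic.a, Bicyclic.abar]
      · rw [if_neg hi]
        split_ifs with hj
        · rw [Pi.mulSingle_eq_of_ne]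
          intro h; exact hi (by rw [h])
        all_goals first | rfl | (rw [Pi.mulSingle_eq_of_ne]; intro h; exact hi (by rw [h]))
    rw [h2]
    by_cases hi : j / 2 = (i : ℕ) <;> simp [coordWord, hi]

theorem powGen_eval_eq_one_iff (n : ℕ) (u : List ℕ) :
    (powGen n).eval u = 1 ↔ ∀ i < n, counterRun (coordWord i u) 0 = some 0 := by
  constructor
  · intro h i hi
    rw [← bicyclic_prod_eq_one_iff, ← powGen_eval_apply n u ⟨i, hi⟩, h]; rfl
  · intro h
    funext i
    rw [powGen_eval_apply, (bicyclic_prod_eq_one_iff _).2 (h i i.2)]; rfl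

/-- The subword of the generators from `d` on, renumbered. -/
def dropGens (d : ℕ) (u : List ℕ) : List ℕ :=
  u.filterMap fun j => if d ≤ j then some (j - d) else none

@[simp] theorem dropGens_append (d : ℕ) (u v : List ℕ) :
    dropGens d (u ++ v) = dropGens d u ++ dropGens d v := by simp [dropGens]

theorem blindGen_eval (G : GenMonoid) (u : List ℕ) :
    (blindGen G).eval u =
      (G.eval (dropGens 2 u), Multiplicative.ofAdd ((u.count 0 : ℤ) - u.count 1)) := by
  induction u with
  | nil => rfl
  | cons j u ih =>
    rw [GenMonoid.eval_cons, ih]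
    match j with
    | 0 =>
      refine Prod.ext (one_mul _) ?_
      change Multiplicative.ofAdd ((1 : ℤ) + _) = _
      congr 1; simp; ring
    | 1 =>
      refine Prod.ext (one_mul _) ?_
      change Multiplicative.ofAdd ((-1 : ℤ) + _) = _
      congr 1; simp; ring
    | j + 2 =>
      refine Prod.ext ?_ ?_
      · simp [dropGens]
      · change (1 : Multiplicative ℤ) * _ = _
        simp

theorem blindGen_eval_eq_one_iff (G : GenMonoid) (u : List ℕ) :
    (blindGen G).eval u = 1 ↔ G.eval (dropGens 2 u) = 1 ∧ u.count 0 = u.count 1 := by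
  rw [blindGen_eval]
  refine Prod.ext_iff.trans ?_
  refine and_congr Iff.rfl ?_
  change (_ : Multiplicative ℤ) = Multiplicative.ofAdd 0 ↔ _
  rw [Multiplicative.ofAdd.injective.eq_iff]
  omega

/-! ### `𝔹 * M` as a stack -/

/-- The partial action of a generator of `𝔹` on stacks (with their top element in front): `a`
pushes the neutral element and `ā` pops it. -/
noncomputable def stackStep {M : Type} [Monoid M] : Bool → M × List M → Option (M × List M)
  | true, (x, st) => some (1, x :: st)
  | false, (_, []) => none
  | false, (x, y :: st) => by classical exact if x = 1 then some (y, st) else none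

/-- The transformations which are given by the generators of `𝔹`. -/
noncomputable def stackEnd (M : Type) [Monoid M] (b : Bool) :
    Function.End (Option (M × List M)) :=
  fun o => o.bind (stackStep b)

/-- The action of an element of `M` on the top of a stack. -/
def topEnd {M : Type} [Monoid M] (m : M) : Function.End (Option (M × List M)) :=
  fun o => o.map fun p => (p.1 * m, p.2)

/-- The partial action of `𝔹 * M` on stacks. -/
noncomputable def stackHom (M : Type) [Monoid M] :
    Monoid.Coprod Bicyclic M →* (Function.End (Option (M × List M)))ᵐᵒᵖ :=
  Monoid.Coprod.lift
    (PresentedMonoid.lift (fun b => MulOpposite.op (stackEnd M b)) (by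
        rintro _ _ ⟨⟩
        simp only [map_mul, FreeMonoid.lift_eval_of, map_one]
        apply MulOpposite.unop_injective
        funext o
        rcases o with _ | ⟨x, st⟩
        · rfl
        · change (stackStep true (x, st)).bind (stackStep false) = some (x, st)
          simp [stackStep]))
    { toFun := fun m => MulOpposite.op (topEnd m)
      map_one' := by
        apply MulOpposite.unop_injective
        funext o
        change Option.map _ o = o
        cases o <;> simp
      map_mul' := fun m m' => by
        apply MulOpposite.unop_injective
        funext o
        change Option.map _ o = Option.map _ (Option.map _ o)
        cases o <;> simp [mul_assoc] }

variable (G : GenMonoid)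

/-- The partial action of the words over the generators of `𝔹 * M` on stacks. -/
noncomputable def stackRun (u : List ℕ) (o : Option (G.carrier × List G.carrier)) :
    Option (G.carrier × List G.carrier) :=
  (stackHom G.carrier ((stackGen G).eval u)).unop o

@[simp] theorem stackRun_nil (o) : stackRun G [] o = o := by
  rw [stackRun, GenMonoid.eval_nil]
  change (stackHom G.carrier 1).unop o = o
  rw [map_one]; rfl

theorem stackRun_append (u v : List ℕ) (o) :
    stackRun G (u ++ v) o = stackRun G v (stackRun G u o) := by
  rw [stackRun, GenMonoid.eval_append, map_mul]; rfl

theorem stackRun_zero (o) : stackRun G [0] o = o.bind (stackStep true) := by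
  rw [stackRun, GenMonoid.eval_cons, GenMonoid.eval_nil, mul_one]
  change (stackHom G.carrier (Monoid.Coprod.inl Bicyclic.a)).unop o = _
  rw [stackHom, Monoid.Coprod.lift_apply_inl]
  rfl

theorem stackRun_one (o) : stackRun G [1] o = o.bind (stackStep false) := by
  rw [stackRun, GenMonoid.eval_cons, GenMonoid.eval_nil, mul_one]
  change (stackHom G.carrier (Monoid.Coprod.inl Bicyclic.abar)).unop o = _
  rw [stackHom, Monoid.Coprod.lift_apply_inl]
  rfl

theorem stackGen_eval_add_two (v : List ℕ) :
    (stackGen G).eval (v.map (· + 2)) = Monoid.Coprod.inr (G.eval v) := by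
  induction v with
  | nil => exact (map_one _).symm
  | cons j v ih => rw [List.map_cons, GenMonoid.eval_cons, GenMonoid.eval_cons, ih, map_mul]

theorem stackRun_add_two (v : List ℕ) (o) :
    stackRun G (v.map (· + 2)) o = o.map fun p => (p.1 * G.eval v, p.2) := by
  rw [stackRun, stackGen_eval_add_two, stackHom, Monoid.Coprod.lift_apply_inr]
  rfl

theorem stackRun_none (u : List ℕ) : stackRun G u none = none := by
  induction u with
  | nil => exact stackRun_nil G _
  | cons j u ih =>
    rw [← List.singleton_append, stackRun_append]
    match j with
    | 0 => rw [stackRun_zero]; exact ih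
    | 1 => rw [stackRun_one]; exact ih
    | j + 2 =>
      rw [show [j + 2] = [j].map (· + 2) from rfl, stackRun_add_two]; exact ih

theorem stackRun_of_eval_eq_one {u : List ℕ} (h : (stackGen G).eval u = 1) (o) :
    stackRun G u o = o := by
  rw [stackRun, h, map_one]; rfl

theorem stackStep_false_eq_some {M : Type} [Monoid M] {p q : M × List M} :
    stackStep false p = some q ↔ p = (1, q.1 :: q.2) := by
  rcases p with ⟨x, _ | ⟨y, st⟩⟩ <;> simp [stackStep, Prod.ext_iff]

/-- `G.Reduces u v`: the word `u` over the generators of `𝔹 * M` reduces to the word `v` over the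
generators of `M`. -/
inductive GenMonoid.Reduces : List ℕ → List ℕ → Prop
  | nil : Reduces [] []
  | gen {u v : List ℕ} (j : ℕ) : Reduces u v → Reduces (u ++ [j + 2]) (v ++ [j])
  | block {u v u' v' : List ℕ} : Reduces u v → Reduces u' v' → G.eval v' = 1 →
      Reduces (u ++ ([0] ++ u' ++ [1])) v

variable {G}

theorem GenMonoid.Reduces.append {u v u' v' : List ℕ} (h : G.Reduces u v) (h' : G.Reduces u' v') :
    G.Reduces (u ++ u') (v ++ v') := by
  induction h' with
  | nil => simpa using h
  | gen j _ ih => simpa [← List.append_assoc] using ih.gen j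
  | block _ h2 h3 ih _ => rw [← List.append_assoc]; exact ih.block h2 h3

theorem GenMonoid.Reduces.eval_eq {u v : List ℕ} (h : G.Reduces u v) :
    (stackGen G).eval u = Monoid.Coprod.inr (G.eval v) := by
  induction h with
  | nil => exact (map_one _).symm
  | gen j _ ih =>
    rw [GenMonoid.eval_append, ih, GenMonoid.eval_append, map_mul, GenMonoid.eval_cons,
      GenMonoid.eval_cons, GenMonoid.eval_nil, GenMonoid.eval_nil, mul_one, mul_one]
  | block _ _ h3 ih ih' =>
    rw [GenMonoid.eval_append, ih, GenMonoid.eval_append, GenMonoid.eval_append, ih', h3, map_one,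
      GenMonoid.eval_cons, GenMonoid.eval_cons, GenMonoid.eval_nil, mul_one, mul_one, mul_one,
      ← map_mul, Bicyclic.a_mul_abar, map_one, mul_one]

/-- The words that lead from the stack with one trivial entry to a given stack. -/
inductive GenMonoid.Pushes (G : GenMonoid) : List ℕ → G.carrier → List G.carrier → Prop
  | base {u v : List ℕ} : G.Reduces u v → Pushes G u (G.eval v) []
  | push {u u' v' : List ℕ} {x : G.carrier} {st : List G.carrier} : Pushes G u x st →
      G.Reduces u' v' → Pushes G (u ++ [0] ++ u') (G.eval v') (x :: st)

theorem GenMonoid.Pushes.gen {u : List ℕ} {x : G.carrier} {st : List G.carrier} (j : ℕ)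
    (h : G.Pushes u x st) : G.Pushes (u ++ [j + 2]) (x * G.gen j) st := by
  cases h with
  | base h => simpa using Pushes.base (h.gen j)
  | push h h' => simpa using h.push (h'.gen j)

/-- A pop needs the top `1`, so the last segment is trivial in `M`. With the push before it and the
new pop after it, it becomes a block of the segment below. -/
theorem GenMonoid.Pushes.pop {u : List ℕ} {x : G.carrier} {st : List G.carrier}
    (h : G.Pushes u 1 (x :: st)) : G.Pushes (u ++ [1]) x st := by
  generalize h1 : (1 : G.carrier) = y at h
  cases h with
  | push h h' =>
    cases h with
    | base h => simpa using Pushes.base (h.block h' h1.symm)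
    | push h h'' => simpa using h.push (h''.block h' h1.symm)

/-- The stack records the unmatched pushes: they cut `u` into segments, and each entry is the value
of one reduced segment. One more generator extends the last segment, opens a new one, or closes the
last one as a block. -/
theorem pushes_of_stackRun {u : List ℕ} {p : G.carrier × List G.carrier}
    (h : stackRun G u (some (1, [])) = some p) : G.Pushes u p.1 p.2 := by
  induction u using List.reverseRecOn generalizing p with
  | nil =>
    rw [stackRun_nil] at h
    cases h
    exact GenMonoid.Pushes.base GenMonoid.Reduces.nil
  | append_singleton u j ih =>
    rw [stackRun_append] at h
    rcases ho : stackRun G u (some (1, [])) with _ | p'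
    · rw [ho, stackRun_none] at h; cases h
    rw [ho] at h
    match j with
    | 0 =>
      rw [stackRun_zero] at h
      cases h
      simpa using (ih ho).push GenMonoid.Reduces.nil
    | 1 =>
      rw [stackRun_one] at h
      have := stackStep_false_eq_some.1 h
      subst this
      exact (ih ho).pop
    | j + 2 =>
      rw [show [j + 2] = [j].map (· + 2) from rfl, stackRun_add_two] at h
      cases h
      simpa using (ih ho).gen j

/-- A trivial word acts trivially on the stack with the single entry `1`, so it has no unmatched
push and is itself one reducible segment. Conversely, reductions preserve the value by
`GenMonoid.Reduces.eval_eq`. -/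
theorem stackGen_eval_eq_one_iff (u : List ℕ) :
    (stackGen G).eval u = 1 ↔ ∃ v, G.Reduces u v ∧ G.eval v = 1 := by
  constructor
  · intro h
    have := pushes_of_stackRun (stackRun_of_eval_eq_one G h (some (1, [])))
    generalize h1 : ((1, []) : G.carrier × List G.carrier) = p at this
    rcases p with ⟨x, st⟩
    cases this with
    | base h => exact ⟨_, h, (Prod.ext_iff.1 h1).1.symm⟩
    | push => simp at h1
  · rintro ⟨v, h, hv⟩
    rw [h.eval_eq, hv, map_one]

end ValenceLang

/-! ### Normal forms of automata and grammars over the natural numbers -/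

namespace ValenceLang

/-! ### Paths -/

/-- An edge of an automaton with natural numbers as states: source, input word, word over the
generators of the monoid, target. -/
abbrev Edge : Type := ℕ × List ℕ × List ℕ × ℕ

/-- `Path E s w u t`: a path from `s` to `t` with the input `w` and the word `u` of generators. -/
inductive Path (E : List Edge) : ℕ → List ℕ → List ℕ → ℕ → Prop
  | nil (s : ℕ) : Path E s [] [] s
  | cons {s t q : ℕ} {w u w' u' : List ℕ} : (s, w, u, t) ∈ E → Path E t w' u' q →
      Path E s (w ++ w') (u ++ u') q

/-- Acceptance of the word `w` between two states. -/
def Accepts (G : GenMonoid) (E : List Edge) (s t : ℕ) (w : List ℕ) : Prop :=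
  ∃ u, Path E s w u t ∧ G.eval u = 1

/-- Every edge carries at most one letter or generator. -/
def Elementary (E : List Edge) : Prop :=
  ∀ e ∈ E, e.2.1.length + e.2.2.1.length ≤ 1

variable {E E' : List Edge}

theorem Path.single {s t : ℕ} {w u : List ℕ} (h : (s, w, u, t) ∈ E) : Path E s w u t := by
  simpa using Path.cons h (Path.nil t)

theorem Path.append {s t q : ℕ} {w u w' u' : List ℕ} (h : Path E s w u t)
    (h' : Path E t w' u' q) : Path E s (w ++ w') (u ++ u') q := by
  induction h with
  | nil => exact h'
  | cons he _ ih => rw [List.append_assoc, List.append_assoc]; exact Path.cons he (ih h')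

theorem Path.snoc {s t q : ℕ} {w u w' u' : List ℕ} (h : Path E s w u t)
    (h' : (t, w', u', q) ∈ E) : Path E s (w ++ w') (u ++ u') q :=
  h.append (Path.single h')

/-- `Path` grows at the front, whereas stacks and reductions grow at the back; arguments about the
latter need this induction. -/
theorem Path.snoc_induction {s : ℕ} {motive : List ℕ → List ℕ → ℕ → Prop}
    (nil : motive [] [] s)
    (snoc : ∀ {w u t w' u' q}, Path E s w u t → motive w u t → (t, w', u', q) ∈ E →
      motive (w ++ w') (u ++ u') q)
    {w u : List ℕ} {t : ℕ} (h : Path E s w u t) : motive w u t := by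
  suffices H : ∀ {a w u t}, Path E a w u t → ∀ w₀ u₀, Path E s w₀ u₀ a → motive w₀ u₀ a →
      motive (w₀ ++ w) (u₀ ++ u) t from H h [] [] (Path.nil s) nil
  intro a w u t h
  induction h with
  | nil => intro w₀ u₀ _ hm; simpa using hm
  | cons he _ ih =>
    intro w₀ u₀ hp hm
    rw [← List.append_assoc, ← List.append_assoc]
    exact ih _ _ (hp.snoc he) (snoc hp hm he)

theorem Elementary.cases (hE : Elementary E) {s t : ℕ} {w u : List ℕ} (h : (s, w, u, t) ∈ E) :
    (w = [] ∧ u = []) ∨ (∃ x, w = [x] ∧ u = []) ∨ ∃ j, w = [] ∧ u = [j] := by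
  have := hE _ h
  rcases w with _ | ⟨x, _ | ⟨y, w⟩⟩ <;> rcases u with _ | ⟨j, _ | ⟨j', u⟩⟩ <;>
    simp at this ⊢
  omega

/-- Since an edge carries at most one generator, a cut of the generator word never falls inside an
edge and is thus realised at a state. This is what elementary edges are for. -/
theorem Path.split_gens (hE : Elementary E) {s q : ℕ} {w u : List ℕ} (h : Path E s w u q) :
    ∀ u₁ u₂, u = u₁ ++ u₂ →
      ∃ t w₁ w₂, w = w₁ ++ w₂ ∧ Path E s w₁ u₁ t ∧ Path E t w₂ u₂ q := by
  induction h with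
  | nil s =>
    intro u₁ u₂ h
    obtain ⟨rfl, rfl⟩ := List.append_eq_nil_iff.1 h.symm
    exact ⟨s, [], [], rfl, Path.nil s, Path.nil s⟩
  | @cons s t q w u w' u' he hp ih =>
    intro u₁ u₂ h
    rcases hE.cases he with ⟨rfl, rfl⟩ | ⟨x, rfl, rfl⟩ | ⟨j, rfl, rfl⟩
    · obtain ⟨t', w₁, w₂, rfl, h1, h2⟩ := ih u₁ u₂ h
      exact ⟨t', w₁, w₂, rfl, by simpa using Path.cons he h1, h2⟩
    · obtain ⟨t', w₁, w₂, rfl, h1, h2⟩ := ih u₁ u₂ h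
      exact ⟨t', x :: w₁, w₂, rfl, by simpa using Path.cons he h1, h2⟩
    · rcases u₁ with _ | ⟨j', u₁⟩
      · refine ⟨s, [], w', rfl, Path.nil s, ?_⟩
        rw [List.nil_append] at h
        rw [← h]
        simpa using Path.cons he hp
      · simp only [List.cons_append, List.nil_append, List.cons.injEq] at h
        obtain ⟨rfl, h⟩ := h
        obtain ⟨t', w₁, w₂, rfl, h1, h2⟩ := ih u₁ u₂ h
        exact ⟨t', w₁, w₂, rfl, by simpa using Path.cons he h1, h2⟩

theorem Path.cons_gen (hE : Elementary E) {s q : ℕ} {w u₀ u : List ℕ} {j : ℕ}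
    (h : Path E s w u₀ q) (hu : u₀ = j :: u) :
    ∃ a b w₁ w₂, w = w₁ ++ w₂ ∧ Path E s w₁ [] a ∧ (a, [], [j], b) ∈ E ∧ Path E b w₂ u q := by
  induction h with
  | nil s => cases hu
  | @cons s t q w u w' u' he hp ih =>
    rcases hE.cases he with ⟨rfl, rfl⟩ | ⟨x, rfl, rfl⟩ | ⟨j, rfl, rfl⟩
    · obtain ⟨a, b, w₁, w₂, rfl, h1, h2⟩ := ih hu
      exact ⟨a, b, w₁, w₂, rfl, by simpa using Path.cons he h1, h2⟩
    · obtain ⟨a, b, w₁, w₂, rfl, h1, h2⟩ := ih hu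
      exact ⟨a, b, x :: w₁, w₂, rfl, by simpa using Path.cons he h1, h2⟩
    · simp only [List.cons_append, List.nil_append, List.cons.injEq] at hu
      obtain ⟨rfl, rfl⟩ := hu
      exact ⟨s, t, [], w', rfl, Path.nil s, he, hp⟩

theorem Path.snoc_gen (hE : Elementary E) {s q : ℕ} {w u : List ℕ} {j : ℕ}
    (h : Path E s w (u ++ [j]) q) :
    ∃ a b w₁ w₂, w = w₁ ++ w₂ ∧ Path E s w₁ u a ∧ (a, [], [j], b) ∈ E ∧ Path E b w₂ [] q := by
  obtain ⟨t, w₁, w₂, rfl, h1, h2⟩ := h.split_gens hE _ _ rfl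
  obtain ⟨a, b, w₃, w₄, rfl, h3, h4, h5⟩ := h2.cons_gen hE rfl
  exact ⟨a, b, w₁ ++ w₃, w₄, by simp, by simpa using h1.append h3, h4, h5⟩

theorem Path.cons_input (hE : Elementary E) {s q : ℕ} {w₀ w u : List ℕ} {x : ℕ}
    (h : Path E s w₀ u q) (hw : w₀ = x :: w) :
    ∃ a b u₁ u₂, u = u₁ ++ u₂ ∧ Path E s [] u₁ a ∧ (a, [x], [], b) ∈ E ∧ Path E b w u₂ q := by
  induction h with
  | nil s => cases hw
  | @cons s t q w u w' u' he hp ih =>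
    rcases hE.cases he with ⟨rfl, rfl⟩ | ⟨x, rfl, rfl⟩ | ⟨j, rfl, rfl⟩
    · obtain ⟨a, b, w₁, w₂, rfl, h1, h2⟩ := ih hw
      exact ⟨a, b, w₁, w₂, rfl, by simpa using Path.cons he h1, h2⟩
    · simp only [List.cons_append, List.nil_append, List.cons.injEq] at hw
      obtain ⟨rfl, rfl⟩ := hw
      exact ⟨s, t, [], u', rfl, Path.nil s, he, hp⟩
    · obtain ⟨a, b, w₁, w₂, rfl, h1, h2⟩ := ih hw
      exact ⟨a, b, j :: w₁, w₂, rfl, by simpa using Path.cons he h1, h2⟩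

/-- The path relation only depends on the set of edges. -/
theorem Path.mono {s t : ℕ} {w u : List ℕ} (h : Path E s w u t)
    (hE : ∀ e ∈ E, e ∈ E') : Path E' s w u t := by
  induction h with
  | nil s => exact Path.nil s
  | cons he _ ih => exact Path.cons (hE _ he) ih

/-! ### Elementary automata -/

/-- The state in which the input `w` and the generators `u` have to be processed before the state
`q` is reached. -/
def pendingState (w u : List ℕ) (q : ℕ) : ℕ := Encodable.encode (w, u, q)

theorem pendingState_inj {w u w' u' : List ℕ} {q q' : ℕ} :
    pendingState w u q = pendingState w' u' q' ↔ w = w' ∧ u = u' ∧ q = q' := by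
  simp [pendingState]

/-- A path of elementary edges that replaces an edge. -/
def splitEdge (e : Edge) : List Edge :=
  (pendingState [] [] e.1, [], [], pendingState e.2.1 e.2.2.1 e.2.2.2) ::
    (((List.range e.2.1.length).map fun i =>
      (pendingState (e.2.1.drop i) e.2.2.1 e.2.2.2, (e.2.1.drop i).take 1, [],
        pendingState (e.2.1.drop (i + 1)) e.2.2.1 e.2.2.2)) ++
    (List.range e.2.2.1.length).map fun i =>
      (pendingState [] (e.2.2.1.drop i) e.2.2.2, [], (e.2.2.1.drop i).take 1,
        pendingState [] (e.2.2.1.drop (i + 1)) e.2.2.2))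

/-- An equivalent automaton with elementary edges. -/
def splitEdges (E : List Edge) : List Edge := E.flatMap splitEdge

theorem mem_splitEdge {p q s t : ℕ} {w u w' u' : List ℕ} :
    (s, w', u', t) ∈ splitEdge (p, w, u, q) ↔
      (s = pendingState [] [] p ∧ w' = [] ∧ u' = [] ∧ t = pendingState w u q) ∨
      (∃ x v, x :: v <:+ w ∧ s = pendingState (x :: v) u q ∧ w' = [x] ∧ u' = [] ∧
        t = pendingState v u q) ∨
      (∃ j v, j :: v <:+ u ∧ s = pendingState [] (j :: v) q ∧ w' = [] ∧ u' = [j] ∧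
        t = pendingState [] v q) := by
  -- Positions in a list are traded for its nonempty suffixes, on which one can do induction.
  have key : ∀ (l : List ℕ) (Q : List ℕ → List ℕ → List ℕ → Prop),
      (∃ i < l.length, Q (l.drop i) ((l.drop i).take 1) (l.drop (i + 1))) ↔
        ∃ x v, x :: v <:+ l ∧ Q (x :: v) [x] v := by
    intro l Q
    constructor
    · rintro ⟨i, hi, h⟩
      rw [List.drop_eq_getElem_cons hi] at h
      exact ⟨_, _, List.drop_eq_getElem_cons hi ▸ List.drop_suffix i l, h⟩
    · rintro ⟨x, v, ⟨l', rfl⟩, h⟩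
      refine ⟨l'.length, by simp, ?_⟩
      rw [← List.drop_drop]
      simpa using h
  simp only [splitEdge, List.mem_cons, List.mem_append, List.mem_map, List.mem_range,
    Prod.mk.injEq]
  refine or_congr Iff.rfl (or_congr ?_ ?_)
  · rw [← key w fun a b c => s = pendingState a u q ∧ w' = b ∧ u' = [] ∧ t = pendingState c u q]
    constructor <;> rintro ⟨i, hi, h1, h2, h3, h4⟩ <;> exact ⟨i, hi, h1.symm, h2.symm, h3.symm, h4.symm⟩
  · rw [← key u fun a b c => s = pendingState [] a q ∧ w' = [] ∧ u' = b ∧ t = pendingState [] c q]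
    constructor <;> rintro ⟨i, hi, h1, h2, h3, h4⟩ <;> exact ⟨i, hi, h1.symm, h2.symm, h3.symm, h4.symm⟩

theorem elementary_splitEdges (E : List Edge) : Elementary (splitEdges E) := by
  rintro ⟨s, w', u', t⟩ h
  obtain ⟨⟨p, w, u, q⟩, -, h⟩ := List.mem_flatMap.1 h
  rcases mem_splitEdge.1 h with ⟨-, rfl, rfl, -⟩ | ⟨x, v, -, -, rfl, rfl, -⟩ |
    ⟨x, v, -, -, rfl, rfl, -⟩ <;> simp

/-- From the state `pendingState w₀ u₀ q₀` with pending work, the only way on is to process the next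
letter or generator, because the encoding is injective. So `w₀` and `u₀` are finished before the
next edge of `E` is chosen at `q₀`. -/
theorem Path.of_splitEdges {s t : ℕ} {w u : List ℕ} (h : Path (splitEdges E) s w u t)
    {w₀ u₀ : List ℕ} {q₀ q : ℕ} (hs : s = pendingState w₀ u₀ q₀) (ht : t = pendingState [] [] q) :
    ∃ w' u', w = w₀ ++ w' ∧ u = u₀ ++ u' ∧ Path E q₀ w' u' q := by
  induction h generalizing w₀ u₀ q₀ with
  | nil s =>
    obtain ⟨rfl, rfl, rfl⟩ := pendingState_inj.1 (hs.symm.trans ht)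
    exact ⟨[], [], rfl, rfl, Path.nil _⟩
  | cons he _ ih =>
    obtain ⟨⟨p, w, u, q⟩, hm, he⟩ := List.mem_flatMap.1 he
    rcases mem_splitEdge.1 he with ⟨h1, rfl, rfl, h2⟩ | ⟨x, v, -, h1, rfl, rfl, h2⟩ |
      ⟨x, v, -, h1, rfl, rfl, h2⟩ <;> obtain ⟨rfl, rfl, rfl⟩ := pendingState_inj.1 (hs.symm.trans h1)
      <;> obtain ⟨w', u', rfl, rfl, hp⟩ := ih h2 ht
    · exact ⟨_, _, by simp, by simp, Path.cons hm hp⟩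
    · exact ⟨_, _, by simp, rfl, hp⟩
    · exact ⟨_, _, rfl, by simp, hp⟩

theorem Path.splitEdges {s t : ℕ} {w u : List ℕ} (h : Path E s w u t) :
    Path (splitEdges E) (pendingState [] [] s) w u (pendingState [] [] t) := by
  induction h with
  | nil => exact Path.nil _
  | @cons s t q w u w' u' he _ ih =>
    refine Path.append ?_ ih
    have hmem : ∀ e ∈ splitEdge (s, w, u, t), e ∈ ValenceLang.splitEdges E :=
      fun e h => List.mem_flatMap.2 ⟨_, he, h⟩
    -- The input word is read first and the generators afterwards; `h1` is the second phase and `h2`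
    -- the first.
    have h1 : ∀ v, v <:+ u → Path (ValenceLang.splitEdges E) (pendingState [] v t) [] v
        (pendingState [] [] t) := by
      intro v
      induction v with
      | nil => exact fun _ => Path.nil _
      | cons j v ih =>
        intro hv
        exact Path.cons (w := []) (u := [j])
          (hmem _ (mem_splitEdge.2 (Or.inr (Or.inr ⟨j, v, hv, rfl, rfl, rfl, rfl⟩))))
          (ih ((List.suffix_cons j v).trans hv))
    have h2 : ∀ v, v <:+ w → Path (ValenceLang.splitEdges E) (pendingState v u t) v u
        (pendingState [] [] t) := by
      intro v
      induction v with
      | nil => exact fun _ => h1 u (List.suffix_refl u)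
      | cons x v ih =>
        intro hv
        exact Path.cons (w := [x]) (u := [])
          (hmem _ (mem_splitEdge.2 (Or.inr (Or.inl ⟨x, v, hv, rfl, rfl, rfl, rfl⟩))))
          (ih ((List.suffix_cons x v).trans hv))
    exact Path.cons (w := []) (u := []) (hmem _ (mem_splitEdge.2 (Or.inl ⟨rfl, rfl, rfl, rfl⟩)))
      (h2 w (List.suffix_refl w))

theorem path_splitEdges_iff {s t : ℕ} {w u : List ℕ} :
    Path (splitEdges E) (pendingState [] [] s) w u (pendingState [] [] t) ↔ Path E s w u t := by
  refine ⟨fun h => ?_, Path.splitEdges⟩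
  obtain ⟨w', u', rfl, rfl, h⟩ := h.of_splitEdges rfl rfl
  exact h

theorem accepts_splitEdges_iff {G : GenMonoid} {s t : ℕ} {w : List ℕ} :
    Accepts G (splitEdges E) (pendingState [] [] s) (pendingState [] [] t) w ↔
      Accepts G E s t w := by
  simp only [Accepts, path_splitEdges_iff]

/-! ### Grammars over the natural numbers -/

/-- `Yield n m P v w`: the word `v` over the nonterminals `0, …, n` and the terminals
`n + 1, …, n + m` derives the word `w` over the terminals (renumbered from `0` on), where `P A k`
says that the nonterminal `A` has the right-hand side `k`. -/
inductive Yield (n m : ℕ) (P : ℕ → List ℕ → Prop) : List ℕ → List ℕ → Prop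
  | nil : Yield n m P [] []
  | terminal {x : ℕ} {v w : List ℕ} : x < m → Yield n m P v w →
      Yield n m P ((n + 1 + x) :: v) (x :: w)
  | nonterminal {A : ℕ} {k v w₁ w₂ : List ℕ} : A ≤ n → P A k → Yield n m P k w₁ →
      Yield n m P v w₂ → Yield n m P (A :: v) (w₁ ++ w₂)

variable {n m : ℕ} {P : ℕ → List ℕ → Prop}

theorem Yield.append {v w v' w' : List ℕ} (h : Yield n m P v w) (h' : Yield n m P v' w') :
    Yield n m P (v ++ v') (w ++ w') := by
  induction h with
  | nil => exact h'
  | terminal hx _ ih => exact Yield.terminal hx ih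
  | nonterminal hA hk hy _ _ ih =>
    rw [List.append_assoc]; exact Yield.nonterminal hA hk hy ih

theorem Yield.split {v w : List ℕ} (h : Yield n m P v w) : ∀ v₁ v₂, v = v₁ ++ v₂ →
    ∃ w₁ w₂, w = w₁ ++ w₂ ∧ Yield n m P v₁ w₁ ∧ Yield n m P v₂ w₂ := by
  induction h with
  | nil =>
    intro v₁ v₂ h
    obtain ⟨rfl, rfl⟩ := List.append_eq_nil_iff.1 h.symm
    exact ⟨[], [], rfl, Yield.nil, Yield.nil⟩
  | @terminal x v w hx hy ih =>
    intro v₁ v₂ h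
    rcases v₁ with _ | ⟨y, v₁⟩
    · exact ⟨[], x :: w, rfl, Yield.nil, by rw [List.nil_append] at h; exact h ▸ Yield.terminal hx hy⟩
    · simp only [List.cons_append, List.cons.injEq] at h
      obtain ⟨rfl, h⟩ := h
      obtain ⟨w₁, w₂, rfl, h1, h2⟩ := ih v₁ v₂ h
      exact ⟨x :: w₁, w₂, rfl, Yield.terminal hx h1, h2⟩
  | @nonterminal A k v w w' hA hk hy hy' _ ih =>
    intro v₁ v₂ h
    rcases v₁ with _ | ⟨y, v₁⟩
    · exact ⟨[], w ++ w', rfl, Yield.nil,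
        by rw [List.nil_append] at h; exact h ▸ Yield.nonterminal hA hk hy hy'⟩
    · simp only [List.cons_append, List.cons.injEq] at h
      obtain ⟨rfl, h⟩ := h
      obtain ⟨w₁, w₂, rfl, h1, h2⟩ := ih v₁ v₂ h
      exact ⟨w ++ w₁, w₂, by simp, Yield.nonterminal hA hk hy h1, h2⟩

theorem Yield.lt {v w : List ℕ} (h : Yield n m P v w) : ∀ x ∈ w, x < m := by
  induction h with
  | nil => simp
  | terminal hx _ ih => simpa [hx] using ih
  | nonterminal _ _ _ _ ih ih' =>
    intro x hx
    exact (List.mem_append.1 hx).elim (ih x) (ih' x)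

theorem Yield.lt' {v w : List ℕ} (h : Yield n m P v w) : ∀ x ∈ v, x < n + 1 + m := by
  induction h with
  | nil => simp
  | terminal hx _ ih => simpa [hx] using ih
  | nonterminal hA _ _ _ _ ih' =>
    intro x hx
    rcases List.mem_cons.1 hx with rfl | hx
    · omega
    · exact ih' x hx

theorem Yield.singleton {A : ℕ} {k w : List ℕ} (hA : A ≤ n) (hk : P A k) (h : Yield n m P k w) :
    Yield n m P [A] w := by
  simpa using Yield.nonterminal hA hk h Yield.nil

theorem Yield.of_singleton {A : ℕ} {w : List ℕ} (hA : A ≤ n) (h : Yield n m P [A] w) :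
    ∃ k, P A k ∧ Yield n m P k w := by
  generalize hv : [A] = v at h
  cases h with
  | nil => cases hv
  | terminal => simp at hv; omega
  | nonterminal _ hk hy hy' =>
    simp only [List.cons.injEq] at hv
    obtain ⟨rfl, rfl⟩ := hv
    cases hy'
    exact ⟨_, hk, by simpa using hy⟩

/-- A right-hand side that takes part in a yield has all letters below `n + 1 + m`, so the two
systems need to be compared on such words only. -/
theorem Yield.mono {P' : ℕ → List ℕ → Prop} (hP : ∀ A ≤ n, ∀ k, (∀ x ∈ k, x < n + 1 + m) → P A k →
    P' A k) {v w : List ℕ} (h : Yield n m P v w) : Yield n m P' v w := by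
  induction h with
  | nil => exact Yield.nil
  | terminal hx _ ih => exact Yield.terminal hx ih
  | nonterminal hA hk hy _ ih ih' =>
    exact Yield.nonterminal hA (hP _ hA _ hy.lt' hk) ih ih'

theorem Grammar.steps_append {N T : Type} {G : Grammar N T} {x y x' y' : List (N ⊕ T)}
    (h : Relation.ReflTransGen G.Step x y) (h' : Relation.ReflTransGen G.Step x' y') :
    Relation.ReflTransGen G.Step (x ++ x') (y ++ y') := by
  have h1 : Relation.ReflTransGen G.Step (x ++ x') (y ++ x') := by
    refine h.lift (· ++ x') ?_
    rintro _ _ ⟨p, hp, u, v, w, hw, rfl, rfl⟩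
    exact ⟨p, hp, u, v ++ x', w, hw, by simp, by simp⟩
  refine h1.trans (h'.lift (y ++ ·) ?_)
  rintro _ _ ⟨p, hp, u, v, w, hw, rfl, rfl⟩
  exact ⟨p, hp, y ++ u, v, w, hw, by simp, by simp⟩

/-- The number of a symbol. -/
def symbolCode {n m : ℕ} (x : Fin (n + 1) ⊕ Fin m) : ℕ := (finSumFinEquiv x : ℕ)

@[simp] theorem symbolCode_inl (A : Fin (n + 1)) :
    symbolCode (Sum.inl A : Fin (n + 1) ⊕ Fin m) = A := by simp [symbolCode]

@[simp] theorem symbolCode_inr (x : Fin m) :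
    symbolCode (Sum.inr x : Fin (n + 1) ⊕ Fin m) = n + 1 + x := by simp [symbolCode]

/-- The right-hand sides of a grammar. -/
def Grammar.Rhs {n m : ℕ} (G : Grammar (Fin (n + 1)) (Fin m)) (A : ℕ) (k : List ℕ) : Prop :=
  ∃ p ∈ G.prods, (p.1 : ℕ) = A ∧ ∃ k' ∈ p.2, k'.map symbolCode = k

/-- Derivations correspond to derivation trees. A derivation is read backwards: the terminal word
yields itself, and undoing a step gathers the yield of the inserted word under its nonterminal.
Conversely, the derivations of the parts of a word are concatenated. -/
theorem Grammar.mem_lang_iff (G : Grammar (Fin (n + 1)) (Fin m)) (w : List (Fin m)) :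
    w ∈ G.lang ↔ Yield n m G.Rhs [(G.start : ℕ)] (w.map Fin.val) := by
  constructor
  · intro h
    suffices H : ∀ x, Relation.ReflTransGen G.Step x (w.map Sum.inr) →
        Yield n m G.Rhs (x.map symbolCode) (w.map Fin.val) by simpa using H _ h
    intro x h
    induction h using Relation.ReflTransGen.head_induction_on with
    | refl =>
      clear h
      induction w with
      | nil => exact Yield.nil
      | cons a w ih => simpa using Yield.terminal a.2 ih
    | head hs _ ih =>
      obtain ⟨p, hp, u, v, k, hk, rfl, rfl⟩ := hs
      rw [List.map_append, List.map_append] at ih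
      obtain ⟨w₁, w₂, hw, h1, h2⟩ := ih.split _ _ rfl
      obtain ⟨w₃, w₄, rfl, h3, h4⟩ := h1.split _ _ rfl
      rw [List.map_append, List.map_append, hw]
      refine (h3.append ?_).append h2
      exact Yield.singleton (by simp; omega) ⟨p, hp, by simp, k, hk, rfl⟩ h4
  · intro h
    suffices H : ∀ v w', Yield n m G.Rhs v w' → ∀ x : List (Fin (n + 1) ⊕ Fin m),
        x.map symbolCode = v → ∃ w : List (Fin m), w.map Fin.val = w' ∧
          Relation.ReflTransGen G.Step x (w.map Sum.inr) by
      obtain ⟨w', h1, h2⟩ := H _ _ h [Sum.inl G.start] (by simp)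
      rw [List.map_injective_iff.2 Fin.val_injective h1] at h2
      exact h2
    intro v w' h
    induction h with
    | nil =>
      intro x hx
      rw [List.map_eq_nil_iff] at hx
      subst hx
      exact ⟨[], rfl, Relation.ReflTransGen.refl⟩
    | @terminal a v w' ha _ ih =>
      intro x hx
      rcases x with _ | ⟨b, x⟩
      · cases hx
      rw [List.map_cons, List.cons.injEq] at hx
      obtain ⟨w, rfl, h⟩ := ih x hx.2
      rcases b with A | b
      · have := A.2; simp at hx; omega
      · have hb : (b : ℕ) = a := by simpa using hx.1
        exact ⟨b :: w, by simp [hb],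
          Grammar.steps_append (x := [Sum.inr b]) Relation.ReflTransGen.refl h⟩
    | @nonterminal A k v w₁ w₂ hA hk _ _ ih ih' =>
      intro x hx
      rcases x with _ | ⟨b, x⟩
      · cases hx
      rw [List.map_cons, List.cons.injEq] at hx
      obtain ⟨p, hp, rfl, k', hk', rfl⟩ := hk
      obtain ⟨w, rfl, h⟩ := ih k' rfl
      obtain ⟨w', rfl, h'⟩ := ih' x hx.2
      rcases b with B | b
      · have hb : B = p.1 := Fin.ext (by simpa using hx.1)
        subst hb
        refine ⟨w ++ w', by simp, ?_⟩
        rw [List.map_append]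
        refine Grammar.steps_append (x := [Sum.inl p.1]) (Relation.ReflTransGen.head ?_ h) h'
        exact ⟨p, hp, [], [], k', hk', by simp, by simp⟩
      · have := hx.1
        simp at this; omega

/-! ### The represented languages over the natural numbers -/

/-- The language represented by a code, as a set of words over the natural numbers. -/
def FWord (i k c : ℕ) (w : List ℕ) : Prop := ∃ v ∈ fLang i k c, v.map Fin.val = w

theorem FWord.lt {i k c : ℕ} {w : List ℕ} (h : FWord i k c w) : ∀ x ∈ w, x < k := by
  obtain ⟨v, -, rfl⟩ := h
  simp

theorem fWord_map_iff {i k c : ℕ} {w : List (Fin k)} :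
    FWord i k c (w.map Fin.val) ↔ w ∈ fLang i k c := by
  constructor
  · rintro ⟨v, hv, h⟩
    rwa [← List.map_injective_iff.2 Fin.val_injective h]
  · exact fun h => ⟨w, h, rfl⟩

theorem exists_map_val {k : ℕ} {w : List ℕ} (h : ∀ x ∈ w, x < k) :
    ∃ v : List (Fin k), v.map Fin.val = w := by
  induction w with
  | nil => exact ⟨[], rfl⟩
  | cons x w ih =>
    obtain ⟨v, rfl⟩ := ih fun y hy => h y (List.mem_cons_of_mem _ hy)
    exact ⟨⟨x, h x (by simp)⟩ :: v, rfl⟩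

theorem wordOf_map_val (k : ℕ) (l : List ℕ) :
    (wordOf k l).map Fin.val = l.filter fun x => x < k := by
  induction l with
  | nil => rfl
  | cons x l ih =>
    by_cases h : x < k
    · simpa [wordOf, h] using ih
    · simpa [wordOf, h] using ih

/-- The right-hand sides of a grammar that is given by a code. -/
def CodeRhs (i k : ℕ) (prods : List (ℕ × ℕ)) (A : ℕ) (v : List ℕ) : Prop :=
  ∃ c, (A, c) ∈ prods ∧ FWord i k c v

theorem grammarOfCode_rhs_iff {i : ℕ} {prods : List (ℕ × ℕ)} {A : ℕ} {v : List ℕ} (hA : A ≤ n) :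
    (grammarOfCode n m prods (fLang i (n + 1 + m))).Rhs A v ↔
      CodeRhs i (n + 1 + m) prods A v := by
  constructor
  · rintro ⟨⟨B, K⟩, ⟨c, hc, hK⟩, rfl, k, hk, rfl⟩
    simp only at hK hk
    subst hK
    exact ⟨c, hc, k.map finSumFinEquiv, hk, by simp [symbolCode]⟩
  · rintro ⟨c, hc, w, hw, rfl⟩
    refine ⟨((⟨A, by omega⟩ : Fin (n + 1)),
      ({v | v.map finSumFinEquiv ∈ fLang i (n + 1 + m) c} : Language (Fin (n + 1) ⊕ Fin m))),
      ⟨c, hc, rfl⟩, rfl, w.map finSumFinEquiv.symm, ?_, ?_⟩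
    · change (w.map finSumFinEquiv.symm).map finSumFinEquiv ∈ fLang i (n + 1 + m) c
      simpa [Function.comp_def] using hw
    · simp [symbolCode, Function.comp_def]

/-- This form of the level step is used in both translations. The filter reflects that `wordOf`
drops letters outside the alphabet. -/
theorem fWord_succ_iff {i k c : ℕ} {prods : List (ℕ × ℕ)} {hs : List (List ℕ)}
    {S : List (List ℕ × List (List ℕ))}
    (hc : Denumerable.ofNat StepCode c = (n, m, prods, hs, S)) (w : List ℕ) :
    FWord (i + 1) k c w ↔ ∃ z, Yield n m (CodeRhs i (n + 1 + m) prods) [0] z ∧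
      (fun y : Fin m => z.count (y : ℕ)) ∈ semilinearOf m S ∧
      w = (z.flatMap fun x => hs.getD x []).filter fun x => x < k := by
  have hflat : ∀ z : List (Fin m), (z.flatMap fun x : Fin m => wordOf k (hs.getD x [])).map Fin.val =
      ((z.map Fin.val).flatMap fun x => hs.getD x []).filter fun x => x < k := by
    intro z
    induction z with
    | nil => rfl
    | cons x z ih => simp only [List.flatMap_cons, List.map_append, ih, List.map_cons,
        List.filter_append, wordOf_map_val]
  have hpar : ∀ z : List (Fin m), parikh z = fun y : Fin m => (z.map Fin.val).count (y : ℕ) := by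
    intro z
    funext y
    rw [List.count_map_of_injective _ _ Fin.val_injective, parikh]
    congr!
  have hlang : ∀ z : List (Fin m), z ∈ (grammarOfCode n m prods (fLang i (n + 1 + m))).lang ↔
      Yield n m (CodeRhs i (n + 1 + m) prods) [0] (z.map Fin.val) := by
    intro z
    rw [Grammar.mem_lang_iff]
    exact ⟨fun h => h.mono fun A hA v _ => (grammarOfCode_rhs_iff hA).1,
      fun h => h.mono fun A hA v _ => (grammarOfCode_rhs_iff hA).2⟩
  have hF : fLang (i + 1) k c = homSLIImage (fun x : Fin m => wordOf k (hs.getD x []))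
      (grammarOfCode n m prods (fLang i (n + 1 + m))).lang (semilinearOf m S) := by
    rw [fLang, hc]
  rw [FWord, hF]
  constructor
  · rintro ⟨v, ⟨z, hz, hS, rfl⟩, rfl⟩
    exact ⟨z.map Fin.val, (hlang z).1 hz, hpar z ▸ hS, hflat z⟩
  · rintro ⟨z, hz, hS, rfl⟩
    obtain ⟨z, rfl⟩ := exists_map_val hz.lt
    exact ⟨_, ⟨z, (hlang z).2 hz, (hpar z).symm ▸ hS, rfl⟩, hflat z⟩

/-- Edges to nonexistent states must be filtered out, but not edges with nonexistent letters: the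
latter cannot lie on a path whose input is a word over `Fin k`. -/
theorem mem_vaLang_iff (k n : ℕ) (ops : List Bool) (r : ℕ) (edges : List Edge) (finals : List ℕ)
    (w : List (Fin k)) :
    w ∈ vaLang k (n, ops, r, edges, finals) ↔ ∃ f ∈ finals, f ≤ r ∧
      Accepts (scMonoid n ops) (edges.filter fun e => e.1 ≤ r ∧ e.2.2.2 ≤ r) 0 f
        (w.map Fin.val) := by
  set G := scMonoid n ops
  constructor
  · rintro ⟨f, hf, h⟩
    refine ⟨(show Fin (r + 1) from f), hf, Nat.le_of_lt_succ (show Fin (r + 1) from f).2, ?_⟩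
    suffices H : ∀ c, Relation.ReflTransGen (vaOfCode k G r edges finals).Step
        ((0 : Fin (r + 1)), [], 1) c → ∃ u, Path (edges.filter fun e => e.1 ≤ r ∧ e.2.2.2 ≤ r) 0
          (c.2.1.map Fin.val) u ((show Fin (r + 1) from c.1) : ℕ) ∧ G.eval u = c.2.2 from H _ h
    intro c h
    induction h with
    | refl => exact ⟨[], Path.nil 0, rfl⟩
    | @tail b c _ hs ih =>
      obtain ⟨u, hu, hu'⟩ := ih
      obtain ⟨⟨p, v, g, q⟩, ⟨x, hx, hg⟩, h1, h2, h3, h4⟩ := hs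
      obtain ⟨b1, b2, b3⟩ := b
      obtain ⟨c1, c2, c3⟩ := c
      simp only at hx hg h1 h2 h3 h4 hu hu' ⊢
      subst h1 h2 h3 h4 hg
      refine ⟨u ++ x, ?_, by rw [GenMonoid.eval_append, hu']⟩
      rw [List.map_append]
      refine hu.snoc (List.mem_filter.2 ⟨hx, ?_⟩)
      have := (show Fin (r + 1) from b1).2
      have := (show Fin (r + 1) from c1).2
      simp only [decide_eq_true_eq]
      omega
  · rintro ⟨f, hf, hr, u, hu, hu'⟩
    refine ⟨(⟨f, by omega⟩ : Fin (r + 1)), hf, ?_⟩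
    suffices H : ∀ s w' u t, Path (edges.filter fun e => e.1 ≤ r ∧ e.2.2.2 ≤ r) s w' u t →
        ∀ (hs : s < r + 1) (ht : t < r + 1) (w : List (Fin k)), w' = w.map Fin.val →
        ∀ (w₀ : List (Fin k)) (g : G.carrier),
        Relation.ReflTransGen (vaOfCode k G r edges finals).Step
          ((⟨s, hs⟩ : Fin (r + 1)), w₀, g) ((⟨t, ht⟩ : Fin (r + 1)), w₀ ++ w, g * G.eval u) by
      have := H _ _ _ _ hu (by omega) (by omega) w rfl [] 1
      rwa [hu', mul_one, List.nil_append] at this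
    intro s w' u t h
    induction h with
    | nil s =>
      intro hs ht w hw w₀ g
      rw [List.map_eq_nil_iff.1 hw.symm, GenMonoid.eval_nil, mul_one, List.append_nil]
    | @cons s t q v x v' x' he _ ih =>
      intro hs ht w hw w₀ g
      obtain ⟨he, hb⟩ := List.mem_filter.1 he
      simp only [decide_eq_true_eq] at hb
      obtain ⟨w₁, w₂, rfl, rfl, rfl⟩ := List.map_eq_append_iff.1 hw.symm
      refine Relation.ReflTransGen.head ?_ (by
        simpa [mul_assoc] using ih (by omega) ht w₂ rfl (w₀ ++ w₁) (g * G.eval x))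
      exact ⟨((⟨s, hs⟩ : Fin (r + 1)), w₁, G.eval x, (⟨t, by omega⟩ : Fin (r + 1))),
        ⟨x, he, rfl⟩, rfl, rfl, rfl, rfl⟩

end ValenceLang

/-! ### Trading the outermost monoid operation for a grammar with a counting condition -/

namespace ValenceLang

variable {E : List Edge} {n R k : ℕ} {G : GenMonoid}

/-- All states are smaller than `R`. -/
def StatesLt (R : ℕ) (E : List Edge) : Prop := ∀ e ∈ E, e.1 < R ∧ e.2.2.2 < R

/-! ### Removing the outermost operation of the monoid -/

/-- The nonterminal for the words that lead from `p` to `q`. -/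
def callLetter (R p q : ℕ) : ℕ := p * R + q + 1

theorem mul_add_lt {R p q : ℕ} (hp : p < R) (hq : q < R) : p * R + q < R * R := by
  nlinarith

theorem mul_add_div_mod {R p q : ℕ} (hq : q < R) : (p * R + q) / R = p ∧ (p * R + q) % R = q := by
  rw [Nat.mul_comm, Nat.mul_add_div (by omega), Nat.div_eq_of_lt hq, Nat.mul_add_mod,
    Nat.mod_eq_of_lt hq]
  simp

/-- The edges over the inner monoid. With `b = true`, a call of a nonterminal replaces the path
between a push and the corresponding pop; with `b = false`, marker letters replace the generators
of `ℤ`. -/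
def nextEdges (b : Bool) (R : ℕ) (E : List Edge) : List Edge :=
  (E.flatMap fun e => if e.2.2.1 = [0] ∨ e.2.2.1 = [1] then [] else
    -- The new alphabet has the nonterminals `0, …, R * R` (the start symbol and one for each pair
    -- of states), then the markers `R * R + 1` and `R * R + 2`, then the old letters. The inner
    -- monoid lacks the first two generators.
    [(e.1, e.2.1.map (· + (R * R + 3)), e.2.2.1.map (· - 2), e.2.2.2)]) ++
  if b = true then
    E.flatMap fun e => E.flatMap fun e' => if e.2.2.1 = [0] ∧ e'.2.2.1 = [1] then
      [(e.1, [callLetter R e.2.2.2 e'.1], [], e'.2.2.2)] else []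
  else E.flatMap fun e => if e.2.2.1 = [0] then [(e.1, [R * R + 1], [], e.2.2.2)] else
    if e.2.2.1 = [1] then [(e.1, [R * R + 2], [], e.2.2.2)] else []

/-- The edges which both operations keep. -/
def KeptEdge (R : ℕ) (E : List Edge) (s : ℕ) (w u : List ℕ) (t : ℕ) : Prop :=
  (w = [] ∧ u = [] ∧ (s, [], [], t) ∈ E) ∨
    (∃ x, w = [x + (R * R + 3)] ∧ u = [] ∧ (s, [x], [], t) ∈ E) ∨
    ∃ j, w = [] ∧ u = [j] ∧ (s, [], [j + 2], t) ∈ E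

theorem mem_nextEdges_left (hE : Elementary E) {s t : ℕ} {w u : List ℕ} :
    (s, w, u, t) ∈ (E.flatMap fun e => if e.2.2.1 = [0] ∨ e.2.2.1 = [1] then [] else
    [(e.1, e.2.1.map (· + (R * R + 3)), e.2.2.1.map (· - 2), e.2.2.2)] : List Edge) ↔
      KeptEdge R E s w u t := by
  rw [List.mem_flatMap]
  constructor
  · rintro ⟨⟨s', w', u', t'⟩, he, h⟩
    split_ifs at h with hu
    · cases h
    simp only [List.mem_singleton, Prod.mk.injEq] at h
    obtain ⟨rfl, rfl, rfl, rfl⟩ := h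
    rcases hE.cases he with ⟨rfl, rfl⟩ | ⟨x, rfl, rfl⟩ | ⟨j, rfl, rfl⟩
    · exact Or.inl ⟨rfl, rfl, he⟩
    · exact Or.inr (Or.inl ⟨x, rfl, rfl, he⟩)
    · refine Or.inr (Or.inr ⟨j - 2, rfl, rfl, ?_⟩)
      have : j - 2 + 2 = j := by simp at hu; omega
      rwa [this]
  · rintro (⟨rfl, rfl, he⟩ | ⟨x, rfl, rfl, he⟩ | ⟨j, rfl, rfl, he⟩) <;>
      exact ⟨_, he, by simp⟩

theorem mem_nextEdges_true (hE : Elementary E) {s t : ℕ} {w u : List ℕ} :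
    (s, w, u, t) ∈ nextEdges true R E ↔ KeptEdge R E s w u t ∨
      ∃ s' t', w = [callLetter R s' t'] ∧ u = [] ∧ (s, [], [0], s') ∈ E ∧
        (t', [], [1], t) ∈ E := by
  rw [nextEdges, List.mem_append, mem_nextEdges_left hE]
  refine or_congr Iff.rfl ?_
  rw [if_pos rfl, List.mem_flatMap]
  constructor
  · rintro ⟨⟨s₁, w₁, u₁, t₁⟩, he, h⟩
    obtain ⟨⟨s₂, w₂, u₂, t₂⟩, he', h⟩ := List.mem_flatMap.1 h
    split_ifs at h with hu
    · simp only [List.mem_singleton, Prod.mk.injEq] at h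
      obtain ⟨rfl, rfl, rfl, rfl⟩ := h
      obtain ⟨rfl, rfl⟩ := hu
      obtain rfl : w₁ = [] := by simpa using hE _ he
      obtain rfl : w₂ = [] := by simpa using hE _ he'
      exact ⟨_, _, rfl, rfl, he, he'⟩
    · cases h
  · rintro ⟨s', t', rfl, rfl, he, he'⟩
    exact ⟨_, he, List.mem_flatMap.2 ⟨_, he', by simp⟩⟩

theorem mem_nextEdges_false (hE : Elementary E) {s t : ℕ} {w u : List ℕ} :
    (s, w, u, t) ∈ nextEdges false R E ↔ KeptEdge R E s w u t ∨
      (w = [R * R + 1] ∧ u = [] ∧ (s, [], [0], t) ∈ E) ∨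
      (w = [R * R + 2] ∧ u = [] ∧ (s, [], [1], t) ∈ E) := by
  rw [nextEdges, List.mem_append, mem_nextEdges_left hE]
  refine or_congr Iff.rfl ?_
  rw [if_neg (by simp), List.mem_flatMap]
  constructor
  · rintro ⟨⟨s₁, w₁, u₁, t₁⟩, he, h⟩
    split_ifs at h with hu hu
    · simp only [List.mem_singleton, Prod.mk.injEq] at h
      obtain ⟨rfl, rfl, rfl, rfl⟩ := h
      simp only at hu
      subst hu
      obtain rfl : w₁ = [] := by simpa using hE _ he
      exact Or.inl ⟨rfl, rfl, he⟩
    · simp only [List.mem_singleton, Prod.mk.injEq] at h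
      obtain ⟨rfl, rfl, rfl, rfl⟩ := h
      simp only at hu
      subst hu
      obtain rfl : w₁ = [] := by simpa using hE _ he
      exact Or.inr ⟨rfl, rfl, he⟩
    · cases h
  · rintro (⟨rfl, rfl, he⟩ | ⟨rfl, rfl, he⟩) <;> exact ⟨_, he, by simp⟩

theorem elementary_nextEdges (hE : Elementary E) (b : Bool) : Elementary (nextEdges b R E) := by
  rintro ⟨s, w, u, t⟩ h
  cases b
  · rcases (mem_nextEdges_false hE).1 h with (⟨rfl, rfl, -⟩ | ⟨x, rfl, rfl, -⟩ | ⟨j, rfl, rfl, -⟩) |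
      ⟨rfl, rfl, -⟩ | ⟨rfl, rfl, -⟩ <;> simp
  · rcases (mem_nextEdges_true hE).1 h with (⟨rfl, rfl, -⟩ | ⟨x, rfl, rfl, -⟩ | ⟨j, rfl, rfl, -⟩) |
      ⟨_, _, rfl, rfl, -⟩ <;> simp

theorem statesLt_nextEdges (hE : Elementary E) (hR : StatesLt R E) (b : Bool) :
    StatesLt R (nextEdges b R E) := by
  rintro ⟨s, w, u, t⟩ h
  cases b
  · rcases (mem_nextEdges_false hE).1 h with (⟨-, -, h⟩ | ⟨x, -, -, h⟩ | ⟨j, -, -, h⟩) |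
      ⟨-, -, h⟩ | ⟨-, -, h⟩ <;> exact (hR _ h :)
  · rcases (mem_nextEdges_true hE).1 h with (⟨-, -, h⟩ | ⟨x, -, -, h⟩ | ⟨j, -, -, h⟩) |
      ⟨_, _, -, -, h, h'⟩
    · exact (hR _ h :)
    · exact (hR _ h :)
    · exact (hR _ h :)
    · exact ⟨(hR _ h).1, (hR _ h').2⟩

/-! ### Free products with `𝔹` -/

section Stack

variable {P : ℕ → List ℕ → Prop}

theorem Path.nextEdges_of_noGens (hE : Elementary E) {p q : ℕ} {w u : List ℕ}
    (h : Path E p w u q) (hu : u = []) (hw : ∀ x ∈ w, x < k) :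
    ∃ z, Path (nextEdges true R E) p z [] q ∧ Yield (R * R) (k + 2) P z (w.map (· + 2)) := by
  induction h with
  | nil => exact ⟨[], Path.nil _, Yield.nil⟩
  | cons he _ ih =>
    rcases hE.cases he with ⟨rfl, rfl⟩ | ⟨x, rfl, rfl⟩ | ⟨j, rfl, rfl⟩
    · obtain ⟨z, h1, h2⟩ := ih hu hw
      exact ⟨z, Path.cons (w := []) (u := [])
        ((mem_nextEdges_true hE).2 (Or.inl (Or.inl ⟨rfl, rfl, he⟩))) h1, h2⟩
    · obtain ⟨z, h1, h2⟩ := ih hu fun x hx => hw x (by simp [hx])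
      refine ⟨_, Path.cons (u := [])
        ((mem_nextEdges_true hE).2 (Or.inl (Or.inr (Or.inl ⟨x, rfl, rfl, he⟩)))) h1, ?_⟩
      have := Yield.terminal (n := R * R) (P := P) (m := k + 2) (x := x + 2)
        (by simpa using hw x (by simp)) h2
      rwa [show R * R + 1 + (x + 2) = x + (R * R + 3) by ring] at this
    · cases hu

/-- In a block, the path pushes from `a` to `c`, runs from `c` to `b` and pops from `b` to `d`. The
new automaton jumps from `a` to `d` and reads the letter of the pair `(c, b)`; the inner run, whose
reduced word is trivial, supplies a right-hand side for this letter. Markers never occur here, hence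
the shift of `w` by `2`. -/
theorem exists_yield_of_reduces (hE : Elementary E) (hR : StatesLt R E)
    (hP : ∀ p < R, ∀ q < R, ∀ v, (∀ x ∈ v, x < R * R + 1 + (k + 2)) →
      Accepts G (nextEdges true R E) p q v → P (callLetter R p q) v)
    {u v : List ℕ} (hr : G.Reduces u v) {p q : ℕ} {w : List ℕ} (h : Path E p w u q)
    (hw : ∀ x ∈ w, x < k) :
    ∃ z, Path (nextEdges true R E) p z v q ∧ Yield (R * R) (k + 2) P z (w.map (· + 2)) := by
  induction hr generalizing p q w with
  | nil => exact h.nextEdges_of_noGens hE rfl hw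
  | gen j hr ih =>
    obtain ⟨a, b, w₁, w₂, rfl, h1, h2, h3⟩ := h.snoc_gen hE
    obtain ⟨z, hz, hy⟩ := ih h1 fun x hx => hw x (by simp [hx])
    obtain ⟨z', hz', hy'⟩ := h3.nextEdges_of_noGens (R := R) (P := P) hE rfl
      fun x hx => hw x (by simp [hx])
    have h4 : Path (nextEdges true R E) a [] [j] b :=
      Path.single ((mem_nextEdges_true hE).2 (Or.inl (Or.inr (Or.inr ⟨j, rfl, rfl, h2⟩))))
    refine ⟨z ++ z', by simpa using (hz.append h4).append hz', ?_⟩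
    rw [List.map_append]
    exact hy.append hy'
  | block hr hr' hv ih ih' =>
    obtain ⟨t, w₁, w₂, rfl, h1, h2⟩ := h.split_gens hE _ _ rfl
    obtain ⟨b, d, w₃, w₄, rfl, h3, h4, h5⟩ := h2.snoc_gen hE
    obtain ⟨a, c, w₅, w₆, rfl, h6, h7, h8⟩ := h3.cons_gen hE rfl
    obtain ⟨z₁, hz₁, hy₁⟩ := ih h1 fun x hx => hw x (by simp [hx])
    obtain ⟨z₂, hz₂, hy₂⟩ := h6.nextEdges_of_noGens (R := R) (P := P) hE rfl
      fun x hx => hw x (by simp [hx])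
    obtain ⟨z₃, hz₃, hy₃⟩ := ih' h8 fun x hx => hw x (by simp [hx])
    obtain ⟨z₄, hz₄, hy₄⟩ := h5.nextEdges_of_noGens (R := R) (P := P) hE rfl
      fun x hx => hw x (by simp [hx])
    have hc : c < R := (hR _ h7).2
    have hb : b < R := (hR _ h4).1
    have h9 : Path (nextEdges true R E) a [callLetter R c b] [] d :=
      Path.single ((mem_nextEdges_true hE).2 (Or.inr ⟨c, b, rfl, rfl, h7, h4⟩))
    have h10 : Yield (R * R) (k + 2) P [callLetter R c b] (w₆.map (· + 2)) :=
      Yield.singleton (by have := mul_add_lt hc hb; unfold callLetter; omega)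
        (hP c hc b hb z₃ hy₃.lt' ⟨_, hz₃, hv⟩) hy₃
    refine ⟨z₁ ++ z₂ ++ [callLetter R c b] ++ z₄, ?_, ?_⟩
    · simpa using ((hz₁.append hz₂).append h9).append hz₄
    · simpa using ((hy₁.append hy₂).append h10).append hy₄

/-- Call edges read a letter, so a path without input uses kept edges only and lifts without any
block. -/
theorem Path.of_nextEdges_of_noInput (hE : Elementary E) {p q : ℕ} {w v : List ℕ}
    (h : Path (nextEdges true R E) p w v q) (hw : w = []) :
    ∃ u, Path E p [] u q ∧ G.Reduces u v := by
  revert hw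
  refine Path.snoc_induction (motive := fun w v q => w = [] → ∃ u, Path E p [] u q ∧
    G.Reduces u v) (fun _ => ⟨[], Path.nil _, GenMonoid.Reduces.nil⟩) ?_ h
  intro _ _ _ _ _ _ _ ih he₀ hw
  · obtain ⟨rfl, hw⟩ := List.append_eq_nil_iff.1 hw
    obtain ⟨u, h1, h2⟩ := ih rfl
    rcases (mem_nextEdges_true hE).1 he₀ with (⟨-, rfl, he⟩ | ⟨x, rfl, -⟩ | ⟨j, -, rfl, he⟩) |
      ⟨_, _, rfl, -⟩
    · exact ⟨u, by simpa using h1.snoc he, by simpa using h2⟩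
    · cases hw
    · exact ⟨u ++ [j + 2], by simpa using h1.snoc he, h2.gen j⟩
    · cases hw

/-- Along the derivation tree, each call edge is expanded back into push, inner path and pop. The
inner path comes from the subtree and is trivial in `M`, so the expansion is a block. -/
theorem exists_reduces_of_yield (hE : Elementary E) (hR : StatesLt R E)
    (hP : ∀ p < R, ∀ q < R, ∀ v, P (callLetter R p q) v → Accepts G (nextEdges true R E) p q v)
    {z w : List ℕ} (hy : Yield (R * R) (k + 2) P z w) {p q : ℕ} {v : List ℕ}
    (h : Path (nextEdges true R E) p z v q) :
    ∃ w' u, w = w'.map (· + 2) ∧ Path E p w' u q ∧ G.Reduces u v := by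
  induction hy generalizing p q v with
  | nil =>
    obtain ⟨u, h1, h2⟩ := h.of_nextEdges_of_noInput (G := G) hE rfl
    exact ⟨[], u, rfl, h1, h2⟩
  | @terminal x z w hx hy ih =>
    obtain ⟨a, b, v₁, v₂, rfl, h1, h2, h3⟩ := h.cons_input (elementary_nextEdges hE true) rfl
    obtain ⟨u₁, hp₁, hr₁⟩ := h1.of_nextEdges_of_noInput (G := G) hE rfl
    obtain ⟨w', u₂, rfl, hp₂, hr₂⟩ := ih h3
    rcases (mem_nextEdges_true hE).1 h2 with (⟨h, -⟩ | ⟨y, h, -, he⟩ | ⟨j, h, -⟩) |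
      ⟨s', t', h, -, he, he'⟩
    · cases h
    · have hxy : x = y + 2 := by simp at h; omega
      subst hxy
      refine ⟨y :: w', u₁ ++ u₂, rfl, ?_, hr₁.append hr₂⟩
      simpa using hp₁.append (Path.cons he hp₂)
    · cases h
    -- A call letter is at most `R * R` and therefore not a terminal.
    · have := mul_add_lt (hR _ he).2 (hR _ he').1
      simp [callLetter] at h this
      omega
  | @nonterminal A κ z w₁ w₂ hA hκ hy hy' ih ih' =>
    obtain ⟨a, b, v₁, v₂, rfl, h1, h2, h3⟩ := h.cons_input (elementary_nextEdges hE true) rfl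
    obtain ⟨u₁, hp₁, hr₁⟩ := h1.of_nextEdges_of_noInput (G := G) hE rfl
    obtain ⟨w₂', u₂, rfl, hp₂, hr₂⟩ := ih' h3
    rcases (mem_nextEdges_true hE).1 h2 with (⟨h, -⟩ | ⟨y, h, -, he⟩ | ⟨j, h, -⟩) |
      ⟨s', t', h, -, he, he'⟩
    · cases h
    · simp at h; omega
    · cases h
    · simp only [List.cons.injEq, and_true] at h
      subst h
      obtain ⟨v, hv, hv1⟩ := hP s' (hR _ he).2 t' (hR _ he').1 κ hκ
      obtain ⟨w₁', u₃, rfl, hp₃, hr₃⟩ := ih hv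
      refine ⟨w₁' ++ w₂', u₁ ++ ([0] ++ u₃ ++ [1]) ++ u₂, by simp, ?_, ?_⟩
      · have := (hp₁.append (((Path.single he).append hp₃).append (Path.single he'))).append hp₂
        simpa using this
      · refine GenMonoid.Reduces.append ?_ hr₂
        exact hr₁.block hr₃ hv1

end Stack

/-! ### Direct products with `ℤ` -/

theorem dropGens_cons_zero (u : List ℕ) : dropGens 2 (0 :: u) = dropGens 2 u := by simp [dropGens]
theorem dropGens_cons_one (u : List ℕ) : dropGens 2 (1 :: u) = dropGens 2 u := by simp [dropGens]
theorem dropGens_cons_add_two (j : ℕ) (u : List ℕ) :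
    dropGens 2 ((j + 2) :: u) = j :: dropGens 2 u := by simp [dropGens]

/-- The word `z` is the input with a marker inserted wherever the path uses a generator of `ℤ`; no
order between letters and generators is lost. -/
theorem Path.nextEdges_false (hE : Elementary E) {p q : ℕ} {w u : List ℕ} (h : Path E p w u q)
    (hw : ∀ x ∈ w, x < k) :
    ∃ z, Path (nextEdges false R E) p (z.map (· + (R * R + 1))) (dropGens 2 u) q ∧
      z.count 0 = u.count 0 ∧ z.count 1 = u.count 1 ∧ dropGens 2 z = w ∧
      ∀ x ∈ z, x < k + 2 := by
  induction h with
  | nil => exact ⟨[], Path.nil _, rfl, rfl, rfl, by simp⟩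
  | @cons _ _ _ _ _ w' u' he _ ih =>
    rcases hE.cases he with ⟨rfl, rfl⟩ | ⟨x, rfl, rfl⟩ | ⟨j, rfl, rfl⟩
    · obtain ⟨z, h1, h2⟩ := ih hw
      exact ⟨z, Path.cons (w := []) (u := [])
        ((mem_nextEdges_false hE).2 (Or.inl (Or.inl ⟨rfl, rfl, he⟩))) h1, h2⟩
    · obtain ⟨z, h1, h2, h3, h4, h5⟩ := ih fun x hx => hw x (by simp [hx])
      refine ⟨(x + 2) :: z, ?_, by simpa using h2, by simpa using h3,
        by rw [dropGens_cons_add_two, h4]; rfl, ?_⟩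
      · have := Path.cons (u := [])
          ((mem_nextEdges_false (R := R) hE).2 (Or.inl (Or.inr (Or.inl ⟨x, rfl, rfl, he⟩)))) h1
        rw [List.map_cons, show x + 2 + (R * R + 1) = x + (R * R + 3) by ring]
        exact this
      · have := hw x (by simp)
        simpa [this] using h5
    · obtain ⟨z, h1, h2, h3, h4, h5⟩ := ih hw
      match j with
      | 0 =>
        refine ⟨0 :: z, ?_, by simp [h2], by simp [h3], by rw [dropGens_cons_zero, h4]; rfl,
          by simpa using h5⟩
        have := Path.cons (u := []) ((mem_nextEdges_false (R := R) hE).2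
          (Or.inr (Or.inl ⟨rfl, rfl, he⟩))) h1
        rw [List.map_cons, zero_add, List.singleton_append, dropGens_cons_zero]
        exact this
      | 1 =>
        refine ⟨1 :: z, ?_, by simp [h2], by simp [h3], by rw [dropGens_cons_one, h4]; rfl,
          by simpa using h5⟩
        have := Path.cons (u := []) ((mem_nextEdges_false (R := R) hE).2
          (Or.inr (Or.inr ⟨rfl, rfl, he⟩))) h1
        rw [List.map_cons, add_comm 1, List.singleton_append, dropGens_cons_one]
        exact this
      | j + 2 =>
        refine ⟨z, ?_, by simp [h2], by simp [h3], h4, h5⟩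
        rw [List.singleton_append, dropGens_cons_add_two]
        exact Path.cons (w := []) (u := [j])
          ((mem_nextEdges_false hE).2 (Or.inl (Or.inr (Or.inr ⟨j, rfl, rfl, he⟩)))) h1

theorem Path.of_nextEdges_false (hE : Elementary E) {p q : ℕ} {v u : List ℕ}
    (h : Path (nextEdges false R E) p v u q) {z : List ℕ} (hz : v = z.map (· + (R * R + 1))) :
    ∃ u', Path E p (dropGens 2 z) u' q ∧ dropGens 2 u' = u ∧
      z.count 0 = u'.count 0 ∧ z.count 1 = u'.count 1 := by
  induction h generalizing z with
  | nil => rw [List.map_eq_nil_iff.1 hz.symm]; exact ⟨[], Path.nil _, rfl, rfl, rfl⟩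
  | cons he₀ _ ih =>
    rcases (mem_nextEdges_false hE).1 he₀ with (⟨rfl, rfl, he⟩ | ⟨x, rfl, rfl, he⟩ |
      ⟨j, rfl, rfl, he⟩) | ⟨rfl, rfl, he⟩ | ⟨rfl, rfl, he⟩
    · obtain ⟨u', h1, h2, h3, h4⟩ := ih hz
      exact ⟨u', by simpa using Path.cons he h1, h2, h3, h4⟩
    · rcases z with _ | ⟨y, z⟩
      · cases hz
      rw [List.singleton_append, List.map_cons, List.cons.injEq] at hz
      obtain rfl : y = x + 2 := by omega
      obtain ⟨u', h1, h2, h3, h4⟩ := ih hz.2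
      exact ⟨u', by rw [dropGens_cons_add_two]; simpa using Path.cons he h1, h2, by simpa using h3,
        by simpa using h4⟩
    · obtain ⟨u', h1, h2, h3, h4⟩ := ih hz
      exact ⟨(j + 2) :: u', by simpa using Path.cons he h1, by rw [dropGens_cons_add_two, h2]; rfl,
        by simpa using h3, by simpa using h4⟩
    · rcases z with _ | ⟨y, z⟩
      · cases hz
      rw [List.singleton_append, List.map_cons, List.cons.injEq] at hz
      obtain rfl : y = 0 := by omega
      obtain ⟨u', h1, h2, h3, h4⟩ := ih hz.2
      exact ⟨0 :: u', by rw [dropGens_cons_zero]; simpa using Path.cons he h1,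
        by rw [dropGens_cons_zero, h2]; rfl, by simpa using h3, by simpa using h4⟩
    · rcases z with _ | ⟨y, z⟩
      · cases hz
      rw [List.singleton_append, List.map_cons, List.cons.injEq] at hz
      obtain rfl : y = 1 := by omega
      obtain ⟨u', h1, h2, h3, h4⟩ := ih hz.2
      exact ⟨1 :: u', by rw [dropGens_cons_one]; simpa using Path.cons he h1,
        by rw [dropGens_cons_one, h2]; rfl, by simpa using h3, by simpa using h4⟩

theorem Yield.eq_map {n m : ℕ} {P : ℕ → List ℕ → Prop} {v z : List ℕ} (h : Yield n m P v z)
    (hv : ∀ x ∈ v, n < x) : v = z.map (· + (n + 1)) := by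
  induction h with
  | nil => rfl
  | terminal _ _ ih =>
    rw [List.map_cons, ← ih fun x hx => hv x (by simp [hx]), add_comm]
  | nonterminal hA => have := hv _ List.mem_cons_self; omega

theorem Yield.of_map {n m : ℕ} {P : ℕ → List ℕ → Prop} {z : List ℕ} (h : ∀ x ∈ z, x < m) :
    Yield n m P (z.map (· + (n + 1))) z := by
  induction z with
  | nil => exact Yield.nil
  | cons x z ih =>
    rw [List.map_cons, add_comm]
    exact Yield.terminal (h x (by simp)) (ih fun y hy => h y (by simp [hy]))

theorem Path.input_gt_of_nextEdges_false (hE : Elementary E) {p q : ℕ} {v u : List ℕ}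
    (h : Path (nextEdges false R E) p v u q) : ∀ x ∈ v, R * R < x := by
  induction h with
  | nil => simp
  | cons he _ ih =>
    intro y hy
    rcases List.mem_append.1 hy with hy | hy
    · rcases (mem_nextEdges_false hE).1 he with (⟨rfl, -⟩ | ⟨x, rfl, -⟩ | ⟨j, rfl, -⟩) |
        ⟨rfl, -⟩ | ⟨rfl, -⟩ <;> simp at hy <;> omega
    · exact ih y hy

theorem dropGens_map_add_two (w : List ℕ) : dropGens 2 (w.map (· + 2)) = w := by
  induction w with
  | nil => rfl
  | cons x w ih => rw [List.map_cons, dropGens_cons_add_two, ih]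

theorem count_map_add_two (w : List ℕ) {i : ℕ} (hi : i < 2) : (w.map (· + 2)).count i = 0 := by
  rw [List.count_eq_zero]
  simp only [List.mem_map, not_exists, not_and]
  intro x _; omega

/-- One statement covers both operations, since each leaves one half of it idle. For `M × ℤ` no
nonterminal occurs in `v`, so the yield is mere renumbering and the equality of counts is the
condition in `ℤ`. For `𝔹 * M` no marker occurs in `z`, so both counts vanish and the grammar does
the work. -/
theorem accepts_cons_iff (hE : Elementary E) (hR : StatesLt R E) {n : ℕ} {b : Bool}
    {ops : List Bool} {P : ℕ → List ℕ → Prop}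
    (hP : ∀ p < R, ∀ q < R, ∀ v, P (callLetter R p q) v ↔ (∀ x ∈ v, x < R * R + 1 + (k + 2)) ∧
      Accepts (scMonoid n ops) (nextEdges b R E) p q v)
    {p q : ℕ} {w : List ℕ} (hw : ∀ x ∈ w, x < k) :
    Accepts (scMonoid n (b :: ops)) E p q w ↔
      ∃ v z, Accepts (scMonoid n ops) (nextEdges b R E) p q v ∧ Yield (R * R) (k + 2) P v z ∧
        z.count 0 = z.count 1 ∧ dropGens 2 z = w := by
  cases b
  · rw [scMonoid_false]
    constructor
    · rintro ⟨u, hu, h1⟩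
      rw [blindGen_eval_eq_one_iff] at h1
      obtain ⟨z, hz, h2, h3, h4, h5⟩ := hu.nextEdges_false (R := R) hE hw
      exact ⟨_, z, ⟨_, hz, h1.1⟩, Yield.of_map h5, by omega, h4⟩
    · rintro ⟨v, z, ⟨u, hu, h1⟩, hy, hc, rfl⟩
      obtain rfl := hy.eq_map (hu.input_gt_of_nextEdges_false hE)
      obtain ⟨u', hp, h2, h3, h4⟩ := hu.of_nextEdges_false hE rfl
      exact ⟨u', hp, (blindGen_eval_eq_one_iff _ _).2 ⟨by rw [h2, h1], by omega⟩⟩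
  · rw [scMonoid_true]
    constructor
    · rintro ⟨u, hu, h1⟩
      obtain ⟨v, hr, hv⟩ := (stackGen_eval_eq_one_iff _).1 h1
      obtain ⟨z, hz, hy⟩ := exists_yield_of_reduces hE hR
        (fun p hp q hq v hv h => (hP p hp q hq v).2 ⟨hv, h⟩) hr hu hw
      refine ⟨z, _, ⟨v, hz, hv⟩, hy, ?_, dropGens_map_add_two w⟩
      rw [count_map_add_two _ (by omega), count_map_add_two _ (by omega)]
    · rintro ⟨v, z, ⟨u, hu, h1⟩, hy, hc, rfl⟩
      obtain ⟨w', u', rfl, hp, hr⟩ := exists_reduces_of_yield hE hR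
        (fun p hp q hq v h => ((hP p hp q hq v).1 h).2) hy hu
      rw [dropGens_map_add_two]
      exact ⟨u', hp, (stackGen_eval_eq_one_iff _).2 ⟨_, hr, h1⟩⟩

end ValenceLang

/-! ### Petri nets for powers of `𝔹`, and the induction over the operations -/

namespace ValenceLang

variable {E : List Edge} {n R k : ℕ}

/-! ### Automata over `𝔹^n` as Petri nets -/

/-- An equivalent automaton without loops: the states `2 * s` and `2 * s + 1` stand for `s`. -/
def doubleEdges (E : List Edge) : List Edge :=
  (E.map fun e => (2 * e.1, e.2.1, e.2.2.1, 2 * e.2.2.2 + 1)) ++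
    E.map fun e => (2 * e.2.2.2 + 1, [], [], 2 * e.2.2.2)

theorem mem_doubleEdges {s t : ℕ} {w u : List ℕ} (h : (s, w, u, t) ∈ doubleEdges E) :
    (∃ s' t', s = 2 * s' ∧ t = 2 * t' + 1 ∧ (s', w, u, t') ∈ E) ∨
      ∃ s', s = 2 * s' + 1 ∧ t = 2 * s' ∧ w = [] ∧ u = [] := by
  rcases List.mem_append.1 h with h | h <;> obtain ⟨⟨a, b, c, d⟩, he, h⟩ := List.mem_map.1 h <;>
    simp only [Prod.mk.injEq] at h <;> obtain ⟨rfl, rfl, rfl, rfl⟩ := h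
  · exact Or.inl ⟨_, _, rfl, rfl, he⟩
  · exact Or.inr ⟨_, rfl, rfl, rfl, rfl⟩

theorem Path.doubleEdges {s t : ℕ} {w u : List ℕ} (h : Path E s w u t) :
    Path (doubleEdges E) (2 * s) w u (2 * t) := by
  induction h with
  | nil => exact Path.nil _
  | cons he _ ih =>
    exact Path.cons (List.mem_append.2 (Or.inl (List.mem_map.2 ⟨_, he, rfl⟩)))
      (Path.cons (w := []) (u := []) (List.mem_append.2 (Or.inr (List.mem_map.2 ⟨_, he, rfl⟩))) ih)

theorem Path.of_doubleEdges {s t : ℕ} {w u : List ℕ} (h : Path (ValenceLang.doubleEdges E) s w u t) :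
    Path E (s / 2) w u (t / 2) := by
  induction h with
  | nil => exact Path.nil _
  | cons he _ ih =>
    rcases mem_doubleEdges he with ⟨s', t', rfl, rfl, he'⟩ | ⟨s', rfl, rfl, rfl, rfl⟩
    · rw [show (2 * t' + 1) / 2 = t' by omega] at ih
      rw [show 2 * s' / 2 = s' by omega]
      exact Path.cons he' ih
    · rw [show 2 * s' / 2 = s' by omega] at ih
      rw [show (2 * s' + 1) / 2 = s' by omega]
      exact ih

/-- A transition is a single vector. For a loop, the token removed and the token returned would
cancel and the state would not be tested; the detour through the odd states avoids this. -/
theorem accepts_doubleEdges_iff {G : GenMonoid} {s t : ℕ} {w : List ℕ} :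
    Accepts G (doubleEdges E) (2 * s) (2 * t) w ↔ Accepts G E s t w := by
  constructor
  · rintro ⟨u, h, h1⟩
    refine ⟨u, ?_, h1⟩
    simpa using h.of_doubleEdges
  · rintro ⟨u, h, h1⟩
    exact ⟨u, h.doubleEdges, h1⟩

theorem elementary_doubleEdges (hE : Elementary E) : Elementary (doubleEdges E) := by
  rintro ⟨s, w, u, t⟩ h
  rcases mem_doubleEdges h with ⟨s', t', rfl, rfl, he'⟩ | ⟨s', rfl, rfl, rfl, rfl⟩
  · exact (hE _ he' :)
  · simp

theorem statesLt_doubleEdges (hR : StatesLt R E) : StatesLt (2 * R) (doubleEdges E) := by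
  intro e h
  rcases List.mem_append.1 h with h | h <;> obtain ⟨e, he, rfl⟩ := List.mem_map.1 h <;>
    have := hR _ he <;> simp only <;> omega

/-- The effect of at most one generator on the counter `i`. -/
def counterEffect (i : ℕ) (u : List ℕ) : ℤ :=
  if u = [2 * i] then 1 else if u = [2 * i + 1] then -1 else 0

/-- A single generator fails only if the result would be negative, which a natural number `b`
excludes. A longer word could also fail in between. -/
theorem counterRun_coordWord_iff {i a b : ℕ} {u : List ℕ} (hu : u.length ≤ 1) :
    counterRun (coordWord i u) a = some b ↔ (b : ℤ) = a + counterEffect i u := by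
  rcases u with _ | ⟨j, _ | ⟨j', u⟩⟩
  · simp [counterRun, coordWord, counterEffect, eq_comm]
  · by_cases h1 : j = 2 * i
    · subst h1
      simp [coordWord, counterRun, counterStep, counterEffect]
      omega
    · by_cases h2 : j = 2 * i + 1
      · subst h2
        have h3 : (2 * i + 1) / 2 = i := by omega
        cases a <;> simp [coordWord, counterRun, counterStep, counterEffect, h3] <;> omega
      · have h3 : j / 2 ≠ i := by omega
        simp [coordWord, counterRun, counterEffect, h1, h2, h3]
        omega
  · simp at hu

/-- The vector of a transition that simulates an edge: the first `R` places hold the state. -/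
def edgeVector (R d : ℕ) (e : Edge) : List ℤ :=
  (List.range d).map fun i => if i = e.1 then -1 else if i = e.2.2.2 then 1 else
    if R ≤ i then (if e.2.2.1 = [2 * (i - R)] then 1 else
      if e.2.2.1 = [2 * (i - R) + 1] then -1 else 0) else 0

/-- The marking for a state without tokens on the other places. -/
def stateVector (d s : ℕ) : List ℕ := (List.range d).map fun i => if i = s then 1 else 0

/-- A Petri net for an automaton over `𝔹^n`. -/
def netCode (n R : ℕ) (E : List Edge) (p q : ℕ) : PetriCode :=
  (R + n, E.map fun e => (e.2.1.head?, edgeVector R (R + n) e), stateVector (R + n) p,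
    [stateVector (R + n) q])

/-- The marking for a state and a counter valuation. -/
def netMarking (R n s : ℕ) (μ : ℕ → ℕ) : Fin (R + n) → ℕ :=
  fun i => if (i : ℕ) < R then (if (i : ℕ) = s then 1 else 0) else μ (i - R)

theorem getD_map_range {α : Type} (d i : ℕ) (f : ℕ → α) (z : α) (hi : i < d) :
    ((List.range d).map f).getD i z = f i := by
  simp [List.getD, hi]

theorem vecOf_stateVector {s : ℕ} (hs : s < R) :
    vecOf (R + n) (stateVector (R + n) s) = netMarking R n s 0 := by
  funext i
  rw [vecOf, stateVector, getD_map_range _ _ _ _ i.2, netMarking]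
  split_ifs <;> first | rfl | omega

/-- The transition removes a token from the place `s'`, and `s` is the only marked place among the
states, so `s = s'`. On the remaining places the claim is `counterRun_coordWord_iff`. -/
theorem netStep_iff {s s' t : ℕ} {w u : List ℕ} (hu : u.length ≤ 1) (hs' : s' < R) (ht : t < R)
    (hst : s' ≠ t) (hs : s < R) (μ : ℕ → ℕ) (μ' : Fin (R + n) → ℕ) :
    (∀ i, (μ' i : ℤ) = netMarking R n s μ i +
      vecOf (R + n) (edgeVector R (R + n) (s', w, u, t)) i) ↔
      s = s' ∧ ∃ ν, μ' = netMarking R n t ν ∧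
        ∀ i < n, counterRun (coordWord i u) (μ i) = some (ν i) := by
  have hv : ∀ i : Fin (R + n), vecOf (R + n) (edgeVector R (R + n) (s', w, u, t)) i =
      if (i : ℕ) = s' then -1 else if (i : ℕ) = t then 1 else
        if R ≤ i then counterEffect (i - R) u else 0 := by
    intro i
    rw [vecOf, edgeVector, getD_map_range _ _ _ _ i.2]
    rfl
  constructor
  · intro h
    have hss : s = s' := by
      have := h ⟨s', by omega⟩
      rw [hv] at this
      simp only [netMarking, hs', if_true] at this
      by_contra hne
      rw [if_neg (Ne.symm hne)] at this
      push_cast at this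
    subst hss
    refine ⟨rfl, fun i => if h : i < n then μ' ⟨R + i, by omega⟩ else 0, ?_, ?_⟩
    · funext i
      have h1 := h i
      rw [hv] at h1
      simp only [netMarking] at h1 ⊢
      by_cases hi : (i : ℕ) < R
      · rw [if_neg (show ¬ R ≤ (i : ℕ) by omega)] at h1
        rw [if_pos hi] at h1 ⊢
        split_ifs at h1 ⊢ <;> push_cast at h1 <;> omega
      · rw [if_neg hi]
        have h2 : (i : ℕ) - R < n := by omega
        rw [dif_pos h2]
        exact congrArg μ' (Fin.ext (by simp; omega))
    · intro i hi
      rw [counterRun_coordWord_iff hu]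
      simp only [dif_pos hi]
      have h1 := h ⟨R + i, by omega⟩
      rw [hv] at h1
      simp only [netMarking] at h1
      rw [if_neg (by omega), if_neg (by omega), if_neg (by omega), if_pos (by omega)] at h1
      rw [h1, show R + i - R = i by omega]
  · rintro ⟨rfl, ν, rfl, h⟩ i
    rw [hv]
    simp only [netMarking]
    by_cases hi : (i : ℕ) < R
    · rw [if_pos hi, if_pos hi, if_neg (show ¬ R ≤ (i : ℕ) by omega)]
      split_ifs <;> simp <;> omega
    · rw [if_neg hi, if_neg hi, if_neg (by omega), if_neg (by omega), if_pos (by omega)]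
      exact (counterRun_coordWord_iff hu).1 (h _ (by omega))

theorem coordWord_run_append {u u' : List ℕ} {i a : ℕ} {b : ℕ} :
    counterRun (coordWord i (u ++ u')) a = some b ↔ ∃ c, counterRun (coordWord i u) a = some c ∧
      counterRun (coordWord i u') c = some b := by
  rw [coordWord_append, counterRun_append, Option.bind_eq_some_iff]

theorem fWord_netCode_iff (hE : Elementary E) (hR : StatesLt R E)
    (hloop : ∀ e ∈ E, e.1 ≠ e.2.2.2) {p q : ℕ} (hp : p < R) (hq : q < R) {w : List ℕ}
    (hw : ∀ x ∈ w, x < k) :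
    FWord 0 k (Encodable.encode (netCode n R E p q)) w ↔ Accepts (powGen n) E p q w := by
  set N := petriOfCode k (R + n) (E.map fun e => (e.2.1.head?, edgeVector R (R + n) e))
    (stateVector (R + n) p) [stateVector (R + n) q] with hN
  have htr : ∀ (x : Option (Fin k)) (ν : Fin (R + n) → ℤ), (x, ν) ∈ N.trans ↔
      ∃ s w u t, (s, w, u, t) ∈ E ∧ w = (x.toList.map Fin.val) ∧
        ν = vecOf (R + n) (edgeVector R (R + n) (s, w, u, t)) := by
    intro x ν
    constructor
    · rintro ⟨_, hs, h1, h2⟩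
      obtain ⟨⟨s, w, u, t⟩, he, rfl⟩ := List.mem_map.1 hs
      refine ⟨s, w, u, t, he, ?_, h2⟩
      simp only at h1
      rcases hE.cases he with ⟨rfl, rfl⟩ | ⟨y, rfl, rfl⟩ | ⟨j, rfl, rfl⟩ <;> cases x <;>
        simp_all
    · rintro ⟨s, w, u, t, he, rfl, rfl⟩
      refine ⟨_, List.mem_map.2 ⟨_, he, rfl⟩, ?_, rfl⟩
      cases x <;> simp
  have key : ∀ w : List (Fin k), w ∈ N.lang ↔ N.Run (netMarking R n p 0) w (netMarking R n q 0) := by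
    intro w
    have h1 : N.init = netMarking R n p 0 := vecOf_stateVector hp
    constructor
    · rintro ⟨μ, ⟨l, hl, hμ⟩, hr⟩
      rw [List.mem_singleton.1 hl, vecOf_stateVector hq] at hμ
      rwa [hμ, h1] at hr
    · intro hr
      exact ⟨_, ⟨_, List.mem_singleton.2 rfl, (vecOf_stateVector hq).symm⟩, h1 ▸ hr⟩
  have main : ∀ w : List (Fin k), w ∈ N.lang ↔ Accepts (powGen n) E p q (w.map Fin.val) := by
    intro w
    rw [key]
    constructor
    · intro h
      -- Transitions are removed at the front, so state and counters are arbitrary at the start,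
      -- while the target keeps empty counters.
      suffices H : ∀ μ₁ w μ₂, N.Run μ₁ w μ₂ → μ₂ = netMarking R n q 0 → ∀ s < R, ∀ μ,
          μ₁ = netMarking R n s μ → ∃ u, Path E s (w.map Fin.val) u q ∧
            ∀ i < n, counterRun (coordWord i u) (μ i) = some 0 by
        obtain ⟨u, hu, h1⟩ := H _ _ _ h rfl p hp 0 rfl
        exact ⟨u, hu, (powGen_eval_eq_one_iff n u).2 h1⟩
      intro μ₁ w μ₂ h
      induction h with
      | nil μ₁ =>
        rintro rfl s hs μ h
        have h1 := congrFun h ⟨q, by omega⟩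
        simp only [netMarking, hq, if_true] at h1
        have hqs : q = s := by by_contra h; simp [h] at h1
        subst hqs
        refine ⟨[], Path.nil _, fun i hi => ?_⟩
        have h1 := congrFun h ⟨R + i, by omega⟩
        simp [netMarking] at h1
        simp [coordWord, counterRun, ← h1]
      | cons ht hm _ ih =>
        rintro h2 s hs μ rfl
        obtain ⟨s', v, u, t, he, hv, rfl⟩ := (htr _ _).1 ht
        have hlt := hR _ he
        obtain ⟨rfl, ν, hν, hc⟩ := (netStep_iff (by have := hE _ he; simp at this; omega) hlt.1
          hlt.2 (hloop _ he) hs μ _).1 hm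
        obtain ⟨u', hu', hc'⟩ := ih h2 t hlt.2 ν hν
        refine ⟨u ++ u', ?_, fun i hi => coordWord_run_append.2 ⟨_, hc i hi, hc' i hi⟩⟩
        rw [List.map_append, ← hv]
        exact Path.cons he hu'
    · rintro ⟨u, hu, h1⟩
      rw [powGen_eval_eq_one_iff] at h1
      suffices H : ∀ s w' u t, Path E s w' u t → s < R → ∀ w : List (Fin k), w' = w.map Fin.val →
          ∀ μ ν : ℕ → ℕ, (∀ i < n, counterRun (coordWord i u) (μ i) = some (ν i)) →
          N.Run (netMarking R n s μ) w (netMarking R n t ν) from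
        H _ _ _ _ hu hp w rfl 0 0 h1
      intro s w' u t h
      induction h with
      | nil s =>
        intro hs w hw μ ν h
        have : netMarking R n s μ = netMarking R n s ν := by
          funext i
          simp only [netMarking]
          split_ifs with h1 h2
          · rfl
          · rfl
          · have := h (i - R) (by omega)
            simpa [coordWord, counterRun] using this
        rw [List.map_eq_nil_iff.1 hw.symm, this]
        exact PetriNet.Run.nil _
      | @cons s t q v u v' u' he _ ih =>
        intro hs w hw μ ν h
        obtain ⟨w₁, w₂, rfl, rfl, rfl⟩ := List.map_eq_append_iff.1 hw.symm
        have hlt := hR _ he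
        have h2 : ∀ i, ∃ c, i < n → counterRun (coordWord i u) (μ i) = some c ∧
            counterRun (coordWord i u') c = some (ν i) := by
          intro i
          by_cases hi : i < n
          · obtain ⟨c, hc⟩ := coordWord_run_append.1 (h i hi)
            exact ⟨c, fun _ => hc⟩
          · exact ⟨0, fun h => absurd h hi⟩
        -- The counters after the first edge; the values from `n` on are irrelevant.
        choose ρ hρ using h2
        have hel := hE _ he
        simp only [List.length_map] at hel
        have hx : ∃ x : Option (Fin k), w₁ = x.toList := by
          rcases w₁ with _ | ⟨x, _ | ⟨y, w₁⟩⟩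
          · exact ⟨none, rfl⟩
          · exact ⟨some x, rfl⟩
          · simp at hel; omega
        obtain ⟨x, rfl⟩ := hx
        refine PetriNet.Run.cons ((htr _ _).2 ⟨_, _, _, _, he, rfl, rfl⟩) ?_
          (ih hlt.2 w₂ rfl ρ ν fun i hi => (hρ i hi).2)
        exact (netStep_iff (by omega) hlt.1 hlt.2 (hloop _ he) hs μ _).2
          ⟨rfl, ρ, rfl, fun i hi => (hρ i hi).1⟩
  obtain ⟨w, rfl⟩ := exists_map_val hw
  rw [fWord_map_iff, ← main, hN]
  rw [fLang, Denumerable.ofNat_encode]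
  rfl

/-! ### Codes for the languages between two states -/

/-- The semilinear set of the vectors whose first two entries agree. -/
def markerSet (k : ℕ) : List (List ℕ × List (List ℕ)) :=
  [([], [1, 1] :: (List.range k).map fun x => (List.range (x + 2)).map (fun _ => 0) ++ [1])]

theorem mem_semilinearOf_markerSet (v : Fin (k + 2) → ℕ) :
    v ∈ semilinearOf (k + 2) (markerSet k) ↔ v 0 = v 1 := by
  have hunit : ∀ x, vecOf (k + 2) ((List.range (x + 2)).map (fun _ => 0) ++ [1]) =
      fun i : Fin (k + 2) => if (i : ℕ) = x + 2 then 1 else 0 := by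
    intro x
    funext i
    rw [vecOf]
    by_cases h1 : (i : ℕ) < x + 2
    · rw [List.getD_append _ _ _ _ (by simpa using h1), getD_map_range _ _ _ _ h1,
        if_neg (by omega)]
    · rw [List.getD_append_right _ _ _ _ (by simpa using h1)]
      by_cases h2 : (i : ℕ) = x + 2
      · simp [h2]
      · rw [if_neg h2, List.getD_eq_default]
        simp; omega
  constructor
  · rintro ⟨s, hs, x, hx, rfl⟩
    rw [markerSet, List.mem_singleton] at hs
    subst hs
    have h0 : x 0 = x 1 := by
      induction hx using AddSubmonoid.closure_induction with
      | mem x hx =>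
        obtain ⟨l, hl, rfl⟩ := hx
        rcases List.mem_cons.1 hl with rfl | hl
        · rfl
        · obtain ⟨y, -, rfl⟩ := List.mem_map.1 hl
          rw [hunit]; simp
      | zero => rfl
      | add a b _ _ ha hb => simp [ha, hb]
    simp [vecOf, h0]
  · intro h
    refine ⟨_, List.mem_singleton.2 rfl, v, ?_, ?_⟩
    -- The period `(1, 1, 0, …)` accounts for the markers, which are equally frequent, and the unit
    -- vectors for the letters.
    · have hv : v = v 0 • vecOf (k + 2) [1, 1] + ∑ x : Fin k, v x.succ.succ •
          vecOf (k + 2) ((List.range ((x : ℕ) + 2)).map (fun _ => 0) ++ [1]) := by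
        simp only [hunit]
        funext i
        simp only [Pi.add_apply, Pi.smul_apply, Finset.sum_apply, smul_eq_mul]
        refine Fin.cases ?_ (fun i => Fin.cases ?_ (fun i => ?_) i) i
        · simp [vecOf]
        · simp [vecOf]; exact h.symm
        · rw [Finset.sum_eq_single i]
          · simp [vecOf]
          · intro j _ hj
            have : (i : ℕ) ≠ j := fun h => hj (Fin.ext h.symm)
            simp [this]
          · simp
      rw [hv]
      refine add_mem (AddSubmonoid.nsmul_mem _ (AddSubmonoid.subset_closure ?_) _)
        (sum_mem fun x _ => AddSubmonoid.nsmul_mem _ (AddSubmonoid.subset_closure ?_) _)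
      · exact ⟨_, List.mem_cons_self, rfl⟩
      · exact ⟨_, List.mem_cons_of_mem _ (List.mem_map.2 ⟨x, List.mem_range.2 x.2, rfl⟩), rfl⟩
    · funext i; simp [vecOf]

/-- The grammar with the right-hand sides `T` for all pairs of states, with the start symbol for
the pair number `t`. -/
def pairCode (R k : ℕ) (T : List ℕ) (t : ℕ) : StepCode :=
  -- The start symbol `0` repeats the right-hand sides of the pair number `t`, whose own nonterminal
  -- is `t + 1`. The terminals `0` and `1` are the markers, and their images are empty.
  (R * R, k + 2, (0, T.getD t 0) :: (List.range (R * R)).map (fun t => (t + 1, T.getD t 0)),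
    [] :: [] :: (List.range k).map (fun x => [x]), markerSet k)

/-- Codes for the languages between any two of the states `0, …, R - 1`; the pair of `p` and `q`
has the number `p * R + q`. -/
def codeTable (n R : ℕ) : List Bool → ℕ → List Edge → List ℕ
  | [], _, E => (List.range (R * R)).map fun t =>
      Encodable.encode (netCode n (2 * R) (doubleEdges E) (2 * (t / R)) (2 * (t % R)))
  | b :: ops, k, E => (List.range (R * R)).map fun t =>
      Encodable.encode (pairCode R k
        (codeTable n R ops (R * R + 1 + (k + 2)) (nextEdges b R E)) t)

theorem codeRhs_zero_iff {i K t : ℕ} {T : List ℕ} {v : List ℕ} :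
    CodeRhs i K ((0, T.getD t 0) :: (List.range (R * R)).map (fun t => (t + 1, T.getD t 0))) 0 v ↔
      FWord i K (T.getD t 0) v := by
  constructor
  · rintro ⟨c, hc, h⟩
    rcases List.mem_cons.1 hc with hc | hc
    · rw [Prod.mk.injEq] at hc
      rwa [hc.2] at h
    · obtain ⟨x, -, hx⟩ := List.mem_map.1 hc
      simp at hx
  · exact fun h => ⟨_, List.mem_cons_self, h⟩

theorem codeRhs_callLetter_iff {i K t p q : ℕ} (hp : p < R) (hq : q < R) {T : List ℕ}
    {v : List ℕ} :
    CodeRhs i K ((0, T.getD t 0) :: (List.range (R * R)).map (fun t => (t + 1, T.getD t 0)))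
      (callLetter R p q) v ↔ FWord i K (T.getD (p * R + q) 0) v := by
  constructor
  · rintro ⟨c, hc, h⟩
    rcases List.mem_cons.1 hc with hc | hc
    · simp [callLetter] at hc
    · obtain ⟨x, -, hx⟩ := List.mem_map.1 hc
      simp only [callLetter, Prod.mk.injEq, Nat.add_right_cancel_iff] at hx
      rwa [← hx.2, hx.1] at h
  · exact fun h => ⟨_, List.mem_cons_of_mem _ (List.mem_map.2
      ⟨p * R + q, List.mem_range.2 (mul_add_lt hp hq), rfl⟩), h⟩

theorem flatMap_markers {z : List ℕ} (hz : ∀ x ∈ z, x < k + 2) :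
    (z.flatMap fun x => ([] :: [] :: (List.range k).map (fun x => [x])).getD x []).filter
      (fun x => decide (x < k)) = dropGens 2 z := by
  induction z with
  | nil => rfl
  | cons x z ih =>
    have ih := ih fun y hy => hz y (List.mem_cons_of_mem _ hy)
    have hx := hz x List.mem_cons_self
    rw [List.flatMap_cons, List.filter_append, ih]
    match x with
    | 0 => rw [dropGens_cons_zero]; rfl
    | 1 => rw [dropGens_cons_one]; rfl
    | x + 2 =>
      rw [dropGens_cons_add_two, List.getD_cons_succ, List.getD_cons_succ,
        getD_map_range _ _ _ _ (by omega)]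
      have : x < k := by omega
      simp [this]

/-- The induction step is `accepts_cons_iff` with the right-hand sides of the code as `P`. From one
operation to the next the alphabet and the edges change, while the set of states stays; this is why
`k` and `E` are generalised and a whole table of pairs is carried along. -/
theorem fWord_codeTable_iff (n : ℕ) (ops : List Bool) (hE : Elementary E) (hR : StatesLt R E)
    {p q : ℕ} (hp : p < R) (hq : q < R) (w : List ℕ) :
    FWord ops.length k ((codeTable n R ops k E).getD (p * R + q) 0) w ↔
      (∀ x ∈ w, x < k) ∧ Accepts (scMonoid n ops) E p q w := by
  induction ops generalizing k E p q w with
  | nil =>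
    refine ⟨fun h => ⟨h.lt, ?_⟩, fun h => ?_⟩
    · have hw := h.lt
      rw [codeTable, getD_map_range _ _ _ _ (mul_add_lt hp hq), (mul_add_div_mod hq).1,
        (mul_add_div_mod hq).2, List.length_nil, fWord_netCode_iff (elementary_doubleEdges hE)
        (statesLt_doubleEdges hR) _ (by omega) (by omega) hw, accepts_doubleEdges_iff] at h
      · exact h
      · rintro ⟨s, w, u, t⟩ he
        rcases mem_doubleEdges he with ⟨s', t', rfl, rfl, -⟩ | ⟨s', rfl, rfl, -⟩ <;> simp only <;>
          omega
    · rw [codeTable, getD_map_range _ _ _ _ (mul_add_lt hp hq), (mul_add_div_mod hq).1,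
        (mul_add_div_mod hq).2, List.length_nil, fWord_netCode_iff (elementary_doubleEdges hE)
        (statesLt_doubleEdges hR) _ (by omega) (by omega) h.1, accepts_doubleEdges_iff]
      · exact h.2
      · rintro ⟨s, w, u, t⟩ he
        rcases mem_doubleEdges he with ⟨s', t', rfl, rfl, -⟩ | ⟨s', rfl, rfl, -⟩ <;> simp only <;>
          omega
  | cons b ops ih =>
    have hE' := elementary_nextEdges (R := R) hE b
    have hR' := statesLt_nextEdges hE hR b
    set T := codeTable n R ops (R * R + 1 + (k + 2)) (nextEdges b R E) with hT
    have hP : ∀ p' < R, ∀ q' < R, ∀ v, CodeRhs ops.length (R * R + 1 + (k + 2)) ((0,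
        T.getD (p * R + q) 0) :: (List.range (R * R)).map (fun t => (t + 1, T.getD t 0)))
        (callLetter R p' q') v ↔ (∀ x ∈ v, x < R * R + 1 + (k + 2)) ∧
        Accepts (scMonoid n ops) (nextEdges b R E) p' q' v := by
      intro p' hp q' hq v
      rw [codeRhs_callLetter_iff hp hq, ih hE' hR' hp hq]
    rw [codeTable, getD_map_range _ _ _ _ (mul_add_lt hp hq), List.length_cons, ← hT, pairCode,
      fWord_succ_iff (n := R * R) (m := k + 2) (S := markerSet k)
        (hs := [] :: [] :: (List.range k).map (fun x => [x]))
        (prods := (0, T.getD (p * R + q) 0) :: (List.range (R * R)).map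
          (fun t => (t + 1, T.getD t 0))) (Denumerable.ofNat_encode _)]
    have hcount : ∀ z : List ℕ, (fun y : Fin (k + 2) => z.count (y : ℕ)) ∈
        semilinearOf (k + 2) (markerSet k) ↔ z.count 0 = z.count 1 := by
      intro z
      rw [mem_semilinearOf_markerSet]; rfl
    constructor
    · rintro ⟨z, hy, hS, rfl⟩
      rw [hcount] at hS
      rw [flatMap_markers hy.lt]
      have hlt : ∀ x ∈ dropGens 2 z, x < k := by
        rw [← flatMap_markers hy.lt]
        intro x hx
        simpa using (List.mem_filter.1 hx).2
      refine ⟨hlt, (accepts_cons_iff hE hR hP hlt).2 ?_⟩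
      obtain ⟨v, hv, hy⟩ := hy.of_singleton (Nat.zero_le _)
      rw [codeRhs_zero_iff, ih hE' hR' hp hq] at hv
      exact ⟨v, z, hv.2, hy, hS, rfl⟩
    · rintro ⟨hw, ha⟩
      obtain ⟨v, z, hv, hy, hS, rfl⟩ := (accepts_cons_iff hE hR hP hw).1 ha
      refine ⟨z, Yield.singleton (Nat.zero_le _) ?_ hy, (hcount z).2 hS,
        (flatMap_markers hy.lt).symm⟩
      rw [codeRhs_zero_iff, ih hE' hR' hp hq]
      exact ⟨hy.lt', hv⟩

end ValenceLang

/-! ### Completion of the first translation; call stacks for grammars -/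

namespace ValenceLang

/-! ### From automata to codes of level languages -/

/-- The edges within the states `0, …, r` and edges from the final states to the new state
`r + 1`. -/
def restrictEdges (r : ℕ) (edges : List Edge) (finals : List ℕ) : List Edge :=
  (edges.filter fun e => e.1 ≤ r ∧ e.2.2.2 ≤ r) ++
    (finals.filter fun f => f ≤ r).map fun f => (f, [], [], r + 1)

/-- The new state `r + 1` is entered only from admissible final states and has no outgoing edge, so
it can serve as the only final state. -/
theorem accepts_restrictEdges_iff {G : GenMonoid} {r : ℕ} {edges : List Edge} {finals : List ℕ}
    {w : List ℕ} : Accepts G (restrictEdges r edges finals) 0 (r + 1) w ↔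
      ∃ f ∈ finals, f ≤ r ∧ Accepts G (edges.filter fun e => e.1 ≤ r ∧ e.2.2.2 ≤ r) 0 f w := by
  constructor
  · rintro ⟨u, hu, h1⟩
    have key := Path.snoc_induction (motive := fun w u t =>
      (t ≤ r ∧ Path (edges.filter fun e => e.1 ≤ r ∧ e.2.2.2 ≤ r) 0 w u t) ∨
      (t = r + 1 ∧ ∃ f ∈ finals, f ≤ r ∧
        Path (edges.filter fun e => e.1 ≤ r ∧ e.2.2.2 ≤ r) 0 w u f))
      (Or.inl ⟨Nat.zero_le _, Path.nil _⟩) ?_ hu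
    · rcases key with ⟨h, -⟩ | ⟨-, f, hf, hr, hp⟩
      · omega
      · exact ⟨f, hf, hr, u, hp, h1⟩
    · intro w u t w' u' q _ ih he
      rcases List.mem_append.1 he with he | he
      · have hb := (List.mem_filter.1 he).2
        simp only [decide_eq_true_eq] at hb
        rcases ih with ⟨-, hp⟩ | ⟨rfl, -⟩
        · exact Or.inl ⟨hb.2, hp.snoc he⟩
        · omega
      · obtain ⟨f, hf, h⟩ := List.mem_map.1 he
        obtain ⟨hf, hr⟩ := List.mem_filter.1 hf
        simp only [Prod.mk.injEq] at h
        obtain ⟨rfl, rfl, rfl, rfl⟩ := h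
        simp only [decide_eq_true_eq] at hr
        rcases ih with ⟨-, hp⟩ | ⟨rfl, -⟩
        · exact Or.inr ⟨rfl, f, hf, hr, by simpa using hp⟩
        · omega
  · rintro ⟨f, hf, hr, u, hu, h1⟩
    refine ⟨u, ?_, h1⟩
    have h2 : Path (restrictEdges r edges finals) 0 w u f :=
      hu.mono fun e he => List.mem_append.2 (Or.inl he)
    simpa using h2.snoc (List.mem_append.2 (Or.inr (List.mem_map.2 ⟨f,
      List.mem_filter.2 ⟨hf, by simpa using hr⟩, rfl⟩)))

/-- The Gödel number of a list is a bound for everything listed in it; this yields primitive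
recursive bounds for states and for codes of right-hand sides. -/
theorem encode_lt_of_mem {α : Type} [Encodable α] {a : α} {l : List α} (h : a ∈ l) :
    Encodable.encode a < Encodable.encode l := by
  induction l with
  | nil => cases h
  | cons b l ih =>
    rw [Encodable.encode_list_cons]
    rcases List.mem_cons.1 h with rfl | h
    · exact Nat.lt_succ_of_le (Nat.left_le_pair _ _)
    · exact (ih h).trans (Nat.lt_succ_of_le (Nat.right_le_pair _ _))

/-- A bound for the states of an automaton, which also exceeds `a` and `b`. -/
def stateBound (E : List Edge) (a b : ℕ) : ℕ := Encodable.encode E + a + b + 1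

theorem statesLt_stateBound (E : List Edge) (a b : ℕ) : StatesLt (stateBound E a b) E := by
  rintro ⟨s, w, u, t⟩ he
  have h := encode_lt_of_mem he
  simp only [Encodable.encode_prod_val, Encodable.encode_nat] at h
  have h1 := Nat.left_le_pair s (Nat.pair (Encodable.encode w) (Nat.pair (Encodable.encode u) t))
  have h2 := Nat.right_le_pair s (Nat.pair (Encodable.encode w) (Nat.pair (Encodable.encode u) t))
  have h3 := Nat.right_le_pair (Encodable.encode w) (Nat.pair (Encodable.encode u) t)
  have h4 := Nat.right_le_pair (Encodable.encode u) t
  simp only [stateBound]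
  omega

/-- The initial state of an elementary automaton. -/
def startState : ℕ := pendingState [] [] 0

/-- A level and a code for the language of a valence automaton over the alphabet with `k`
letters. -/
def levelCode (k : ℕ) (c : VACode) : ℕ × ℕ :=
  let E := splitEdges (restrictEdges c.2.2.1 c.2.2.2.1 c.2.2.2.2)
  let q := pendingState [] [] (c.2.2.1 + 1)
  let R := stateBound E startState q
  (c.2.1.length, (codeTable c.1 R c.2.1 k E).getD (startState * R + q) 0)

theorem fLang_levelCode (k : ℕ) (c : VACode) :
    fLang (levelCode k c).1 k (levelCode k c).2 = vaLang k c := by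
  obtain ⟨n, ops, r, edges, finals⟩ := c
  ext w
  rw [mem_vaLang_iff, ← accepts_restrictEdges_iff, ← fWord_map_iff, levelCode]
  simp only
  rw [fWord_codeTable_iff n ops (elementary_splitEdges _) (statesLt_stateBound _ _ _)
    (by simp only [stateBound]; omega) (by simp only [stateBound]; omega), startState,
    accepts_splitEdges_iff]
  exact ⟨fun h => h.2, fun h => ⟨by simp, h⟩⟩

/-! ### Grammars as automata over `𝔹 * (M × ℤ)` -/

/-- The word that pushes the return address `t`. -/
def callWord (t : ℕ) : List ℕ := [0] ++ List.replicate t 2 ++ [0]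

/-- The word that pops the return address `t`. -/
def returnWord (t : ℕ) : List ℕ := [1] ++ List.replicate t 3 ++ [1]

/-- The state `s` of the automaton for the right-hand sides with the code `c` of `A`. -/
def frameState (A c s : ℕ) : ℕ := Encodable.encode (A, c, s) + 2

/-- The offset `2` in `frameState` reserves `0` and `1` for the initial and the final state of the
automaton for the grammar. -/
theorem frameState_inj {A c s A' c' s' : ℕ} :
    frameState A c s = frameState A' c' s' ↔ A = A' ∧ c = c' ∧ s = s' := by
  simp [frameState]

/-- The final state of an elementary automaton. -/
def finalState : ℕ := pendingState [] [] 1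

/-- The triples `(s, B, t)` such that the nonterminal `B` leads from `s` to `t`. -/
def callSites (n : ℕ) (prods : List (ℕ × ℕ)) (aut : ℕ → List Edge) : List (ℕ × ℕ × ℕ) :=
  -- The first triple is the call of the start symbol from the initial state, with return to the
  -- final state.
  (0, 0, 1) :: prods.flatMap fun p => (aut p.2).flatMap fun e =>
    (e.2.1.filter fun x => x ≤ n).map fun x =>
      (frameState p.1 p.2 e.1, x, frameState p.1 p.2 e.2.2.2)

/-- An automaton over `𝔹 * (M × ℤ)` for the grammar whose right-hand sides are given by automata
over `M`. -/
def grammarEdges (n : ℕ) (prods : List (ℕ × ℕ)) (aut : ℕ → List Edge) : List Edge :=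
  (prods.flatMap fun p => (aut p.2).flatMap fun e =>
    if (e.2.1.filter fun x => x ≤ n) = [] then
      [(frameState p.1 p.2 e.1, e.2.1.map (· - (n + 1)), e.2.2.1.map (· + 4),
        frameState p.1 p.2 e.2.2.2)] else []) ++
  -- A call may choose any production of the nonterminal. The return address is the number of the
  -- state behind the call.
  (callSites n prods aut).flatMap fun σ => prods.flatMap fun p => if p.1 = σ.2.1 then
    [(σ.1, [], callWord σ.2.2, frameState p.1 p.2 startState),
      (frameState p.1 p.2 finalState, [], returnWord σ.2.2, σ.2.2)] else []

section GrammarEdges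

variable {n m : ℕ} {prods : List (ℕ × ℕ)} {aut : ℕ → List Edge} {G : GenMonoid}

theorem mem_callSites {a B b : ℕ} : (a, B, b) ∈ callSites n prods aut ↔
    (a = 0 ∧ B = 0 ∧ b = 1) ∨ ∃ A c s w u t, (A, c) ∈ prods ∧ (s, w, u, t) ∈ aut c ∧ B ∈ w ∧
      B ≤ n ∧ a = frameState A c s ∧ b = frameState A c t := by
  rw [callSites, List.mem_cons]
  simp only [List.mem_flatMap, List.mem_map, List.mem_filter, Prod.mk.injEq, Prod.exists,
    decide_eq_true_eq]
  refine or_congr Iff.rfl ?_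
  constructor
  · rintro ⟨A, c, hp, s, w, u, t, he, x, ⟨hx, hn⟩, rfl, rfl, rfl⟩
    exact ⟨A, c, s, w, u, t, hp, he, hx, hn, rfl, rfl⟩
  · rintro ⟨A, c, s, w, u, t, hp, he, hx, hn, rfl, rfl⟩
    exact ⟨A, c, hp, s, w, u, t, he, B, ⟨hx, hn⟩, rfl, rfl, rfl⟩

theorem mem_grammarEdges {s t : ℕ} {w u : List ℕ} : (s, w, u, t) ∈ grammarEdges n prods aut ↔
    (∃ A c s' w' u' t', (A, c) ∈ prods ∧ (s', w', u', t') ∈ aut c ∧ (∀ x ∈ w', n < x) ∧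
      s = frameState A c s' ∧ w = w'.map (· - (n + 1)) ∧ u = u'.map (· + 4) ∧
      t = frameState A c t') ∨
    ∃ a B b c, (a, B, b) ∈ callSites n prods aut ∧ (B, c) ∈ prods ∧ w = [] ∧
      ((s = a ∧ u = callWord b ∧ t = frameState B c startState) ∨
        (s = frameState B c finalState ∧ u = returnWord b ∧ t = b)) := by
  rw [grammarEdges, List.mem_append]
  simp only [List.mem_flatMap, Prod.exists]
  refine or_congr ?_ ?_
  · constructor
    · rintro ⟨A, c, hp, s', w', u', t', he, h⟩
      split_ifs at h with hf
      · simp only [List.mem_singleton, Prod.mk.injEq] at h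
        obtain ⟨rfl, rfl, rfl, rfl⟩ := h
        refine ⟨A, c, s', w', u', t', hp, he, ?_, rfl, rfl, rfl, rfl⟩
        intro x hx
        have := List.filter_eq_nil_iff.1 hf x hx
        simpa using this
      · cases h
    · rintro ⟨A, c, s', w', u', t', hp, he, hx, rfl, rfl, rfl, rfl⟩
      refine ⟨A, c, hp, s', w', u', t', he, ?_⟩
      rw [if_pos, List.mem_singleton]
      rw [List.filter_eq_nil_iff]
      simpa using hx
  · constructor
    · rintro ⟨a, B, b, hσ, A, c, hp, h⟩
      split_ifs at h with hf
      · obtain rfl : A = B := hf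
        simp only [List.mem_cons, Prod.mk.injEq, List.not_mem_nil, or_false] at h
        refine ⟨a, A, b, c, hσ, hp, ?_⟩
        rcases h with ⟨rfl, rfl, rfl, rfl⟩ | ⟨rfl, rfl, rfl, rfl⟩ <;> simp
      · cases h
    · rintro ⟨a, B, b, c, hσ, hp, rfl, h⟩
      refine ⟨a, B, b, hσ, B, c, hp, ?_⟩
      rw [if_pos rfl]
      rcases h with ⟨rfl, rfl, rfl⟩ | ⟨rfl, rfl, rfl⟩ <;> simp

theorem blindGen_eval_add_two (u : List ℕ) :
    (blindGen G).eval (u.map (· + 2)) = (G.eval u, 1) := by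
  rw [blindGen_eval, dropGens_map_add_two, count_map_add_two _ (by omega),
    count_map_add_two _ (by omega)]
  rfl

theorem blindGen_eval_replicate_zero (t : ℕ) :
    (blindGen G).eval (List.replicate t 0) = (1, Multiplicative.ofAdd (t : ℤ)) := by
  rw [blindGen_eval]
  have : dropGens 2 (List.replicate t 0) = [] := by
    rw [dropGens, List.filterMap_replicate]; rfl
  rw [this]
  simp [List.count_replicate]

theorem blindGen_eval_replicate_one (t : ℕ) :
    (blindGen G).eval (List.replicate t 1) = (1, Multiplicative.ofAdd (-(t : ℤ))) := by
  rw [blindGen_eval]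
  have : dropGens 2 (List.replicate t 1) = [] := by
    rw [dropGens, List.filterMap_replicate]; rfl
  rw [this]
  simp [List.count_replicate]

theorem callWord_eq (t : ℕ) : callWord t = [0] ++ (List.replicate t 0).map (· + 2) ++ [0] := by
  simp [callWord]

theorem returnWord_eq (t : ℕ) :
    returnWord t = [1] ++ (List.replicate t 1).map (· + 2) ++ [1] := by
  simp [returnWord]

/-- The first push saves the current top, the new entry receives `t` in its `ℤ`-component, and the
second push covers it with a trivial entry on which the callee works. -/
theorem stackRun_callWord (t : ℕ) (p : (blindGen G).carrier × List (blindGen G).carrier) :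
    stackRun (blindGen G) (callWord t) (some p) =
      some ((1, 1), (1, Multiplicative.ofAdd (t : ℤ)) :: p.1 :: p.2) := by
  rw [callWord_eq, stackRun_append, stackRun_append, stackRun_zero, stackRun_add_two,
    stackRun_zero, blindGen_eval_replicate_zero]
  obtain ⟨x, st⟩ := p
  simp only [Option.bind_some, stackStep, Option.map_some, one_mul]
  rfl

/-- The first pop tests that the callee has ended with a trivial element. The second one, after the
subtraction of `t`, tests that the stored address was `t`. -/
theorem stackRun_returnWord {t : ℕ} {p p' : (blindGen G).carrier × List (blindGen G).carrier}
    (h : stackRun (blindGen G) (returnWord t) (some p) = some p') :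
    p = ((1, 1), (1, Multiplicative.ofAdd (t : ℤ)) :: p'.1 :: p'.2) := by
  rw [returnWord_eq, stackRun_append, stackRun_append, stackRun_one, stackRun_add_two,
    stackRun_one, blindGen_eval_replicate_one, Option.bind_some, Option.bind_eq_some_iff] at h
  obtain ⟨q, h1, h2⟩ := h
  rw [Option.map_eq_some_iff] at h1
  obtain ⟨r, h1, rfl⟩ := h1
  rw [stackStep_false_eq_some] at h1 h2
  obtain ⟨⟨m, z⟩, st⟩ := r
  simp only [Prod.mk.injEq] at h2
  obtain ⟨h2, rfl⟩ := h2
  have h3 : m * 1 = 1 := (Prod.ext_iff.1 h2).1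
  have h4 : z * Multiplicative.ofAdd (-(t : ℤ)) = 1 := (Prod.ext_iff.1 h2).2
  rw [mul_one] at h3
  rw [ofAdd_neg, mul_inv_eq_one] at h4
  rw [h1, h3, h4]
  rfl

theorem stackGen_eval_callWord_mul (t : ℕ) :
    (stackGen (blindGen G)).eval (callWord t) * (stackGen (blindGen G)).eval (returnWord t) = 1 := by
  have h : (Monoid.Coprod.inl Bicyclic.a : (stackGen (blindGen G)).carrier) *
      Monoid.Coprod.inl Bicyclic.abar = 1 := by
    rw [← map_mul, Bicyclic.a_mul_abar, map_one]
  have h2 : (((1 : G.carrier), Multiplicative.ofAdd (t : ℤ)) : (blindGen G).carrier) *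
      (1, Multiplicative.ofAdd (-(t : ℤ))) = 1 := by
    rw [Prod.mk_mul_mk, mul_one, ← ofAdd_add, add_neg_cancel]; rfl
  rw [callWord_eq, returnWord_eq]
  simp only [GenMonoid.eval_append, stackGen_eval_add_two, blindGen_eval_replicate_zero,
    blindGen_eval_replicate_one, GenMonoid.eval_cons, GenMonoid.eval_nil, mul_one]
  rw [mul_assoc, mul_assoc, mul_assoc]
  rw [← mul_assoc (Monoid.Coprod.inl Bicyclic.a) (Monoid.Coprod.inl Bicyclic.abar), h, one_mul,
    ← mul_assoc (Monoid.Coprod.inr _), ← map_mul, h2, map_one, one_mul, h]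

/-- The right-hand sides which are given by automata. -/
def AutRhs (G : GenMonoid) (prods : List (ℕ × ℕ)) (aut : ℕ → List Edge) (A : ℕ) (v : List ℕ) :
    Prop :=
  ∃ c, (A, c) ∈ prods ∧ Accepts G (aut c) startState finalState v

theorem path_grammarEdges_of_noInput {A c : ℕ} (hp : (A, c) ∈ prods) {s t : ℕ} {v u : List ℕ}
    (h : Path (aut c) s v u t) (hv : v = []) :
    ∃ u', Path (grammarEdges n prods aut) (frameState A c s) [] u' (frameState A c t) ∧
      (stackGen (blindGen G)).eval u' = Monoid.Coprod.inr (G.eval u, 1) := by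
  induction h with
  | nil => exact ⟨[], Path.nil _, (map_one _).symm⟩
  | @cons s t q w u w' u' he _ ih =>
    obtain ⟨rfl, rfl⟩ := List.append_eq_nil_iff.1 hv
    obtain ⟨x, h1, h2⟩ := ih rfl
    refine ⟨u.map (· + 4) ++ x, ?_, ?_⟩
    · exact Path.cons (w := []) (mem_grammarEdges.2 (Or.inl ⟨A, c, _, _, _, _, hp, he, by simp,
        rfl, rfl, rfl, rfl⟩)) h1
    · rw [GenMonoid.eval_append, h2, show u.map (· + 4) = (u.map (· + 2)).map (· + 2) by simp,
        stackGen_eval_add_two, blindGen_eval_add_two, ← map_mul, GenMonoid.eval_append,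
        Prod.mk_mul_mk, one_mul]

/-- Each subtree of the derivation tree is run between a call and the matching return. Its run is
trivial in `M`, so call and return cancel by `stackGen_eval_callWord_mul` and the caller's value is
undisturbed. -/
theorem exists_path_grammarEdges (hE : ∀ c, Elementary (aut c)) {v w : List ℕ}
    (hy : Yield n m (AutRhs G prods aut) v w) {A c : ℕ} (hp : (A, c) ∈ prods) {s t : ℕ}
    {u : List ℕ} (h : Path (aut c) s v u t) :
    ∃ u', Path (grammarEdges n prods aut) (frameState A c s) w u' (frameState A c t) ∧
      (stackGen (blindGen G)).eval u' = Monoid.Coprod.inr (G.eval u, 1) := by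
  induction hy generalizing A c s t u with
  | nil => exact path_grammarEdges_of_noInput hp h rfl
  | @terminal x v w hx _ ih =>
    obtain ⟨a, b, u₁, u₂, rfl, h1, h2, h3⟩ := h.cons_input (hE c) rfl
    obtain ⟨y₁, hy₁, he₁⟩ := path_grammarEdges_of_noInput (n := n) (G := G) hp h1 rfl
    obtain ⟨y₂, hy₂, he₂⟩ := ih hp h3
    refine ⟨y₁ ++ ([] ++ y₂), hy₁.append (Path.cons (w := [x]) ?_ hy₂), ?_⟩
    · refine mem_grammarEdges.2 (Or.inl ⟨A, c, _, _, _, _, hp, h2, ?_, rfl, ?_, rfl, rfl⟩)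
      · simp; omega
      · simp
    · rw [List.nil_append, GenMonoid.eval_append, he₁, he₂, ← map_mul, GenMonoid.eval_append,
        Prod.mk_mul_mk, one_mul]
  | @nonterminal B κ v w₁ w₂ hB hκ _ _ ih ih' =>
    obtain ⟨a, b, u₁, u₂, rfl, h1, h2, h3⟩ := h.cons_input (hE c) rfl
    obtain ⟨y₁, hy₁, he₁⟩ := path_grammarEdges_of_noInput (n := n) (G := G) hp h1 rfl
    obtain ⟨y₂, hy₂, he₂⟩ := ih' hp h3
    obtain ⟨d, hd, x, hx, hx1⟩ := hκ
    obtain ⟨y₃, hy₃, he₃⟩ := ih hd hx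
    have hσ : (frameState A c a, B, frameState A c b) ∈ callSites n prods aut :=
      mem_callSites.2 (Or.inr ⟨A, c, _, _, _, _, hp, h2, List.mem_singleton.2 rfl, hB, rfl, rfl⟩)
    have hcall := mem_grammarEdges.2 (Or.inr ⟨_, _, _, _, hσ, hd, rfl, Or.inl ⟨rfl, rfl, rfl⟩⟩)
    have hret := mem_grammarEdges.2 (Or.inr ⟨_, _, _, _, hσ, hd, rfl, Or.inr ⟨rfl, rfl, rfl⟩⟩)
    refine ⟨_, hy₁.append (Path.cons (w := []) hcall (hy₃.append (Path.cons (w := []) hret hy₂))),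
      ?_⟩
    have h1' : (stackGen (blindGen G)).eval y₃ = 1 := by
      rw [he₃, hx1]; exact map_one _
    rw [GenMonoid.eval_append, GenMonoid.eval_append, GenMonoid.eval_append, GenMonoid.eval_append,
      h1', one_mul, ← mul_assoc ((stackGen (blindGen G)).eval (callWord _)),
      stackGen_eval_callWord_mul, one_mul, he₁, he₂, ← map_mul, GenMonoid.eval_append,
        Prod.mk_mul_mk, one_mul]

/-- The configurations which are reached in an automaton for a grammar. -/
inductive GrammarConf (G : GenMonoid) (n m : ℕ) (prods : List (ℕ × ℕ)) (aut : ℕ → List Edge) :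
    ℕ → (G.carrier × Multiplicative ℤ) × List (G.carrier × Multiplicative ℤ) → List ℕ → Prop
  | init : GrammarConf G n m prods aut 0 ((1, 1), []) []
  -- Here `p` and `w₀` are the stack and the input at the moment of the call, `v` is the part of the
  -- right-hand side processed so far, and `w` is its yield.
  | body {a B b c s : ℕ} {p : (G.carrier × Multiplicative ℤ) × List (G.carrier × Multiplicative ℤ)}
      {w₀ v u w : List ℕ} : GrammarConf G n m prods aut a p w₀ →
      (a, B, b) ∈ callSites n prods aut → (B, c) ∈ prods → Path (aut c) startState v u s →
      Yield n m (AutRhs G prods aut) v w →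
      GrammarConf G n m prods aut (frameState B c s)
        ((G.eval u, 1), (1, Multiplicative.ofAdd (b : ℤ)) :: p.1 :: p.2) (w₀ ++ w)
  | done {w : List ℕ} : Yield n m (AutRhs G prods aut) [0] w →
      GrammarConf G n m prods aut 1 ((1, 1), []) w

theorem GrammarConf.of_frameState {A c s q : ℕ}
    {p : (G.carrier × Multiplicative ℤ) × List (G.carrier × Multiplicative ℤ)} {w : List ℕ}
    (h : GrammarConf G n m prods aut q p w) (hq : q = frameState A c s) :
    ∃ (a b : ℕ) (p₀ : (G.carrier × Multiplicative ℤ) × List (G.carrier × Multiplicative ℤ))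
      (w₀ v u w₁ : List ℕ), w = w₀ ++ w₁ ∧
      p = ((G.eval u, 1), (1, Multiplicative.ofAdd (b : ℤ)) :: p₀.1 :: p₀.2) ∧
      GrammarConf G n m prods aut a p₀ w₀ ∧ (a, A, b) ∈ callSites n prods aut ∧
      (A, c) ∈ prods ∧ Path (aut c) startState v u s ∧ Yield n m (AutRhs G prods aut) v w₁ := by
  cases h with
  | init => simp [frameState] at hq
  | done => simp [frameState] at hq
  | body h1 h2 h3 h4 h5 =>
    obtain ⟨rfl, rfl, rfl⟩ := frameState_inj.1 hq
    exact ⟨_, _, _, _, _, _, _, rfl, rfl, h1, h2, h3, h4, h5⟩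

theorem Yield.of_sub {P : ℕ → List ℕ → Prop} {w : List ℕ} (h : ∀ x ∈ w, n < x)
    (h' : ∀ x ∈ w.map (· - (n + 1)), x < m) : Yield n m P w (w.map (· - (n + 1))) := by
  have := Yield.of_map (n := n) (P := P) h'
  rw [List.map_map] at this
  convert this
  conv_lhs => rw [← List.map_id w]
  refine List.map_congr_left fun x hx => ?_
  have := h x hx
  simp; omega

/-- An edge extends the current frame, opens a frame or closes it. Only the last case needs work: a
closed frame has to be turned into a nonterminal read by the caller. -/
theorem GrammarConf.step (hE : ∀ c, Elementary (aut c)) {s t : ℕ}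
    {p p' : (G.carrier × Multiplicative ℤ) × List (G.carrier × Multiplicative ℤ)}
    {w₀ w u : List ℕ} (h : GrammarConf G n m prods aut s p w₀)
    (he₀ : (s, w, u, t) ∈ grammarEdges n prods aut)
    (hs : stackRun (blindGen G) u (some p) = some p') (hw : ∀ x ∈ w, x < m) :
    GrammarConf G n m prods aut t p' (w₀ ++ w) := by
  rcases mem_grammarEdges.1 he₀ with ⟨A, c, s', w', u', t', hp, he, hn, hs', rfl, rfl, rfl⟩ |
    ⟨a, B, b, c, hσ, hp, rfl, ⟨rfl, rfl, rfl⟩ | ⟨hs', rfl, rfl⟩⟩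
  · obtain ⟨a, b, p₀, w₀, v, x, w₁, rfl, rfl, h1, h2, h3, h4, h5⟩ := h.of_frameState hs'
    rw [show u'.map (· + 4) = (u'.map (· + 2)).map (· + 2) by simp, stackRun_add_two,
      blindGen_eval_add_two] at hs
    obtain rfl := Option.some.inj hs
    have := GrammarConf.body h1 h2 h3 (h4.snoc he) (h5.append (Yield.of_sub hn hw))
    rw [List.append_assoc]
    convert this using 2
    rw [GenMonoid.eval_append]
    exact Prod.ext rfl (mul_one _)
  · rw [stackRun_callWord] at hs
    obtain rfl := Option.some.inj hs
    exact GrammarConf.body h hσ hp (Path.nil _) Yield.nil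
  · obtain ⟨a', b', p₀, w₀, v, x, w₁, rfl, rfl, h1, h2, h3, h4, h5⟩ := h.of_frameState hs'
    -- The stack forces the value of the frame in `M` to be `1` and the address of the return edge
    -- to be the one stored at the call.
    have hret := stackRun_returnWord hs
    simp only [Prod.mk.injEq, List.cons.injEq, Multiplicative.ofAdd.injective.eq_iff,
      Nat.cast_inj] at hret
    obtain ⟨⟨hx, -⟩, ⟨-, rfl⟩, hp1, hp2⟩ := hret
    obtain rfl : p₀ = p' := Prod.ext hp1 hp2
    rw [List.append_nil]
    -- So `v` is a complete right-hand side of `B`. If the call came from the initial state, the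
    -- derivation is finished; otherwise the caller's frame advances by the letter `B`.
    have hA : AutRhs G prods aut B v := ⟨c, h3, x, h4, hx⟩
    rcases mem_callSites.1 h2 with ⟨rfl, rfl, rfl⟩ |
      ⟨A, c', s₁, w', u', t₁, hp', he', hB, hBn, rfl, rfl⟩
    · have h0 : ∀ q, GrammarConf G n m prods aut q p₀ w₀ → q = 0 → p₀ = ((1, 1), []) ∧ w₀ = [] := by
        intro q h hq
        cases h with
        | init => exact ⟨rfl, rfl⟩
        | body => simp [frameState] at hq
        | done => cases hq
      obtain ⟨rfl, rfl⟩ := h0 _ h1 rfl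
      exact GrammarConf.done (Yield.singleton (Nat.zero_le _) hA h5)
    · obtain ⟨a, b, p₁, w₂, v', y, w₃, rfl, rfl, g1, g2, g3, g4, g5⟩ := h1.of_frameState rfl
      have hel := hE _ _ he'
      simp only at hel
      -- An elementary edge that mentions `B` reads just `B` and carries no generator.
      obtain rfl : w' = [B] := by
        rcases w' with _ | ⟨y, _ | ⟨z, w'⟩⟩
        · cases hB
        · rw [List.mem_singleton.1 hB]
        · simp at hel; omega
      obtain rfl : u' = [] := by simpa using hel
      have := GrammarConf.body g1 g2 g3 (g4.snoc he') (g5.append (Yield.singleton hBn hA h5))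
      rw [List.append_nil] at this
      rw [List.append_assoc]
      exact this

theorem GrammarConf.of_one {q : ℕ}
    {p : (G.carrier × Multiplicative ℤ) × List (G.carrier × Multiplicative ℤ)} {w : List ℕ}
    (h : GrammarConf G n m prods aut q p w) (hq : q = 1) :
    Yield n m (AutRhs G prods aut) [0] w := by
  cases h with
  | init => cases hq
  | body => simp [frameState] at hq
  | done h => exact h

/-- A trivial word acts on the stack without failure, hence so do its prefixes, and the invariant
`GrammarConf` holds along the whole path. Conversely, the run of a derivation tree is framed by the
call and the return of the start symbol. -/
theorem accepts_grammarEdges_iff (hE : ∀ c, Elementary (aut c)) (w : List ℕ) :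
    ((∀ x ∈ w, x < m) ∧ Accepts (stackGen (blindGen G)) (grammarEdges n prods aut) 0 1 w) ↔
      Yield n m (AutRhs G prods aut) [0] w := by
  constructor
  · rintro ⟨hw, u, hu, h1⟩
    have key := Path.snoc_induction (motive := fun w u t => (∀ x ∈ w, x < m) → ∀ p,
      stackRun (blindGen G) u (some ((1, 1), [])) = some p → GrammarConf G n m prods aut t p w)
      ?_ ?_ hu hw _ (stackRun_of_eval_eq_one _ h1 _)
    · exact key.of_one rfl
    · intro _ p hp
      rw [stackRun_nil] at hp
      obtain rfl := Option.some.inj hp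
      exact GrammarConf.init
    · intro w u t w' u' q _ ih he hw p hp
      rw [stackRun_append] at hp
      rcases ho : stackRun (blindGen G) u (some ((1, 1), [])) with _ | p'
      · rw [ho, stackRun_none] at hp; cases hp
      rw [ho] at hp
      exact (ih (fun x hx => hw x (by simp [hx])) _ ho).step hE he hp
        fun x hx => hw x (by simp [hx])
  · intro h
    refine ⟨h.lt, ?_⟩
    obtain ⟨v, ⟨c, hc, u, hu, h1⟩, hy⟩ := h.of_singleton (Nat.zero_le _)
    obtain ⟨u', hp, he⟩ := exists_path_grammarEdges hE hy hc hu
    have hσ : (0, 0, 1) ∈ callSites n prods aut := mem_callSites.2 (Or.inl ⟨rfl, rfl, rfl⟩)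
    have hcall := mem_grammarEdges.2 (Or.inr ⟨_, _, _, _, hσ, hc, rfl, Or.inl ⟨rfl, rfl, rfl⟩⟩)
    have hret := mem_grammarEdges.2 (Or.inr ⟨_, _, _, _, hσ, hc, rfl, Or.inr ⟨rfl, rfl, rfl⟩⟩)
    refine ⟨_, by simpa using Path.cons (w := []) hcall (hp.snoc hret), ?_⟩
    rw [GenMonoid.eval_append, GenMonoid.eval_append, he, h1]
    refine Eq.trans ?_ (stackGen_eval_callWord_mul 1)
    congr 1
    exact (congrArg (· * _) (map_one _)).trans (one_mul _)

end GrammarEdges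

end ValenceLang

/-! ### Blind counters for semilinear conditions -/

namespace ValenceLang

/-! ### Images under morphisms of semilinear intersections -/

variable {E : List Edge} {G : GenMonoid} {k m M n : ℕ}

theorem count_dropGens (d j : ℕ) (u : List ℕ) : (dropGens d u).count j = u.count (j + d) := by
  induction u with
  | nil => rfl
  | cons x u ih =>
    rw [dropGens] at ih ⊢
    by_cases h : d ≤ x
    · simp only [List.filterMap_cons, h, if_true, List.count_cons, ih, beq_iff_eq]
      split_ifs <;> omega
    · simp only [List.filterMap_cons, h, if_false, List.count_cons, ih, beq_iff_eq]
      split_ifs <;> omega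

theorem dropGens_dropGens (d d' : ℕ) (u : List ℕ) :
    dropGens d' (dropGens d u) = dropGens (d + d') u := by
  induction u with
  | nil => rfl
  | cons x u ih =>
    simp only [dropGens] at ih ⊢
    by_cases h : d ≤ x
    · by_cases h' : d' ≤ x - d
      · simp [h, h', ih, show d + d' ≤ x by omega]; omega
      · simp [h, h', ih, show ¬ d + d' ≤ x by omega]
    · simp [h, ih, show ¬ d + d' ≤ x by omega]

/-- Each factor `ℤ` puts two generators in front, so the counter `y` owns `2 * y` and `2 * y + 1`,
and the inner monoid starts at `2 * M`. -/
theorem scMonoid_replicate_false_eval_eq_one_iff (n M : ℕ) (ops : List Bool) (u : List ℕ) :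
    (scMonoid n (List.replicate M false ++ ops)).eval u = 1 ↔
      (∀ y < M, u.count (2 * y) = u.count (2 * y + 1)) ∧
        (scMonoid n ops).eval (dropGens (2 * M) u) = 1 := by
  induction M generalizing u with
  | zero =>
    have : dropGens 0 u = u := by simp [dropGens]
    simp [this]
  | succ M ih =>
    rw [List.replicate_succ, List.cons_append, scMonoid_false, blindGen_eval_eq_one_iff, ih,
      dropGens_dropGens, show 2 + 2 * M = 2 * (M + 1) by ring]
    simp only [count_dropGens]
    constructor
    · rintro ⟨⟨h1, h2⟩, h0⟩
      refine ⟨fun y hy => ?_, h2⟩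
      rcases y with _ | y
      · exact h0
      · exact h1 y (by omega)
    · rintro ⟨h1, h2⟩
      exact ⟨⟨fun y hy => h1 (y + 1) (by omega), h2⟩, h1 0 (by omega)⟩

/-- The generators that add the vector `p` to the first `d` counters and then subtract `q`. -/
def signedWord (d : ℕ) (p q : List ℕ) : List ℕ :=
  (List.range d).flatMap fun i =>
    List.replicate (p.getD i 0) (2 * i) ++ List.replicate (q.getD i 0) (2 * i + 1)

theorem count_signedWord (d : ℕ) (p : List ℕ) (y : ℕ) :
    (signedWord d p []).count (2 * y) = (if y < d then p.getD y 0 else 0) ∧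
      (signedWord d p []).count (2 * y + 1) = 0 := by
  induction d with
  | zero => simp [signedWord]
  | succ d ih =>
    have h : signedWord (d + 1) p [] =
        signedWord d p [] ++ List.replicate (p.getD d 0) (2 * d) := by
      simp [signedWord, List.range_succ]
    simp only [h, List.count_append, ih, List.count_replicate, beq_iff_eq]
    constructor
    · rcases lt_trichotomy y d with h | rfl | h
      · simp [h, show y < d + 1 by omega, show ¬ d = y by omega]
      · simp
      · simp [show ¬ y < d by omega, show ¬ y < d + 1 by omega, show ¬ d = y by omega]
    · have : ¬ 2 * d = 2 * y + 1 := by omega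
      simp [this]

theorem lt_of_mem_signedWord {d x : ℕ} {p q : List ℕ} (h : x ∈ signedWord d p q) : x < 2 * d := by
  obtain ⟨i, hi, h⟩ := List.mem_flatMap.1 h
  rw [List.mem_range] at hi
  rcases List.mem_append.1 h with h | h <;> have := List.eq_of_mem_replicate h <;> omega

theorem dropGens_eq_nil {d : ℕ} {u : List ℕ} (h : ∀ x ∈ u, x < d) : dropGens d u = [] := by
  rw [dropGens, List.filterMap_eq_nil_iff]
  intro x hx
  have := h x hx
  simp; omega

theorem dropGens_map_add (d : ℕ) (u : List ℕ) : dropGens d (u.map (· + d)) = u := by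
  rw [dropGens, List.filterMap_map]
  conv_rhs => rw [← List.filterMap_some (l := u)]
  refine List.filterMap_congr fun x _ => ?_
  simp

/-- The state in which the periods of the linear set `l` are added. -/
def linearState (l : List ℕ × List (List ℕ)) : ℕ := 2 * Encodable.encode l + 3

/-- An automaton for the image of a semilinear intersection. The first `M` blind counters of the
monoid hold the difference between the elements of the semilinear set and the Parikh image. -/
def imageEdges (M k m : ℕ) (hs : List (List ℕ)) (S : List (List ℕ × List (List ℕ)))
    (E : List Edge) : List Edge :=
  -- State `s` of `E` becomes `2 * s + 2`, so `2` and `4` are its initial state `0` and final state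
  -- `1`. The states of the linear sets are odd and at least `3`, which keeps `0` and `1` free.
  -- Reading a letter `x` decreases counter `x` through the generator `2 * x + 1`.
  (0, [], [], 2) :: ((E.flatMap fun e => if (e.2.1.filter fun x => m ≤ x) = [] then
    [(2 * e.1 + 2, (e.2.1.flatMap fun x => hs.getD x []).filter fun x => x < k,
      e.2.1.map (2 * · + 1) ++ e.2.2.1.map (· + 2 * M), 2 * e.2.2.2 + 2)] else []) ++
  S.flatMap fun l => (4, [], signedWord m l.1 [], linearState l) :: (linearState l, [], [], 1) ::
    l.2.map fun p => (linearState l, [], signedWord m p [], linearState l))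

section ImageEdges

variable {hs : List (List ℕ)} {S : List (List ℕ × List (List ℕ))}

theorem mem_imageEdges {s t : ℕ} {w u : List ℕ} : (s, w, u, t) ∈ imageEdges M k m hs S E ↔
    (s = 0 ∧ w = [] ∧ u = [] ∧ t = 2) ∨
    (∃ s' w' u' t', (s', w', u', t') ∈ E ∧ (∀ x ∈ w', x < m) ∧ s = 2 * s' + 2 ∧
      w = ((w'.flatMap fun x => hs.getD x []).filter fun x => x < k) ∧
      u = w'.map (2 * · + 1) ++ u'.map (· + 2 * M) ∧ t = 2 * t' + 2) ∨
    ∃ l ∈ S, w = [] ∧ ((s = 4 ∧ u = signedWord m l.1 [] ∧ t = linearState l) ∨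
      (s = linearState l ∧ u = [] ∧ t = 1) ∨
      ∃ p ∈ l.2, s = linearState l ∧ u = signedWord m p [] ∧ t = linearState l) := by
  rw [imageEdges, List.mem_cons, List.mem_append, List.mem_flatMap, List.mem_flatMap]
  refine or_congr (by simp) (or_congr ?_ ?_)
  · constructor
    · rintro ⟨⟨s', w', u', t'⟩, he, h⟩
      split_ifs at h with hf
      · simp only [List.mem_singleton, Prod.mk.injEq] at h
        obtain ⟨rfl, rfl, rfl, rfl⟩ := h
        refine ⟨s', w', u', t', he, fun x hx => ?_, rfl, rfl, rfl, rfl⟩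
        simpa using List.filter_eq_nil_iff.1 hf x hx
      · cases h
    · rintro ⟨s', w', u', t', he, hx, rfl, rfl, rfl, rfl⟩
      refine ⟨_, he, ?_⟩
      rw [if_pos, List.mem_singleton]
      rw [List.filter_eq_nil_iff]
      simpa using hx
  · refine exists_congr fun l => and_congr Iff.rfl ?_
    simp only [List.mem_cons, List.mem_map, Prod.mk.injEq]
    constructor
    · rintro (⟨rfl, rfl, rfl, rfl⟩ | ⟨rfl, rfl, rfl, rfl⟩ | ⟨p, hp, rfl, rfl, rfl, rfl⟩)
      · simp
      · simp
      · exact ⟨rfl, Or.inr (Or.inr ⟨p, hp, rfl, rfl, rfl⟩)⟩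
    · rintro ⟨rfl, ⟨rfl, rfl, rfl⟩ | ⟨rfl, rfl, rfl⟩ | ⟨p, hp, rfl, rfl, rfl⟩⟩
      · simp
      · simp
      · exact Or.inr (Or.inr ⟨p, hp, rfl, rfl, rfl, rfl⟩)

/-- In the word `u` of generators, the first `M` blind counters have been increased by the vectors
`ls` and decreased by the Parikh image of `z`, and the word over the remaining generators
is `u'`. -/
def Balance (M m : ℕ) (u z u' : List ℕ) (ls : List (List ℕ)) : Prop :=
  dropGens (2 * M) u = u' ∧ ∀ y < M,
    u.count (2 * y) = (ls.map fun p => if y < m then p.getD y 0 else 0).sum ∧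
      u.count (2 * y + 1) = z.count y

theorem Balance.nil : Balance M m [] [] [] [] := ⟨rfl, by simp⟩

theorem Balance.append {u z u' v z' v' : List ℕ} {ls ls' : List (List ℕ)}
    (h : Balance M m u z u' ls) (h' : Balance M m v z' v' ls') :
    Balance M m (u ++ v) (z ++ z') (u' ++ v') (ls ++ ls') := by
  refine ⟨by rw [dropGens_append, h.1, h'.1], fun y hy => ?_⟩
  have h1 := h.2 y hy
  have h2 := h'.2 y hy
  simp only [List.count_append, List.map_append, List.sum_append]
  exact ⟨by rw [h1.1, h2.1], by rw [h1.2, h2.2]⟩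

theorem Balance.base (hm : m ≤ M) (p : List ℕ) : Balance M m (signedWord m p []) [] [] [p] := by
  refine ⟨dropGens_eq_nil fun x hx => ?_, fun y _ => ?_⟩
  · have := lt_of_mem_signedWord hx
    omega
  · have := count_signedWord m p y
    simpa using this

theorem Balance.edge (hm : m ≤ M) {w u : List ℕ} (hw : ∀ x ∈ w, x < m) :
    Balance M m (w.map (2 * · + 1) ++ u.map (· + 2 * M)) w u [] := by
  constructor
  · rw [dropGens_append, dropGens_map_add, dropGens_eq_nil, List.nil_append]
    intro x hx
    obtain ⟨y, hy, rfl⟩ := List.mem_map.1 hx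
    have := hw y hy
    omega
  · intro y hy
    have h1 : ∀ j < 2 * M, (u.map (· + 2 * M)).count j = 0 := by
      intro j hj
      rw [List.count_eq_zero, List.mem_map]
      rintro ⟨x, -, hx⟩
      omega
    have h2 : (w.map (2 * · + 1)).count (2 * y) = 0 := by
      rw [List.count_eq_zero, List.mem_map]
      rintro ⟨x, -, hx⟩
      omega
    have h3 : (w.map (2 * · + 1)).count (2 * y + 1) = w.count y :=
      List.count_map_of_injective w (2 * · + 1) (fun a b h => by simpa using h) y
    rw [List.count_append, List.count_append, h1 _ (by omega), h1 _ (by omega), h2, h3]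
    simp

theorem Path.imageEdges_body (hm : m ≤ M) {s t : ℕ} {z u : List ℕ} (h : Path E s z u t)
    (hz : ∀ x ∈ z, x < m) : ∃ u', Path (imageEdges M k m hs S E) (2 * s + 2)
      ((z.flatMap fun x => hs.getD x []).filter fun x => x < k) u' (2 * t + 2) ∧
      Balance M m u' z u [] := by
  induction h with
  | nil => exact ⟨[], Path.nil _, Balance.nil⟩
  | cons he _ ih =>
    obtain ⟨u', h1, h2⟩ := ih fun x hx => hz x (by simp [hx])
    have hw := fun x hx => hz x (List.mem_append.2 (Or.inl hx))
    refine ⟨_, ?_, (Balance.edge hm hw).append h2⟩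
    rw [List.flatMap_append, List.filter_append]
    exact Path.cons (mem_imageEdges.2 (Or.inr (Or.inl ⟨_, _, _, _, he, hw, rfl, rfl, rfl, rfl⟩))) h1

theorem path_imageEdges_periods (hm : m ≤ M) {l : List ℕ × List (List ℕ)} (hl : l ∈ S)
    {ps : List (List ℕ)} (hps : ∀ p ∈ ps, p ∈ l.2) : ∃ u,
      Path (imageEdges M k m hs S E) (linearState l) [] u (linearState l) ∧
      Balance M m u [] [] ps := by
  induction ps with
  | nil => exact ⟨[], Path.nil _, Balance.nil⟩
  | cons p ps ih =>
    obtain ⟨u, h1, h2⟩ := ih fun p hp => hps p (by simp [hp])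
    exact ⟨_, Path.cons (w := []) (mem_imageEdges.2 (Or.inr (Or.inr ⟨l, hl, rfl,
      Or.inr (Or.inr ⟨p, hps p (by simp), rfl, rfl, rfl⟩)⟩))) h1, (Balance.base hm p).append h2⟩

/-- A path passes through separate phases: it simulates `E`, leaves at the final state of `E` by the
base vector of one linear set, adds periods of this set only, and stops. The parity and the
injectivity of the state numbers keep the phases and the linear sets apart. -/
theorem Path.of_imageEdges (hm : m ≤ M) {w u : List ℕ} {t : ℕ}
    (h : Path (imageEdges M k m hs S E) 0 w u t) :
    (t = 0 ∧ w = [] ∧ u = []) ∨ ∃ (s : ℕ) (z v : List ℕ) (ls : List (List ℕ)), Path E 0 z v s ∧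
      (∀ x ∈ z, x < m) ∧ Balance M m u z v ls ∧
      w = ((z.flatMap fun x => hs.getD x []).filter fun x => x < k) ∧
      ((t = 2 * s + 2 ∧ ls = []) ∨ ∃ l ∈ S, s = 1 ∧ (t = linearState l ∨ t = 1) ∧
        ∃ ps, (∀ p ∈ ps, p ∈ l.2) ∧ ls = l.1 :: ps) := by
  revert h
  refine Path.snoc_induction (motive := fun w u t => (t = 0 ∧ w = [] ∧ u = []) ∨
    ∃ (s : ℕ) (z v : List ℕ) (ls : List (List ℕ)), Path E 0 z v s ∧
      (∀ x ∈ z, x < m) ∧ Balance M m u z v ls ∧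
      w = ((z.flatMap fun x => hs.getD x []).filter fun x => x < k) ∧
      ((t = 2 * s + 2 ∧ ls = []) ∨ ∃ l ∈ S, s = 1 ∧ (t = linearState l ∨ t = 1) ∧
        ∃ ps, (∀ p ∈ ps, p ∈ l.2) ∧ ls = l.1 :: ps)) (Or.inl ⟨rfl, rfl, rfl⟩) ?_
  rintro w u t w' u' q - ih he
  rcases mem_imageEdges.1 he with ⟨rfl, rfl, rfl, rfl⟩ | ⟨s', w', u', t', he', hw', rfl, rfl, rfl,
    rfl⟩ | ⟨l, hl, rfl, h⟩
  · rcases ih with ⟨-, rfl, rfl⟩ | ⟨s, z, v, ls, -, -, -, -, ⟨h, -⟩ | ⟨l, -, -, h | h, -⟩⟩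
    · exact Or.inr ⟨0, [], [], [], Path.nil _, by simp, Balance.nil, rfl, Or.inl ⟨rfl, rfl⟩⟩
    · omega
    · simp [linearState] at h
    · omega
  · rcases ih with ⟨h, -, -⟩ | ⟨s, z, v, ls, h1, h2, h3, rfl, ⟨h, rfl⟩ | ⟨l, -, -, h | h, -⟩⟩
    · omega
    · obtain rfl : s' = s := by omega
      refine Or.inr ⟨t', z ++ w', v ++ u', [], h1.snoc he', ?_, h3.append (Balance.edge hm hw'),
        by rw [List.flatMap_append, List.filter_append], Or.inl ⟨rfl, rfl⟩⟩
      exact fun x hx => (List.mem_append.1 hx).elim (h2 x) (hw' x)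
    · rw [linearState] at h; omega
    · omega
  · have hinj : ∀ l', linearState l = linearState l' → l = l' := by
      intro l' h
      exact Encodable.encode_injective (by simpa [linearState] using h)
    rcases ih with ⟨rfl, -, -⟩ | ⟨s, z, v, ls, h1, h2, h3, rfl, h4⟩
    · rcases h with ⟨h, -⟩ | ⟨h, -⟩ | ⟨_, _, h, -⟩ <;> simp [linearState] at h
    rcases h with ⟨rfl, rfl, rfl⟩ | ⟨rfl, rfl, rfl⟩ | ⟨p, hp, rfl, rfl, rfl⟩
    · rcases h4 with ⟨h, rfl⟩ | ⟨l, -, -, h | h, -⟩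
      · obtain rfl : s = 1 := by omega
        refine Or.inr ⟨1, z ++ [], v ++ [], _, by simpa using h1, by simpa using h2,
          h3.append (Balance.base hm l.1), by simp, Or.inr ⟨l, hl, rfl, Or.inl rfl, [], by simp, rfl⟩⟩
      · rw [linearState] at h; omega
      · omega
    · rcases h4 with ⟨h, rfl⟩ | ⟨l', -, rfl, h | h, hps⟩
      · rw [linearState] at h; omega
      · obtain rfl := hinj _ h
        refine Or.inr ⟨1, z, v, ls, h1, h2, by simpa using h3, by simp, Or.inr ⟨l, hl, rfl,
          Or.inr rfl, hps⟩⟩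
      · simp [linearState] at h
    · rcases h4 with ⟨h, rfl⟩ | ⟨l', -, rfl, h | h, ps, hps, rfl⟩
      · rw [linearState] at h; omega
      · obtain rfl := hinj _ h
        refine Or.inr ⟨1, z ++ [], v ++ [], _, by simpa using h1, by simpa using h2,
          h3.append (Balance.base hm p), by simp, Or.inr ⟨l, hl, rfl, Or.inl rfl, ps ++ [p], ?_,
          rfl⟩⟩
        intro p' hp'
        rcases List.mem_append.1 hp' with h | h
        · exact hps _ h
        · rwa [List.mem_singleton.1 h]
      · simp [linearState] at h

/-- An element of the submonoid generated by the periods is the sum of a list of periods, and such a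
list is a sequence of passages through the loops at `linearState`. -/
theorem mem_semilinearOf_iff {v : Fin m → ℕ} : v ∈ semilinearOf m S ↔ ∃ l ∈ S, ∃ ps : List (List ℕ),
    (∀ p ∈ ps, p ∈ l.2) ∧ ∀ y : Fin m,
      v y = ((l.1 :: ps).map fun p => if (y : ℕ) < m then p.getD y 0 else 0).sum := by
  constructor
  · rintro ⟨l, hl, x, hx, rfl⟩
    refine ⟨l, hl, ?_⟩
    suffices H : ∃ ps : List (List ℕ), (∀ p ∈ ps, p ∈ l.2) ∧ ∀ y : Fin m,
        x y = (ps.map fun p => p.getD (y : ℕ) 0).sum by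
      obtain ⟨ps, hps, h⟩ := H
      exact ⟨ps, hps, fun y => by simp [h, vecOf]⟩
    induction hx using AddSubmonoid.closure_induction with
    | mem x hx =>
      obtain ⟨p, hp, rfl⟩ := hx
      exact ⟨[p], by simpa using hp, fun y => by simp [vecOf]⟩
    | zero => exact ⟨[], by simp, by simp⟩
    | add x y _ _ ihx ihy =>
      obtain ⟨ps, hps, h⟩ := ihx
      obtain ⟨ps', hps', h'⟩ := ihy
      refine ⟨ps ++ ps', ?_, fun y => by simp [h, h']⟩
      exact fun p hp => (List.mem_append.1 hp).elim (hps p) (hps' p)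
  · rintro ⟨l, hl, ps, hps, h⟩
    refine ⟨l, hl, (ps.map (vecOf m)).sum, ?_, ?_⟩
    · refine AddSubmonoid.list_sum_mem _ fun x hx => ?_
      obtain ⟨p, hp, rfl⟩ := List.mem_map.1 hx
      exact AddSubmonoid.subset_closure ⟨p, hps p hp, rfl⟩
    · funext y
      have h1 : (ps.map (vecOf m)).sum y = (ps.map fun p => p.getD (y : ℕ) 0).sum := by
        clear h hps
        induction ps with
        | nil => rfl
        | cons p ps ih => simp [ih, vecOf]
      simp [h, h1, vecOf]

/-- The blind counters vanish exactly if the guessed sum of base and periods is the Parikh image of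
the word read by `E`. As they may become negative, the vector can be guessed after the word. -/
theorem accepts_imageEdges_iff (hm : m ≤ M) (n : ℕ) (ops : List Bool) (w : List ℕ) :
    Accepts (scMonoid n (List.replicate M false ++ ops)) (imageEdges M k m hs S E) 0 1 w ↔
      ∃ z, (∀ x ∈ z, x < m) ∧ Accepts (scMonoid n ops) E 0 1 z ∧
        (fun y : Fin m => z.count (y : ℕ)) ∈ semilinearOf m S ∧
        w = ((z.flatMap fun x => hs.getD x []).filter fun x => x < k) := by
  constructor
  · rintro ⟨u, hu, h1⟩
    rw [scMonoid_replicate_false_eval_eq_one_iff] at h1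
    rcases hu.of_imageEdges hm with ⟨h, -⟩ | ⟨s, z, v, ls, h2, h3, h4, h5, ⟨h, -⟩ |
      ⟨l, hl, rfl, -, ps, hps, rfl⟩⟩
    · cases h
    · omega
    · refine ⟨z, h3, ⟨v, h2, h4.1 ▸ h1.2⟩, mem_semilinearOf_iff.2 ⟨l, hl, ps, hps, fun y => ?_⟩, h5⟩
      have hy : (y : ℕ) < M := by omega
      rw [← (h4.2 y hy).1, ← (h4.2 y hy).2, h1.1 y hy]
  · rintro ⟨z, hz, ⟨v, hv, h1⟩, hS, rfl⟩
    obtain ⟨l, hl, ps, hps, hcount⟩ := mem_semilinearOf_iff.1 hS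
    obtain ⟨u₁, hp₁, hb₁⟩ := hv.imageEdges_body (k := k) (hs := hs) (S := S) hm hz
    obtain ⟨u₂, hp₂, hb₂⟩ := path_imageEdges_periods (k := k) (hs := hs) (E := E) hm hl hps
    have hb := (hb₁.append (Balance.base hm l.1)).append hb₂
    refine ⟨u₁ ++ signedWord m l.1 [] ++ u₂, ?_, ?_⟩
    · have e1 : (0, [], [], 2) ∈ imageEdges M k m hs S E :=
        mem_imageEdges.2 (Or.inl ⟨rfl, rfl, rfl, rfl⟩)
      have e2 : (4, [], signedWord m l.1 [], linearState l) ∈ imageEdges M k m hs S E :=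
        mem_imageEdges.2 (Or.inr (Or.inr ⟨l, hl, rfl, Or.inl ⟨rfl, rfl, rfl⟩⟩))
      have e3 : (linearState l, [], [], 1) ∈ imageEdges M k m hs S E :=
        mem_imageEdges.2 (Or.inr (Or.inr ⟨l, hl, rfl, Or.inr (Or.inl ⟨rfl, rfl, rfl⟩)⟩))
      simpa using Path.cons e1 (((hp₁.snoc e2).append hp₂).snoc e3)
    · rw [scMonoid_replicate_false_eval_eq_one_iff]
      refine ⟨fun y hy => ?_, ?_⟩
      · rw [(hb.2 y hy).1, (hb.2 y hy).2]
        -- The counters from `m` on are never changed: no letter and no vector entry belongs to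
        -- them.
        by_cases hym : y < m
        · simpa using (hcount ⟨y, hym⟩).symm
        · have : z.count y = 0 := List.count_eq_zero.2 fun h => hym (hz y h)
          simp [hym, this]
      · rw [hb.1]
        simpa using h1

end ImageEdges

end ValenceLang

/-! ### Petri nets as automata, and the induction over the levels -/

namespace ValenceLang

/-! ### Petri nets as automata over `𝔹^n` -/

variable {k m M n d : ℕ}

theorem coordWord_signedWord (d i : ℕ) (p q : List ℕ) : coordWord i (signedWord d p q) =
    if i < d then List.replicate (p.getD i 0) true ++ List.replicate (q.getD i 0) false else [] := by
  have h1 : ∀ a j, coordWord i (List.replicate a (2 * j)) =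
      if j = i then List.replicate a true else [] := by
    intro a j
    by_cases h : j = i <;> simp [coordWord, h]
  have h2 : ∀ a j, coordWord i (List.replicate a (2 * j + 1)) =
      if j = i then List.replicate a false else [] := by
    intro a j
    have h3 : (2 * j + 1) / 2 = j := by omega
    have h4 : (2 * i + 1) / 2 = i := by omega
    by_cases h : j = i <;> simp [coordWord, h, h3, h4]
  induction d with
  | zero => rfl
  | succ d ih =>
    have h : signedWord (d + 1) p q = signedWord d p q ++
        (List.replicate (p.getD d 0) (2 * d) ++ List.replicate (q.getD d 0) (2 * d + 1)) := by
      simp [signedWord, List.range_succ]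
    rw [h, coordWord_append, coordWord_append, ih, h1, h2]
    rcases lt_trichotomy d i with h | rfl | h
    · simp [show ¬ i < d by omega, show ¬ i < d + 1 by omega, show ¬ d = i by omega]
    · simp
    · simp [h, show i < d + 1 by omega, show ¬ d = i by omega]

/-- All increments precede the decrements, so only a negative final value can make the run fail. -/
theorem counterRun_replicate_iff (p q a b : ℕ) :
    counterRun (List.replicate p true ++ List.replicate q false) a = some b ↔ a + p = b + q := by
  induction p generalizing a with
  | zero =>
    induction q generalizing a with
    | zero => simp [counterRun]
    | succ q ih =>
      rw [List.replicate_succ]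
      cases a with
      | zero => simp [counterRun, counterStep]
      | succ a =>
        refine (ih a).trans ?_
        omega
  | succ p ih =>
    refine (ih (a + 1)).trans ?_
    omega

theorem counterRun_signedWord_iff (d i : ℕ) (p q : List ℕ) (a b : ℕ) :
    counterRun (coordWord i (signedWord d p q)) a = some b ↔
      if i < d then a + p.getD i 0 = b + q.getD i 0 else a = b := by
  rw [coordWord_signedWord]
  split_ifs
  · rw [counterRun_replicate_iff]
  · simp [counterRun]

/-- An automaton over `𝔹^d` for a Petri net. -/
def netEdges (N : PetriCode) : List Edge :=
  -- The edge from `0` to `2` loads the initial marking, the loops at `2` fire transitions, and an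
  -- edge to `1` subtracts a final marking, so that acceptance means empty counters.
  (0, [], signedWord N.1 N.2.2.1 [], 2) ::
    (N.2.1.map (fun t => (2, t.1.toList, signedWord N.1 (t.2.map Int.toNat)
      (t.2.map fun z => (-z).toNat), 2)) ++
    N.2.2.2.map fun f => (2, [], signedWord N.1 [] f, 1))

theorem mem_netEdges {ts : List (Option ℕ × List ℤ)} {init : List ℕ} {finals : List (List ℕ)}
    {s t : ℕ} {w u : List ℕ} : (s, w, u, t) ∈ netEdges (d, ts, init, finals) ↔
      (s = 0 ∧ w = [] ∧ u = signedWord d init [] ∧ t = 2) ∨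
      (s = 2 ∧ t = 2 ∧ ∃ x ν, (x, ν) ∈ ts ∧ w = x.toList ∧
        u = signedWord d (ν.map Int.toNat) (ν.map fun z => (-z).toNat)) ∨
      (s = 2 ∧ w = [] ∧ t = 1 ∧ ∃ f ∈ finals, u = signedWord d [] f) := by
  rw [netEdges, List.mem_cons, List.mem_append, List.mem_map, List.mem_map]
  refine or_congr (by simp) (or_congr ?_ ?_)
  · constructor
    · rintro ⟨⟨x, ν⟩, ht, h⟩
      simp only [Prod.mk.injEq] at h
      obtain ⟨rfl, rfl, rfl, rfl⟩ := h
      exact ⟨rfl, rfl, x, ν, ht, rfl, rfl⟩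
    · rintro ⟨rfl, rfl, x, ν, ht, rfl, rfl⟩
      exact ⟨_, ht, rfl⟩
  · constructor
    · rintro ⟨f, hf, h⟩
      simp only [Prod.mk.injEq] at h
      obtain ⟨rfl, rfl, rfl, rfl⟩ := h
      exact ⟨rfl, rfl, rfl, f, hf, rfl⟩
    · rintro ⟨rfl, rfl, rfl, f, hf, rfl⟩
      exact ⟨_, hf, rfl⟩

/-- A marking, extended by zeros. -/
def extendMarking (μ : Fin d → ℕ) (i : ℕ) : ℕ := if h : i < d then μ ⟨i, h⟩ else 0

theorem extendMarking_vecOf (l : List ℕ) (i : ℕ) :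
    extendMarking (vecOf d l) i = if i < d then l.getD i 0 else 0 := by
  rw [extendMarking]
  split_ifs <;> rfl

theorem counterRun_transition_iff (ν : List ℤ) (μ μ' : Fin d → ℕ) :
    (∀ i, (μ' i : ℤ) = μ i + vecOf d ν i) ↔
      ∀ i, counterRun (coordWord i (signedWord d (ν.map Int.toNat) (ν.map fun z => (-z).toNat)))
        (extendMarking μ i) = some (extendMarking μ' i) := by
  have h1 : ∀ i, (ν.map Int.toNat).getD i 0 = (ν.getD i 0).toNat := fun i => by
    simp only [List.getD_eq_getElem?_getD, List.getElem?_map]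
    cases ν[i]? <;> rfl
  have h2 : ∀ i, (ν.map fun z => (-z).toNat).getD i 0 = (-ν.getD i 0).toNat := fun i => by
    simp only [List.getD_eq_getElem?_getD, List.getElem?_map]
    cases ν[i]? <;> rfl
  simp only [counterRun_signedWord_iff, h1, h2, extendMarking, vecOf]
  constructor
  · intro h i
    by_cases hi : i < d
    · have := h ⟨i, hi⟩
      simp only [hi, if_true, dif_pos] at this ⊢
      omega
    · simp [hi]
  · intro h i
    have := h i
    simp only [i.2, if_true, dif_pos, Fin.eta] at this
    omega

/-- The counters from `d` on stay untouched, so any `M ≥ d` will do. This lets nets of different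
dimensions share one monoid. -/
theorem fWord_zero_iff (hd : d ≤ M) {c : ℕ} {ts : List (Option ℕ × List ℤ)} {init : List ℕ}
    {finals : List (List ℕ)} (hc : Denumerable.ofNat PetriCode c = (d, ts, init, finals))
    (w : List ℕ) : FWord 0 k c w ↔ (∀ x ∈ w, x < k) ∧
      Accepts (powGen M) (netEdges (d, ts, init, finals)) 0 1 w := by
  set N := petriOfCode k d ts init finals with hN
  have hF : fLang 0 k c = N.lang := by rw [fLang, hc, petriLang]
  have hlt : ∀ w : List (Fin k), ∀ x ∈ w.map Fin.val, x < k := by simp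
  suffices H : ∀ w : List (Fin k), w ∈ N.lang ↔
      Accepts (powGen M) (netEdges (d, ts, init, finals)) 0 1 (w.map Fin.val) by
    constructor
    · rintro ⟨v, hv, rfl⟩
      exact ⟨hlt v, (H v).1 (hF ▸ hv)⟩
    · rintro ⟨h1, h2⟩
      obtain ⟨v, rfl⟩ := exists_map_val h1
      exact ⟨v, hF ▸ (H v).2 h2, rfl⟩
  intro w
  constructor
  · rintro ⟨μ, ⟨f, hf, hμ⟩, hr⟩
    have hlist : ∀ x : Option (Fin k), x.toList.map Fin.val = (x.map Fin.val).toList := by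
      rintro (_ | _) <;> rfl
    have key : ∀ μ w μ', N.Run μ w μ' → ∃ u, Path (netEdges (d, ts, init, finals)) 2
        (w.map Fin.val) u 2 ∧ ∀ i, counterRun (coordWord i u) (extendMarking μ i) =
          some (extendMarking μ' i) := by
      intro μ w μ' h
      induction h with
      | nil μ => exact ⟨[], Path.nil _, fun i => rfl⟩
      | cons ht hm _ ih =>
        obtain ⟨u, hu, hu'⟩ := ih
        obtain ⟨⟨y, ν⟩, hs, h1, h2⟩ := ht
        simp only at h1 h2
        subst h1 h2
        refine ⟨_, ?_, fun i => coordWord_run_append.2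
          ⟨_, (counterRun_transition_iff _ _ _).1 hm i, hu' i⟩⟩
        rw [List.map_append]
        refine Path.cons (mem_netEdges.2 (Or.inr (Or.inl ⟨rfl, rfl, _, _, hs, ?_, rfl⟩))) hu
        exact hlist _
    obtain ⟨u, hu, hu'⟩ := key _ _ _ hr
    have hinit : N.init = vecOf d init := rfl
    refine ⟨signedWord d init [] ++ (u ++ signedWord d [] f), ?_, ?_⟩
    · have e1 : (2, [], signedWord d [] f, 1) ∈ netEdges (d, ts, init, finals) :=
        mem_netEdges.2 (Or.inr (Or.inr ⟨rfl, rfl, rfl, f, hf, rfl⟩))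
      simpa using Path.cons (w := []) (mem_netEdges.2 (Or.inl ⟨rfl, rfl, rfl, rfl⟩)) (hu.snoc e1)
    · rw [powGen_eval_eq_one_iff]
      intro i _
      refine coordWord_run_append.2 ⟨_, ?_, coordWord_run_append.2 ⟨_, hu' i, ?_⟩⟩
      · rw [counterRun_signedWord_iff, hinit, extendMarking_vecOf]
        split_ifs <;> simp
      · rw [counterRun_signedWord_iff, hμ, extendMarking_vecOf]
        split_ifs <;> simp
  · rintro ⟨u, hu, h1⟩
    rw [powGen_eval_eq_one_iff] at h1
    have h2 : ∀ s w u t, Path (netEdges (d, ts, init, finals)) s w u t → s = 1 →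
        w = [] ∧ u = [] := by
      intro s w u t h hs
      cases h with
      | nil => exact ⟨rfl, rfl⟩
      | cons he =>
        rcases mem_netEdges.1 he with ⟨h, -⟩ | ⟨h, -⟩ | ⟨h, -⟩ <;> omega
    have key : ∀ s w' u t, Path (netEdges (d, ts, init, finals)) s w' u t → s = 2 → t = 1 →
        ∀ (w : List (Fin k)) (μ : Fin d → ℕ), w' = w.map Fin.val →
        (∀ i < d, counterRun (coordWord i u) (extendMarking μ i) = some 0) →
        ∃ μ' ∈ N.final, N.Run μ w μ' := by
      intro s w' u t h
      induction h with
      | nil => intro h1 h2; omega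
      | @cons s t q w u w' u' he hp ih =>
        intro hs hq v μ hv hrun
        rcases mem_netEdges.1 he with ⟨h, -⟩ | ⟨-, rfl, x, ν, hν, rfl, rfl⟩ |
          ⟨-, rfl, rfl, f, hf, rfl⟩
        · omega
        · obtain ⟨v₁, v₂, rfl, h3, h4⟩ := List.map_eq_append_iff.1 hv.symm
          have h5 : ∀ i < d, ∃ b, counterRun (coordWord i (signedWord d (ν.map Int.toNat)
              (ν.map fun z => (-z).toNat))) (extendMarking μ i) = some b ∧
              counterRun (coordWord i u') b = some 0 := fun i hi => coordWord_run_append.1 (hrun i hi)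
          choose b hb hb' using h5
          have h6 : ∀ i (hi : i < d), extendMarking (fun i : Fin d => b i i.2) i = b i hi := by
            intro i hi
            simp [extendMarking, hi]
          obtain ⟨μ', hμ', hr⟩ := ih rfl hq v₂ (fun i => b i i.2) h4.symm fun i hi => by
            rw [h6 i hi]; exact hb' i hi
          obtain ⟨y, rfl, rfl⟩ : ∃ y : Option (Fin k), x = y.map Fin.val ∧ v₁ = y.toList := by
            cases x with
            | none => exact ⟨none, rfl, by simpa using h3⟩
            | some x =>
              rcases v₁ with _ | ⟨y, _ | ⟨z, v₁⟩⟩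
              · simp at h3
              · exact ⟨some y, by simpa using h3.symm, rfl⟩
              · simp at h3
          refine ⟨μ', hμ', PetriNet.Run.cons (ν := vecOf d ν) ⟨_, hν, rfl, rfl⟩ ?_ hr⟩
          rw [counterRun_transition_iff]
          intro i
          by_cases hi : i < d
          · rw [h6 i hi]; exact hb i hi
          · rw [counterRun_signedWord_iff]
            simp [hi, extendMarking]
        · obtain ⟨rfl, rfl⟩ := h2 _ _ _ _ hp rfl
          obtain rfl : v = [] := by simpa using hv.symm
          refine ⟨μ, ⟨f, hf, ?_⟩, PetriNet.Run.nil μ⟩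
          funext i
          have := hrun i i.2
          rw [List.append_nil, counterRun_signedWord_iff] at this
          simpa [extendMarking, vecOf] using this
    generalize h3 : w.map Fin.val = w' at hu
    cases hu with
    | cons he hp =>
      rcases mem_netEdges.1 he with ⟨-, rfl, rfl, rfl⟩ | ⟨h, -⟩ | ⟨h, -⟩
      · refine key _ _ _ _ hp rfl rfl w (vecOf d init) (by simpa using h3.symm) fun i hi => ?_
        obtain ⟨c, hc, hc'⟩ := coordWord_run_append.1 (h1 i (by omega))
        rw [counterRun_signedWord_iff] at hc
        rw [extendMarking_vecOf, if_pos hi]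
        simp only [hi, if_true, List.getD_nil] at hc
        rwa [show init.getD i 0 = c by omega]
      · omega
      · omega

/-! ### Automata for the languages of the hierarchy -/

/-- The operations for the languages of a level. -/
def levelOps (M : ℕ) : ℕ → List Bool
  | 0 => []
  -- From the outside: `M` blind counters for the semilinear condition, then `𝔹 * (_ × ℤ)` for the
  -- call stack of the grammar.
  | i + 1 => List.replicate M false ++ true :: false :: levelOps M i

/-- The automaton for a `StepCode`, where the entry `k * M + c` of the table `T` is an automaton for
the right-hand side `c` over the alphabet with `k` letters. -/
def stepEdges (M k : ℕ) (T : List (List Edge)) (s : StepCode) : List Edge :=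
  imageEdges M k s.2.1 s.2.2.2.1 s.2.2.2.2
    (grammarEdges s.1 s.2.2.1 fun c => T.getD ((s.1 + 1 + s.2.1) * M + c) [])

/-- Automata for the languages of a level: the entry `k * M + c` belongs to the code `c` and the
alphabet with `k` letters. -/
def edgeTable (M : ℕ) : ℕ → List (List Edge)
  | 0 => (List.range (M * M)).map fun x =>
      splitEdges (netEdges (Denumerable.ofNat PetriCode (x % M)))
  | i + 1 => (List.range (M * M)).map fun x =>
      splitEdges (stepEdges M (x / M) (edgeTable M i) (Denumerable.ofNat StepCode (x % M)))

theorem elementary_edgeTable (M i x : ℕ) : Elementary ((edgeTable M i).getD x []) := by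
  have h : ∀ f : ℕ → List Edge, (∀ x, Elementary (f x)) →
      Elementary (((List.range (M * M)).map f).getD x []) := by
    intro f hf
    rw [List.getD_eq_getElem?_getD, List.getElem?_map]
    cases (List.range (M * M))[x]? with
    | none => intro e he; cases he
    | some y => exact hf y
  cases i with
  | zero => exact h _ fun x => elementary_splitEdges _
  | succ i => exact h _ fun x => elementary_splitEdges _

/-- A code bounds what it mentions: the dimension of a net, the sum `n + m`, and the codes of the
right-hand sides are all at most `c`. Hence the right-hand sides, over `n + 1 + m ≤ c + 1 < M`
letters, are again entries of the table for the same `M`, and all automata of a level use one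
monoid. -/
theorem fWord_edgeTable_iff (M i : ℕ) {k c : ℕ} (hk : k < M) (hc : c + 1 < M) (w : List ℕ) :
    FWord i k c w ↔ (∀ x ∈ w, x < k) ∧ Accepts (scMonoid M (levelOps M i))
      ((edgeTable M i).getD (k * M + c) []) startState finalState w := by
  have hcM : c < M := by omega
  obtain ⟨hdiv, hmod⟩ := mul_add_div_mod (p := k) hcM
  have hlt := mul_add_lt hk hcM
  induction i generalizing k c w with
  | zero =>
    rw [edgeTable, getD_map_range _ _ _ _ hlt, hmod, startState, finalState,
      accepts_splitEdges_iff]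
    obtain ⟨⟨d, ts, init, finals⟩, hs⟩ : ∃ s, Denumerable.ofNat PetriCode c = s := ⟨_, rfl⟩
    rw [hs]
    refine fWord_zero_iff ?_ hs w
    have h := congrArg Encodable.encode hs
    rw [Denumerable.encode_ofNat, Encodable.encode_prod_val, Encodable.encode_nat] at h
    have := Nat.left_le_pair d (Encodable.encode (ts, init, finals))
    omega
  | succ i ih =>
    rw [edgeTable, getD_map_range _ _ _ _ hlt, hdiv, hmod, startState, finalState,
      accepts_splitEdges_iff]
    obtain ⟨⟨n, m, prods, hs, S⟩, hstep⟩ : ∃ s, Denumerable.ofNat StepCode c = s := ⟨_, rfl⟩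
    have h := congrArg Encodable.encode hstep
    simp only [Denumerable.encode_ofNat, Encodable.encode_prod_val, Encodable.encode_nat] at h
    set r := Nat.pair (Encodable.encode hs) (Encodable.encode S)
    have h1 := Nat.add_le_pair n (Nat.pair m (Nat.pair (Encodable.encode prods) r))
    have h2 := Nat.add_le_pair m (Nat.pair (Encodable.encode prods) r)
    have h3 := Nat.left_le_pair (Encodable.encode prods) r
    have hprods : ∀ p ∈ prods, p.2 ≤ c := by
      rintro ⟨A, c'⟩ hp
      have h4 := encode_lt_of_mem hp
      have h5 := Nat.right_le_pair A c'
      simp only [Encodable.encode_prod_val, Encodable.encode_nat] at h4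
      simp only
      omega
    rw [fWord_succ_iff hstep, hstep, levelOps, stepEdges, accepts_imageEdges_iff (by simp only; omega)]
    have hrhs : ∀ A v, CodeRhs i (n + 1 + m) prods A v ↔ (∀ x ∈ v, x < n + 1 + m) ∧
        AutRhs (scMonoid M (levelOps M i)) prods
          (fun c => (edgeTable M i).getD ((n + 1 + m) * M + c) []) A v := by
      intro A v
      have h6 : ∀ c', (A, c') ∈ prods → _ := fun c' hc' => by
        have h7 := hprods _ hc'
        simp only at h7
        have h8 : c' < M := by omega
        have h9 : n + 1 + m < M := by omega
        exact ih h9 (by omega) v h8 (mul_add_div_mod h8).1 (mul_add_div_mod h8).2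
          (mul_add_lt h9 h8)
      constructor
      · rintro ⟨c', hc', h⟩
        obtain ⟨ha, hb⟩ := (h6 c' hc').1 h
        exact ⟨ha, c', hc', hb⟩
      · rintro ⟨ha, c', hc', hb⟩
        exact ⟨c', hc', (h6 c' hc').2 ⟨ha, hb⟩⟩
    have hyield : ∀ z, Yield n m (CodeRhs i (n + 1 + m) prods) [0] z ↔ (∀ x ∈ z, x < m) ∧
        Accepts (scMonoid M (true :: false :: levelOps M i)) (grammarEdges n prods
          fun c => (edgeTable M i).getD ((n + 1 + m) * M + c) []) 0 1 z := by
      intro z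
      refine Iff.trans ?_ (accepts_grammarEdges_iff (fun c => elementary_edgeTable M i _) z).symm
      exact ⟨fun h => h.mono fun A _ v _ hv => ((hrhs A v).1 hv).2,
        fun h => h.mono fun A _ v hlt hv => (hrhs A v).2 ⟨hlt, hv⟩⟩
    constructor
    · rintro ⟨z, hy, hS, rfl⟩
      obtain ⟨ha, hb⟩ := (hyield z).1 hy
      exact ⟨by simp, z, ha, hb, hS, rfl⟩
    · rintro ⟨-, z, ha, hb, hS, rfl⟩
      exact ⟨z, (hyield z).2 ⟨ha, hb⟩, hS, rfl⟩

/-- A code of a valence automaton for a code of a language of the hierarchy. -/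
def autCode (k i c : ℕ) : VACode :=
  -- Large enough for both `k < M` and `c + 1 < M`.
  let M := k + c + 2
  let E := (edgeTable M i).getD (k * M + c) []
  (M, levelOps M i, stateBound E startState finalState, E, [finalState])

theorem vaLang_autCode (k i c : ℕ) : vaLang k (autCode k i c) = fLang i k c := by
  ext w
  rw [autCode, mem_vaLang_iff, ← fWord_map_iff,
    fWord_edgeTable_iff (k + c + 2) i (by omega) (by omega)]
  set E := (edgeTable (k + c + 2) i).getD (k * (k + c + 2) + c) []
  have hR := statesLt_stateBound E startState finalState
  have hE : (E.filter fun e => e.1 ≤ stateBound E startState finalState ∧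
      e.2.2.2 ≤ stateBound E startState finalState) = E := by
    rw [List.filter_eq_self]
    intro e he
    have := hR e he
    simp only [decide_eq_true_eq]
    omega
  -- The triple `([], [], 0)` has the code `0`, and `0` is the initial state that a `VACode`
  -- prescribes.
  have h0 : startState = 0 := by
    simp [startState, pendingState, Nat.pair]
  rw [hE, h0]
  constructor
  · rintro ⟨f, hf, -, h⟩
    rw [List.mem_singleton] at hf
    subst hf
    exact ⟨by simp, h⟩
  · rintro ⟨-, h⟩
    exact ⟨finalState, by simp, by simp only [stateBound]; omega, h⟩

end ValenceLang

/-! ### Primitive recursiveness of both translations -/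

namespace ValenceLang

/-! ### Primitive recursive functions -/

attribute [fun_prop] Primrec PrimrecPred Primrec.const Primrec.comp Primrec.pair Primrec.id

section Primrec

variable {α β γ σ : Type*} [Primcodable α] [Primcodable β] [Primcodable γ] [Primcodable σ]

@[fun_prop] theorem primrec_fst {f : α → β × γ} (hf : Primrec f) : Primrec fun a => (f a).1 :=
  Primrec.fst.comp hf
@[fun_prop] theorem primrec_snd {f : α → β × γ} (hf : Primrec f) : Primrec fun a => (f a).2 :=
  Primrec.snd.comp hf
@[fun_prop] theorem primrec_add {f g : α → ℕ} (hf : Primrec f) (hg : Primrec g) :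
    Primrec fun a => f a + g a := Primrec.nat_add.comp hf hg
@[fun_prop] theorem primrec_sub {f g : α → ℕ} (hf : Primrec f) (hg : Primrec g) :
    Primrec fun a => f a - g a := Primrec.nat_sub.comp hf hg
@[fun_prop] theorem primrec_mul {f g : α → ℕ} (hf : Primrec f) (hg : Primrec g) :
    Primrec fun a => f a * g a := Primrec.nat_mul.comp hf hg
@[fun_prop] theorem primrec_div {f g : α → ℕ} (hf : Primrec f) (hg : Primrec g) :
    Primrec fun a => f a / g a := Primrec.nat_div.comp hf hg
@[fun_prop] theorem primrec_mod {f g : α → ℕ} (hf : Primrec f) (hg : Primrec g) :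
    Primrec fun a => f a % g a := Primrec.nat_mod.comp hf hg
@[fun_prop] theorem primrec_cons {f : α → β} {g : α → List β} (hf : Primrec f) (hg : Primrec g) :
    Primrec fun a => f a :: g a := Primrec.list_cons.comp hf hg
@[fun_prop] theorem primrec_append {f g : α → List β} (hf : Primrec f) (hg : Primrec g) :
    Primrec fun a => f a ++ g a := Primrec.list_append.comp hf hg
@[fun_prop] theorem primrec_map {f : α → List β} {g : α → β → σ} (hf : Primrec f)
    (hg : Primrec fun p : α × β => g p.1 p.2) : Primrec fun a => (f a).map fun b => g a b :=
  Primrec.list_map hf hg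
@[fun_prop] theorem primrec_flatMap {f : α → List β} {g : α → β → List σ} (hf : Primrec f)
    (hg : Primrec fun p : α × β => g p.1 p.2) : Primrec fun a => (f a).flatMap fun b => g a b :=
  Primrec.list_flatMap hf hg
@[fun_prop] theorem primrec_range {f : α → ℕ} (hf : Primrec f) :
    Primrec fun a => List.range (f a) := Primrec.list_range.comp hf
@[fun_prop] theorem primrec_length {f : α → List β} (hf : Primrec f) :
    Primrec fun a => (f a).length := Primrec.list_length.comp hf
@[fun_prop] theorem primrec_getD {f : α → List β} {g : α → ℕ} {d : β} (hf : Primrec f)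
    (hg : Primrec g) : Primrec fun a => (f a).getD (g a) d := (Primrec.list_getD d).comp hf hg
@[fun_prop] theorem primrec_head? {f : α → List β} (hf : Primrec f) :
    Primrec fun a => (f a).head? := Primrec.list_head?.comp hf
@[fun_prop] theorem primrec_encode {f : α → β} (hf : Primrec f) :
    Primrec fun a => Encodable.encode (f a) := Primrec.encode.comp hf
@[fun_prop] theorem primrecPred_eq {f g : α → β} (hf : Primrec f) (hg : Primrec g) :
    PrimrecPred fun a => f a = g a := Primrec.eq.comp hf hg
@[fun_prop] theorem primrecPred_le {f g : α → ℕ} (hf : Primrec f) (hg : Primrec g) :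
    PrimrecPred fun a => f a ≤ g a := Primrec.nat_le.comp hf hg
@[fun_prop] theorem primrecPred_lt {f g : α → ℕ} (hf : Primrec f) (hg : Primrec g) :
    PrimrecPred fun a => f a < g a := Primrec.nat_lt.comp hf hg
@[fun_prop] theorem primrecPred_and {f g : α → Prop} (hf : PrimrecPred f) (hg : PrimrecPred g) :
    PrimrecPred fun a => f a ∧ g a := hf.and hg
@[fun_prop] theorem primrecPred_or {f g : α → Prop} (hf : PrimrecPred f) (hg : PrimrecPred g) :
    PrimrecPred fun a => f a ∨ g a := hf.or hg
@[fun_prop] theorem primrec_ite {c : α → Prop} [DecidablePred c] {f g : α → σ}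
    (hc : PrimrecPred c) (hf : Primrec f) (hg : Primrec g) :
    Primrec fun a => if c a then f a else g a := Primrec.ite hc hf hg

@[fun_prop] theorem primrec_filter {f : α → List β} {p : α → β → Prop}
    [∀ a b, Decidable (p a b)] (hf : Primrec f) (hp : PrimrecPred fun x : α × β => p x.1 x.2) :
    Primrec fun a => (f a).filter fun b => decide (p a b) := by
  have h : Primrec fun a => (f a).flatMap fun b => if p a b then [b] else [] := by fun_prop
  refine h.of_eq fun a => ?_
  induction f a with
  | nil => rfl
  | cons b l ih =>
    rw [List.flatMap_cons, ih, List.filter_cons]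
    by_cases h : p a b <;> simp [h]

@[fun_prop] theorem primrec_toList {f : α → Option β} (hf : Primrec f) :
    Primrec fun a => (f a).toList := by
  have h : Primrec fun a => (Option.casesOn (f a) [] fun b => [b] : List β) :=
    Primrec.option_casesOn hf (Primrec.const []) (by
      change Primrec fun p : α × β => [p.2]
      fun_prop)
  exact h.of_eq fun a => by cases f a <;> rfl

@[fun_prop] theorem primrec_replicate {f : α → ℕ} {g : α → β} (hf : Primrec f) (hg : Primrec g) :
    Primrec fun a => List.replicate (f a) (g a) := by
  have h : Primrec fun a => (List.range (f a)).map fun _ => g a := by fun_prop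
  exact h.of_eq fun a => by simp

@[fun_prop] theorem primrec_drop {f : α → ℕ} {g : α → List β} (hf : Primrec f) (hg : Primrec g) :
    Primrec fun a => (g a).drop (f a) := Primrec.list_drop.comp hf hg
@[fun_prop] theorem primrec_take {f : α → ℕ} {g : α → List β} (hf : Primrec f) (hg : Primrec g) :
    Primrec fun a => (g a).take (f a) := Primrec.list_take.comp hf hg

/-- Even codes stand for nonnegative integers and odd codes for negative ones, so the positive and
the negative part are arithmetic functions of the code. -/
theorem encode_int (z : ℤ) : Encodable.encode z = if 0 ≤ z then 2 * z.toNat else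
    2 * (-z).toNat - 1 := by
  cases z with
  | ofNat n =>
    change 2 * n = _
    simp
  | negSucc n =>
    change 2 * n + 1 = _
    simp
    omega

@[fun_prop] theorem primrec_toNat {f : α → ℤ} (hf : Primrec f) :
    Primrec fun a => (f a).toNat := by
  have h : Primrec fun a => if Encodable.encode (f a) % 2 = 0 then Encodable.encode (f a) / 2
    else 0 := by fun_prop
  refine h.of_eq fun a => ?_
  rw [encode_int]
  split_ifs <;> omega

@[fun_prop] theorem primrec_neg_toNat {f : α → ℤ} (hf : Primrec f) :
    Primrec fun a => (-f a).toNat := by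
  have h : Primrec fun a => if Encodable.encode (f a) % 2 = 0 then 0
    else Encodable.encode (f a) / 2 + 1 := by fun_prop
  refine h.of_eq fun a => ?_
  rw [encode_int]
  split_ifs <;> omega

end Primrec

section

variable {α : Type*} [Primcodable α]

@[fun_prop] theorem primrec_pendingState {f g : α → List ℕ} {h : α → ℕ} (hf : Primrec f)
    (hg : Primrec g) (hh : Primrec h) : Primrec fun a => pendingState (f a) (g a) (h a) := by
  unfold pendingState
  fun_prop

@[fun_prop] theorem primrec_splitEdges {f : α → List Edge} (hf : Primrec f) :
    Primrec fun a => splitEdges (f a) := by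
  unfold splitEdges splitEdge
  fun_prop

@[fun_prop] theorem primrec_stateBound {f : α → List Edge} {g h : α → ℕ} (hf : Primrec f)
    (hg : Primrec g) (hh : Primrec h) : Primrec fun a => stateBound (f a) (g a) (h a) := by
  unfold stateBound
  fun_prop

/-! ### Computability of the first translation -/

@[fun_prop] theorem primrec_restrictEdges {f : α → ℕ} {g : α → List Edge} {h : α → List ℕ}
    (hf : Primrec f) (hg : Primrec g) (hh : Primrec h) :
    Primrec fun a => restrictEdges (f a) (g a) (h a) := by
  unfold restrictEdges
  fun_prop

@[fun_prop] theorem primrec_nextEdges {b : α → Bool} {f : α → ℕ} {g : α → List Edge}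
    (hb : Primrec b) (hf : Primrec f) (hg : Primrec g) :
    Primrec fun a => nextEdges (b a) (f a) (g a) := by
  unfold nextEdges callLetter
  fun_prop

@[fun_prop] theorem primrec_doubleEdges {f : α → List Edge} (hf : Primrec f) :
    Primrec fun a => doubleEdges (f a) := by
  unfold doubleEdges
  fun_prop

@[fun_prop] theorem primrec_edgeVector {R d : α → ℕ} {e : α → Edge} (hR : Primrec R)
    (hd : Primrec d) (he : Primrec e) : Primrec fun a => edgeVector (R a) (d a) (e a) := by
  unfold edgeVector
  fun_prop

@[fun_prop] theorem primrec_stateVector {d s : α → ℕ} (hd : Primrec d) (hs : Primrec s) :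
    Primrec fun a => stateVector (d a) (s a) := by
  unfold stateVector
  fun_prop

@[fun_prop] theorem primrec_netCode {n R p q : α → ℕ} {E : α → List Edge} (hn : Primrec n)
    (hR : Primrec R) (hE : Primrec E) (hp : Primrec p) (hq : Primrec q) :
    Primrec fun a => netCode (n a) (R a) (E a) (p a) (q a) := by
  unfold netCode
  fun_prop

@[fun_prop] theorem primrec_markerSet {k : α → ℕ} (hk : Primrec k) :
    Primrec fun a => markerSet (k a) := by
  unfold markerSet
  fun_prop

@[fun_prop] theorem primrec_pairCode {R k t : α → ℕ} {T : α → List ℕ} (hR : Primrec R)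
    (hk : Primrec k) (hT : Primrec T) (ht : Primrec t) :
    Primrec fun a => pairCode (R a) (k a) (T a) (t a) := by
  unfold pairCode
  fun_prop

/-- The nonrecursive description of `codeTable`: first the automata for the inner monoids are
computed, and then the codes. -/
theorem codeTable_eq (n R : ℕ) (ops : List Bool) (k : ℕ) (E : List Edge) (ks : List ℕ) :
    let st := ops.foldl (fun (st : List ℕ × ℕ × List Edge) b =>
      (st.2.1 :: st.1, R * R + 1 + (st.2.1 + 2), nextEdges b R st.2.2)) (ks, k, E)
    st.1.foldl (fun T k => (List.range (R * R)).map fun t => Encodable.encode (pairCode R k T t))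
        ((List.range (R * R)).map fun t => Encodable.encode
          (netCode n (2 * R) (doubleEdges st.2.2) (2 * (t / R)) (2 * (t % R)))) =
      ks.foldl (fun T k => (List.range (R * R)).map fun t => Encodable.encode (pairCode R k T t))
        (codeTable n R ops k E) := by
  induction ops generalizing k E ks with
  | nil => rfl
  | cons b ops ih => exact ih _ _ _

theorem primrec_foldl {β σ : Type*} [Primcodable β] [Primcodable σ] {f : α → List β} {g : α → σ}
    {h : α → σ → β → σ} (hf : Primrec f) (hg : Primrec g)
    (hh : Primrec fun p : α × σ × β => h p.1 p.2.1 p.2.2) :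
    Primrec fun a => (f a).foldl (h a) (g a) :=
  Primrec.list_foldl (h := fun a p => h a p.1 p.2) hf hg hh

@[fun_prop] theorem primrec_codeTable {n R k : α → ℕ} {ops : α → List Bool} {E : α → List Edge}
    (hn : Primrec n) (hR : Primrec R) (hops : Primrec ops) (hk : Primrec k) (hE : Primrec E) :
    Primrec fun a => codeTable (n a) (R a) (ops a) (k a) (E a) := by
  -- `h1` descends through the operations and collects the alphabet sizes; `h2` climbs back and
  -- builds the tables.
  have h1 : Primrec fun a => (ops a).foldl (fun (st : List ℕ × ℕ × List Edge) b =>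
      (st.2.1 :: st.1, R a * R a + 1 + (st.2.1 + 2), nextEdges b (R a) st.2.2))
      (([] : List ℕ), k a, E a) :=
    primrec_foldl hops (by fun_prop) (by fun_prop)
  have h2 : ∀ st : α → List ℕ × ℕ × List Edge, Primrec st → Primrec fun a =>
      (st a).1.foldl (fun T k => (List.range (R a * R a)).map fun t =>
        Encodable.encode (pairCode (R a) k T t)) ((List.range (R a * R a)).map fun t =>
          Encodable.encode (netCode (n a) (2 * R a) (doubleEdges (st a).2.2) (2 * (t / R a))
            (2 * (t % R a)))) :=
    fun st hst => primrec_foldl (by fun_prop) (by fun_prop) (by fun_prop)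
  exact (h2 _ h1).of_eq fun a => codeTable_eq (n a) (R a) (ops a) (k a) (E a) []

theorem primrec_levelCode : Primrec fun p : ℕ × VACode => levelCode p.1 p.2 := by
  unfold levelCode
  fun_prop

/-! ### Computability of the second translation -/

@[fun_prop] theorem primrec_ofNat {β : Type*} [Denumerable β] {f : α → ℕ} (hf : Primrec f) :
    Primrec fun a => Denumerable.ofNat β (f a) := (Primrec.ofNat β).comp hf

@[fun_prop] theorem primrec_signedWord {d : α → ℕ} {p q : α → List ℕ} (hd : Primrec d)
    (hp : Primrec p) (hq : Primrec q) : Primrec fun a => signedWord (d a) (p a) (q a) := by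
  unfold signedWord
  fun_prop

@[fun_prop] theorem primrec_netEdges {N : α → PetriCode} (hN : Primrec N) :
    Primrec fun a => netEdges (N a) := by
  unfold netEdges
  fun_prop

@[fun_prop] theorem primrec_imageEdges {M k m : α → ℕ} {hs : α → List (List ℕ)}
    {S : α → List (List ℕ × List (List ℕ))} {E : α → List Edge} (hM : Primrec M) (hk : Primrec k)
    (hm : Primrec m) (hhs : Primrec hs) (hS : Primrec S) (hE : Primrec E) :
    Primrec fun a => imageEdges (M a) (k a) (m a) (hs a) (S a) (E a) := by
  unfold imageEdges linearState
  fun_prop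

@[fun_prop] theorem primrec_grammarEdges {n : α → ℕ} {prods : α → List (ℕ × ℕ)}
    {aut : α → ℕ → List Edge} (hn : Primrec n) (hp : Primrec prods)
    (ha : Primrec fun x : α × ℕ => aut x.1 x.2) :
    Primrec fun a => grammarEdges (n a) (prods a) (aut a) := by
  have ha' : ∀ {γ : Type} [Primcodable γ] {f : γ → α} {g : γ → ℕ}, Primrec f → Primrec g →
      Primrec fun c => aut (f c) (g c) := fun hf hg => ha.comp (hf.pair hg)
  unfold grammarEdges callSites callWord returnWord frameState
  fun_prop

@[fun_prop] theorem primrec_stepEdges {M k : α → ℕ} {T : α → List (List Edge)} {s : α → StepCode}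
    (hM : Primrec M) (hk : Primrec k) (hT : Primrec T) (hs : Primrec s) :
    Primrec fun a => stepEdges (M a) (k a) (T a) (s a) := by
  unfold stepEdges
  fun_prop

/-- Tabulating all alphabet sizes and codes below `M` removes `k` and `c` from the recursion; what
is left is a primitive recursion on the level. -/
theorem edgeTable_eq (M i : ℕ) : edgeTable M i = Nat.rec
    ((List.range (M * M)).map fun x =>
      splitEdges (netEdges (Denumerable.ofNat PetriCode (x % M))))
    (fun _ T => (List.range (M * M)).map fun x =>
      splitEdges (stepEdges M (x / M) T (Denumerable.ofNat StepCode (x % M)))) i := by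
  induction i with
  | zero => rfl
  | succ i ih => rw [edgeTable, ih]

@[fun_prop] theorem primrec_edgeTable {M i : α → ℕ} (hM : Primrec M) (hi : Primrec i) :
    Primrec fun a => edgeTable (M a) (i a) := by
  simp only [edgeTable_eq]
  refine Primrec.nat_rec' (h := fun a p => (List.range (M a * M a)).map fun x =>
      splitEdges (stepEdges (M a) (x / M a) p.2 (Denumerable.ofNat StepCode (x % M a)))) hi
    (by fun_prop) ?_
  unfold Primrec₂
  fun_prop

theorem levelOps_eq (M i : ℕ) : levelOps M i =
    Nat.rec [] (fun _ l => List.replicate M false ++ true :: false :: l) i := by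
  induction i with
  | zero => rfl
  | succ i ih => rw [levelOps, ih]

@[fun_prop] theorem primrec_levelOps {M i : α → ℕ} (hM : Primrec M) (hi : Primrec i) :
    Primrec fun a => levelOps (M a) (i a) := by
  simp only [levelOps_eq]
  refine Primrec.nat_rec' (h := fun a p => List.replicate (M a) false ++ true :: false :: p.2) hi
    (by fun_prop) ?_
  unfold Primrec₂
  fun_prop

theorem primrec_autCode : Primrec fun p : ℕ × ℕ × ℕ => autCode p.1 p.2.1 p.2.2 := by
  unfold autCode
  fun_prop

end

end ValenceLang

/-! ### Independence of the alphabet, and completeness of the codes -/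

namespace ValenceLang

/-! ### Change of the alphabet -/

/-- The language which is obtained by renaming the letters. -/
def renameLang {X Y : Type} (e : X ≃ Y) (L : Language X) : Language Y := {w | w.map e.symm ∈ L}

theorem mem_renameLang {X Y : Type} {e : X ≃ Y} {L : Language X} {w : List Y} :
    w ∈ renameLang e L ↔ w.map e.symm ∈ L := Iff.rfl

theorem renameLang_symm {X Y : Type} (e : X ≃ Y) (L : Language X) :
    renameLang e.symm (renameLang e L) = L := by
  ext w
  simp [mem_renameLang, Function.comp_def]

theorem renameLang_eq_iff {X Y : Type} {e : X ≃ Y} {L : Language X} {L' : Language Y} :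
    renameLang e L = L' ↔ ∀ w, w ∈ L ↔ w.map e ∈ L' := by
  constructor
  · rintro rfl w
    simp [mem_renameLang, Function.comp_def]
  · intro h
    ext w
    rw [mem_renameLang, h]
    simp [Function.comp_def]

theorem reflTransGen_equiv {α β : Type*} {r : α → α → Prop} {s : β → β → Prop} (e : α ≃ β)
    (h : ∀ a b, r a b ↔ s (e a) (e b)) {a b : α} :
    Relation.ReflTransGen r a b ↔ Relation.ReflTransGen s (e a) (e b) := by
  constructor
  · exact fun H => H.lift e fun a b => (h a b).1
  · intro H
    have := H.lift (p := r) e.symm fun a b hab => (h _ _).2 (by simpa using hab)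
    simpa [Function.onFun] using this

/-- An isomorphism of automata in states, letters and monoid at once. It serves the change of the
alphabet as well as the passage from an arbitrary automaton to a coded one. -/
theorem ValenceAutomaton.renameLang_lang {X Y M M' : Type} [Monoid M] [Monoid M']
    {A : ValenceAutomaton X M} {A' : ValenceAutomaton Y M'} (eQ : A.Q ≃ A'.Q) (e : X ≃ Y)
    (φ : M ≃* M') (hE : ∀ q w m q', (q, w, m, q') ∈ A.edges ↔
      (eQ q, w.map e, φ m, eQ q') ∈ A'.edges) (hs : eQ A.start = A'.start)
    (hf : ∀ q, q ∈ A.final ↔ eQ q ∈ A'.final) : renameLang e A.lang = A'.lang := by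
  have hlist : ∀ v w : List X, v.map e = w.map e ↔ v = w := fun v w =>
    (List.map_injective_iff.2 e.injective).eq_iff
  let T : (A.Q × List X × M) ≃ (A'.Q × List Y × M') :=
    eQ.prodCongr ((Equiv.listEquivOfEquiv e).prodCongr φ.toEquiv)
  have hT : ∀ q w m, T (q, w, m) = (eQ q, w.map e, φ m) := fun _ _ _ => rfl
  have hstep : ∀ a b, A.Step a b ↔ A'.Step (T a) (T b) := by
    rintro ⟨q, w, m⟩ ⟨q', w', m'⟩
    rw [hT, hT]
    constructor
    · rintro ⟨⟨p, v, n, p'⟩, he, h1, h2, h3, h4⟩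
      simp only at h1 h2 h3 h4
      subst h1 h2 h3 h4
      exact ⟨_, (hE _ _ _ _).1 he, rfl, rfl, by simp, by simp⟩
    · rintro ⟨⟨p, v, n, p'⟩, he, h1, h2, h3, h4⟩
      obtain ⟨v, rfl⟩ : ∃ v₀ : List X, v₀.map e = v := ⟨v.map e.symm, by simp [Function.comp_def]⟩
      obtain ⟨n, rfl⟩ := φ.surjective n
      simp only at h1 h2 h3 h4
      subst h1 h2
      refine ⟨_, (hE _ _ _ _).2 he, rfl, rfl, ?_, ?_⟩
      · rw [← hlist, h3, List.map_append]
      · exact φ.injective (by rw [h4, map_mul])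
  rw [renameLang_eq_iff]
  intro w
  constructor
  · rintro ⟨f, hf', h⟩
    refine ⟨eQ f, (hf f).1 hf', ?_⟩
    have := (reflTransGen_equiv T hstep).1 h
    rwa [hT, hT, map_one, hs] at this
  · rintro ⟨f, hf', h⟩
    obtain ⟨f, rfl⟩ := eQ.surjective f
    refine ⟨f, (hf f).2 hf', (reflTransGen_equiv T hstep).2 ?_⟩
    rwa [hT, hT, map_one, hs]

theorem VASCpm.rename {X Y : Type} [Finite X] [Finite Y] (e : X ≃ Y) {L : Language X}
    (h : L ∈ VASCpm X) : renameLang e L ∈ VASCpm Y := by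
  obtain ⟨M, inst, hM, A, rfl⟩ := h
  let A' : ValenceAutomaton Y M :=
    { Q := A.Q
      finite_Q := A.finite_Q
      edges := (fun x => (x.1, x.2.1.map e, x.2.2.1, x.2.2.2)) '' A.edges
      finite_edges := A.finite_edges.image _
      start := A.start
      final := A.final }
  refine ⟨M, inst, hM, A', (ValenceAutomaton.renameLang_lang (A' := A') (Equiv.refl A.Q) e
    (MulEquiv.refl M) ?_ rfl fun q => Iff.rfl).symm⟩
  intro q w m q'
  constructor
  · exact fun h => ⟨_, h, rfl⟩
  · rintro ⟨⟨p, v, n, p'⟩, h, heq⟩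
    simp only [Prod.mk.injEq, (List.map_injective_iff.2 e.injective).eq_iff] at heq
    obtain ⟨rfl, rfl, rfl, rfl⟩ := heq
    exact h

theorem PetriNet.renameLang_lang {X Y : Type} {d : ℕ} {N : PetriNet X d} {N' : PetriNet Y d}
    (e : X ≃ Y) (ht : ∀ x ν, (x, ν) ∈ N.trans ↔ (x.map e, ν) ∈ N'.trans) (hi : N.init = N'.init)
    (hf : N.final = N'.final) : renameLang e N.lang = N'.lang := by
  have hlist : ∀ x : Option X, x.toList.map e = (x.map e).toList := by rintro (_ | _) <;> rfl
  have h1 : ∀ μ w μ', N.Run μ w μ' → N'.Run μ (w.map e) μ' := by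
    intro μ w μ' h
    induction h with
    | nil => exact PetriNet.Run.nil _
    | cons h1 h2 _ ih =>
      rw [List.map_append, hlist]
      exact PetriNet.Run.cons ((ht _ _).1 h1) h2 ih
  have h2 : ∀ μ v μ', N'.Run μ v μ' → ∀ w : List X, v = w.map e → N.Run μ w μ' := by
    intro μ v μ' h
    induction h with
    | nil =>
      intro w hw
      rw [List.map_eq_nil_iff.1 hw.symm]
      exact PetriNet.Run.nil _
    | @cons _ _ _ y _ _ h1 h2 _ ih =>
      intro w hw
      obtain ⟨w₁, w₂, rfl, h3, h4⟩ := List.map_eq_append_iff.1 hw.symm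
      obtain ⟨x, rfl⟩ : ∃ x : Option X, x.map e = y :=
        ⟨y.map e.symm, by cases y <;> simp⟩
      rw [← hlist] at h3
      rw [List.map_injective_iff.2 e.injective h3]
      exact PetriNet.Run.cons ((ht _ _).2 h1) h2 (ih w₂ h4.symm)
  rw [renameLang_eq_iff]
  intro w
  constructor
  · rintro ⟨μ, hμ, hr⟩
    exact ⟨μ, hf ▸ hμ, hi ▸ h1 _ _ _ hr⟩
  · rintro ⟨μ, hμ, hr⟩
    exact ⟨μ, hf ▸ hμ, h2 _ _ _ (hi ▸ hr) w rfl⟩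

/-- On a positive level it is enough to compose the outer morphism with the renaming, so no
induction over the levels is needed. -/
theorem Flevel.rename {X Y : Type} [Finite X] [Finite Y] (e : X ≃ Y) {i : ℕ} {L : Language X}
    (h : L ∈ Flevel i X) : renameLang e L ∈ Flevel i Y := by
  cases i with
  | zero =>
    obtain ⟨d, N, rfl⟩ := h
    let N' : PetriNet Y d :=
      { trans := (fun t => (t.1.map e, t.2)) '' N.trans
        finite_trans := N.finite_trans.image _
        init := N.init
        final := N.final
        finite_final := N.finite_final }
    refine ⟨d, N', (PetriNet.renameLang_lang (N' := N') e ?_ rfl rfl).symm⟩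
    intro x ν
    constructor
    · exact fun h => ⟨_, h, rfl⟩
    · rintro ⟨⟨y, ν'⟩, h, heq⟩
      simp only [Prod.mk.injEq, (Option.map_injective e.injective).eq_iff] at heq
      obtain ⟨rfl, rfl⟩ := heq
      exact h
  | succ i =>
    obtain ⟨Z, hZ, h, K, S, hK, hS, rfl⟩ := h
    refine ⟨Z, hZ, fun z => (h z).map e, K, S, hK, hS, ?_⟩
    symm
    rw [renameLang_eq_iff]
    intro w
    refine exists_congr fun z => and_congr Iff.rfl (and_congr Iff.rfl ?_)
    rw [← List.map_flatMap, (List.map_injective_iff.2 e.injective).eq_iff]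

theorem F.rename {X Y : Type} [Finite X] [Finite Y] (e : X ≃ Y) {L : Language X}
    (h : L ∈ F X) : renameLang e L ∈ F Y := by
  obtain ⟨i, hi⟩ := h
  exact ⟨i, Flevel.rename e hi⟩

/-! ### Codes represent languages in the classes -/

theorem sCpm_scMonoid (n : ℕ) (ops : List Bool) :
    SCpm (scMonoid n ops).carrier (scMonoid n ops).monoid := by
  induction ops with
  | nil => exact SCpm.bicyclic_pow n
  | cons b ops ih =>
    cases b with
    | false => exact SCpm.blind _ ih
    | true => exact SCpm.stack _ ih

theorem vaLang_mem (k : ℕ) (c : VACode) : vaLang k c ∈ VASCpm (Fin k) :=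
  ⟨_, _, sCpm_scMonoid c.1 c.2.1, vaOfCode k (scMonoid c.1 c.2.1) c.2.2.1 c.2.2.2.1 c.2.2.2.2, rfl⟩

open scoped Pointwise in
theorem isSemilinearSet_semilinearOf (m : ℕ) (S : List (List ℕ × List (List ℕ))) :
    IsSemilinearSet (semilinearOf m S) := by
  have h : semilinearOf m S = ⋃ s ∈ S.toFinset, (vecOf m s.1) +ᵥ
      (AddSubmonoid.closure {y | ∃ l ∈ s.2, y = vecOf m l} : Set (Fin m → ℕ)) := by
    ext v
    simp only [semilinearOf, Set.mem_ofPred_eq, Set.mem_iUnion, List.mem_toFinset, exists_prop,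
      Set.mem_vadd_set, vadd_eq_add, SetLike.mem_coe]
    refine exists_congr fun s => and_congr Iff.rfl (exists_congr fun x => and_congr Iff.rfl ?_)
    exact eq_comm
  rw [h]
  refine IsSemilinearSet.biUnion_finset fun s _ => IsSemilinearSet.vadd _ ?_
  refine IsSemilinearSet.closure_of_finite ?_
  refine ((s.2.toFinset.finite_toSet).image (vecOf m)).subset ?_
  rintro y ⟨l, hl, rfl⟩
  exact ⟨l, List.mem_toFinset.2 hl, rfl⟩

theorem fLang_mem (i k c : ℕ) : fLang i k c ∈ Flevel i (Fin k) := by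
  induction i generalizing k c with
  | zero => exact ⟨_, _, rfl⟩
  | succ i ih =>
    obtain ⟨⟨n, m, prods, hs, S⟩, hc⟩ : ∃ s, Denumerable.ofNat StepCode c = s := ⟨_, rfl⟩
    rw [fLang, hc]
    refine ⟨Fin m, inferInstance, _, _, _, ⟨Fin (n + 1), inferInstance, _, ?_, rfl⟩,
      isSemilinearSet_semilinearOf m S, rfl⟩
    rintro ⟨A, K⟩ ⟨c', -, hK⟩
    simp only at hK ⊢
    subst hK
    -- Codes describe right-hand sides over `Fin (n + 1 + m)`, whereas a grammar needs them over the
    -- disjoint union.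
    exact Flevel.rename finSumFinEquiv.symm (ih (n + 1 + m) c')

/-! ### Every language in the classes has a code -/

theorem GenMonoid.mem_closure_iff (G : GenMonoid) (x : G.carrier) :
    x ∈ Submonoid.closure (Set.range G.gen) ↔ ∃ u, G.eval u = x := by
  constructor
  · intro h
    induction h using Submonoid.closure_induction with
    | mem x hx =>
      obtain ⟨j, rfl⟩ := hx
      exact ⟨[j], by simp⟩
    | one => exact ⟨[], rfl⟩
    | mul x y _ _ hx hy =>
      obtain ⟨u, rfl⟩ := hx
      obtain ⟨v, rfl⟩ := hy
      exact ⟨u ++ v, G.eval_append u v⟩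
  · rintro ⟨u, rfl⟩
    refine Submonoid.list_prod_mem _ fun x hx => ?_
    obtain ⟨j, -, rfl⟩ := List.mem_map.1 hx
    exact Submonoid.subset_closure ⟨j, rfl⟩

/-- Edges of an arbitrary automaton carry monoid elements and codes carry words, so the listed
elements must generate the monoid. For `𝔹^n` this reduces to elements supported on one coordinate.
-/
theorem powGen_eval_surjective (n : ℕ) : Function.Surjective (powGen n).eval := by
  intro x
  rw [← Set.mem_range, Set.mem_range, ← GenMonoid.mem_closure_iff]
  refine Submonoid.pi_mem_of_mulSingle_mem x fun i => ?_
  have h : Submonoid.closure (Set.range (PresentedMonoid.of BicyclicRel)) ≤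
      (Submonoid.closure (Set.range (powGen n).gen)).comap
        (MonoidHom.mulSingle (fun _ : Fin n => Bicyclic) i) := by
    rw [Submonoid.closure_le]
    rintro _ ⟨b, rfl⟩
    refine Submonoid.subset_closure ⟨2 * i + (if b then 0 else 1), ?_⟩
    have hi : (2 * (i : ℕ) + 1) / 2 = i := by omega
    have hi' : (2 * (i : ℕ) + 1) % 2 = 1 := by omega
    cases b
    · simp [powGen, hi]; rfl
    · simp [powGen]; rfl
  rw [PresentedMonoid.closure_range_of] at h
  exact h (Submonoid.mem_top (x i))

theorem stackGen_eval_surjective {G : GenMonoid} (hG : Function.Surjective G.eval) :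
    Function.Surjective (stackGen G).eval := by
  intro x
  induction x using Monoid.Coprod.induction_on with
  | inl x =>
    have h : Submonoid.closure (Set.range (PresentedMonoid.of BicyclicRel)) ≤
        (Submonoid.closure (Set.range (stackGen G).gen)).comap Monoid.Coprod.inl := by
      rw [Submonoid.closure_le]
      rintro _ ⟨b, rfl⟩
      cases b
      · exact Submonoid.subset_closure ⟨1, rfl⟩
      · exact Submonoid.subset_closure ⟨0, rfl⟩
    rw [PresentedMonoid.closure_range_of] at h
    exact ((stackGen G).mem_closure_iff _).1 (h (Submonoid.mem_top x))
  | inr x =>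
    obtain ⟨u, rfl⟩ := hG x
    exact ⟨u.map (· + 2), stackGen_eval_add_two G u⟩
  | mul x y hx hy =>
    obtain ⟨u, rfl⟩ := hx
    obtain ⟨v, rfl⟩ := hy
    exact ⟨u ++ v, GenMonoid.eval_append _ _ _⟩

theorem blindGen_eval_surjective {G : GenMonoid} (hG : Function.Surjective G.eval) :
    Function.Surjective (blindGen G).eval := by
  rintro ⟨x, z⟩
  obtain ⟨u, rfl⟩ := hG x
  refine ⟨u.map (· + 2) ++ (List.replicate (Multiplicative.toAdd z).toNat 0 ++
    List.replicate (-Multiplicative.toAdd z).toNat 1), ?_⟩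
  rw [GenMonoid.eval_append, GenMonoid.eval_append, blindGen_eval_add_two,
    blindGen_eval_replicate_zero, blindGen_eval_replicate_one]
  refine Prod.ext ?_ ?_
  · exact (congrArg _ (one_mul _)).trans (mul_one _)
  · refine (one_mul _).trans ?_
    apply Multiplicative.toAdd.injective
    change ((Multiplicative.toAdd z).toNat : ℤ) + -((-Multiplicative.toAdd z).toNat : ℤ) = Multiplicative.toAdd z
    omega

theorem scMonoid_eval_surjective (n : ℕ) (ops : List Bool) :
    Function.Surjective (scMonoid n ops).eval := by
  induction ops with
  | nil => exact powGen_eval_surjective n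
  | cons b ops ih =>
    cases b with
    | false => exact blindGen_eval_surjective ih
    | true => exact stackGen_eval_surjective ih

/-- Free and direct products respect isomorphisms, so all isomorphisms used in building a monoid of
`SC±` can be postponed to the end. -/
theorem SCpm.exists_mulEquiv {M : Type} {inst : Monoid M} (h : SCpm M inst) :
    ∃ n ops, Nonempty (M ≃* (scMonoid n ops).carrier) := by
  induction h with
  | bicyclic_pow n => exact ⟨n, [], ⟨MulEquiv.refl _⟩⟩
  | stack M _ ih =>
    obtain ⟨n, ops, ⟨e⟩⟩ := ih
    exact ⟨n, true :: ops, ⟨MulEquiv.coprodCongr (MulEquiv.refl _) e⟩⟩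
  | blind M _ ih =>
    obtain ⟨n, ops, ⟨e⟩⟩ := ih
    exact ⟨n, false :: ops, ⟨MulEquiv.prodCongr e (MulEquiv.refl _)⟩⟩
  | iso M N e _ ih =>
    obtain ⟨n, ops, ⟨e'⟩⟩ := ih
    exact ⟨n, ops, ⟨e.symm.trans e'⟩⟩

theorem exists_equiv_fin_of_point {Q : Type} [Finite Q] (s : Q) :
    ∃ (r : ℕ) (e : Q ≃ Fin (r + 1)), e s = 0 := by
  obtain ⟨n, ⟨e⟩⟩ := Finite.exists_equiv_fin Q
  rcases n with _ | r
  · exact (e s).elim0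
  -- Codes prescribe the number `0` for the start; a transposition moves `s` there.
  · exact ⟨r, e.trans (Equiv.swap (e s) 0), by simp⟩

theorem renameLang_refl {X : Type} (L : Language X) : renameLang (Equiv.refl X) L = L := by
  ext w
  simp [mem_renameLang]

theorem exists_vaLang_eq {k : ℕ} {L : Language (Fin k)} (h : L ∈ VASCpm (Fin k)) :
    ∃ c, vaLang k c = L := by
  obtain ⟨M, inst, hM, A, rfl⟩ := h
  obtain ⟨n, ops, ⟨φ⟩⟩ := hM.exists_mulEquiv
  choose u hu using fun m => scMonoid_eval_surjective n ops (φ m)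
  have := A.finite_Q
  obtain ⟨r, e, he⟩ := exists_equiv_fin_of_point A.start
  let edges : List Edge := A.finite_edges.toFinset.toList.map fun x =>
    ((e x.1 : ℕ), x.2.1.map Fin.val, u x.2.2.1, (e x.2.2.2 : ℕ))
  let finals : List ℕ := (Set.toFinite A.final).toFinset.toList.map fun q => (e q : ℕ)
  have hval : ∀ v w : List (Fin k), v.map Fin.val = w.map Fin.val ↔ v = w := fun v w =>
    (List.map_injective_iff.2 Fin.val_injective).eq_iff
  refine ⟨(n, ops, r, edges, finals), ?_⟩
  rw [← renameLang_refl A.lang]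
  refine (ValenceAutomaton.renameLang_lang (A' := vaOfCode k (scMonoid n ops) r edges finals) e
    (Equiv.refl _) φ ?_ he ?_).symm
  · intro q w m q'
    constructor
    · intro h
      refine ⟨u m, List.mem_map.2 ⟨(q, w, m, q'), by simpa using h, ?_⟩, (hu m).symm⟩
      exact Prod.ext rfl (Prod.ext (by simp) rfl)
    · rintro ⟨v, hv, hm⟩
      obtain ⟨⟨p, w', m', p'⟩, h, heq⟩ := List.mem_map.1 hv
      simp only [Prod.mk.injEq, Equiv.coe_refl, List.map_id, hval] at heq
      obtain ⟨hq, rfl, rfl, hq'⟩ := heq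
      obtain rfl : p = q := e.injective (Fin.val_injective hq)
      obtain rfl : p' = q' := e.injective (Fin.val_injective hq')
      have : m = m' := φ.injective (hm.trans (hu m'))
      subst this
      simpa using h
  · intro q
    change _ ↔ ((e q : Fin (r + 1)) : ℕ) ∈ finals
    simp [finals, Fin.val_inj]

/-- The grammar which is obtained by renaming the nonterminals and the terminals. -/
def Grammar.rename {N T N' T' : Type} (G : Grammar N T) (eN : N ≃ N') (eT : T ≃ T') :
    Grammar N' T' where
  prods := (fun p => (eN p.1, renameLang (eN.sumCongr eT) p.2)) '' G.prods
  finite_prods := G.finite_prods.image _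
  start := eN G.start

theorem Grammar.renameLang_lang {N T N' T' : Type} (G : Grammar N T) (eN : N ≃ N') (eT : T ≃ T') :
    renameLang eT G.lang = (G.rename eN eT).lang := by
  set e := eN.sumCongr eT with he
  have hback : ∀ w : List (N ⊕ T), (w.map e).map (eN.sumCongr eT).symm = w := fun w => by
    rw [← he, List.map_map, e.symm_comp_self, List.map_id]
  have hsurj : Function.Surjective (List.map e) := List.map_surjective_iff.2 e.surjective
  have hstep : ∀ x y, G.Step x y ↔
      (G.rename eN eT).Step (Equiv.listEquivOfEquiv e x) (Equiv.listEquivOfEquiv e y) := by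
    intro x y
    change _ ↔ (G.rename eN eT).Step (x.map e) (y.map e)
    constructor
    · rintro ⟨p, hp, u, v, w, hw, rfl, rfl⟩
      refine ⟨_, ⟨p, hp, rfl⟩, u.map e, v.map e, w.map e, ?_, by simp [he], by simp⟩
      rwa [mem_renameLang, hback]
    · rintro ⟨_, ⟨p, hp, rfl⟩, u, v, w, hw, hx, hy⟩
      obtain ⟨u, rfl⟩ := hsurj u
      obtain ⟨v, rfl⟩ := hsurj v
      obtain ⟨w, rfl⟩ := hsurj w
      rw [mem_renameLang, hback] at hw
      refine ⟨p, hp, u, v, w, hw, ?_, ?_⟩ <;>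
        refine List.map_injective_iff.2 e.injective ?_
      · rw [hx]; simp [he]
      · rw [hy]; simp
  rw [renameLang_eq_iff]
  intro w
  refine (reflTransGen_equiv _ hstep).trans ?_
  change Relation.ReflTransGen _ (List.map e [Sum.inl G.start]) (List.map e (w.map Sum.inr)) ↔
    Relation.ReflTransGen _ [Sum.inl (eN G.start)] ((w.map eT).map Sum.inr)
  rw [show (w.map Sum.inr).map e = (w.map eT).map Sum.inr by simp [he]]
  rfl

theorem exists_vecOf_eq {α : Type} [Zero α] {d : ℕ} (v : Fin d → α) : vecOf d (List.ofFn v) = v := by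
  funext i
  simp [vecOf, List.getD_eq_getElem?_getD]

theorem exists_list_forall_iff {α β : Type} {s : Set α} (hs : s.Finite) (f : α → β) :
    ∃ l : List β, ∀ b, b ∈ l ↔ ∃ a ∈ s, f a = b :=
  ⟨hs.toFinset.toList.map f, fun b => by simp⟩

theorem exists_semilinearOf_eq {m : ℕ} {S : Set (Fin m → ℕ)} (hS : IsSemilinearSet S) :
    ∃ l, semilinearOf m l = S := by
  obtain ⟨T, hT, hlin, rfl⟩ := hS
  have h1 : ∀ t ∈ T, ∃ s : List ℕ × List (List ℕ), semilinearOf m [s] = t := by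
    intro t ht
    obtain ⟨a, P, hP, rfl⟩ := hlin t ht
    obtain ⟨l, hl⟩ := exists_list_forall_iff hP List.ofFn
    refine ⟨(List.ofFn a, l), ?_⟩
    have hset : {y | ∃ p ∈ l, y = vecOf m p} = P := by
      ext y
      constructor
      · rintro ⟨p, hp, rfl⟩
        obtain ⟨v, hv, rfl⟩ := (hl p).1 hp
        rwa [exists_vecOf_eq]
      · exact fun hy => ⟨_, (hl _).2 ⟨y, hy, rfl⟩, (exists_vecOf_eq y).symm⟩
    ext v
    constructor
    · rintro ⟨s, hs, x, hx, rfl⟩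
      rw [List.mem_singleton.1 hs] at hx ⊢
      rw [exists_vecOf_eq]
      exact Set.mem_vadd_set.2 ⟨x, hset ▸ hx, rfl⟩
    · intro hv
      obtain ⟨x, hx, rfl⟩ := Set.mem_vadd_set.1 hv
      exact ⟨_, List.mem_singleton.2 rfl, x, hset.symm ▸ hx, by rw [exists_vecOf_eq]; rfl⟩
  choose! f hf using h1
  obtain ⟨l, hl⟩ := exists_list_forall_iff hT f
  refine ⟨l, ?_⟩
  ext v
  rw [Set.mem_sUnion]
  constructor
  · rintro ⟨s, hs, h⟩
    obtain ⟨t, ht, rfl⟩ := (hl s).1 hs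
    exact ⟨t, ht, hf t ht ▸ ⟨_, List.mem_singleton.2 rfl, h⟩⟩
  · rintro ⟨t, ht, h⟩
    rw [← hf t ht] at h
    obtain ⟨s, hs, h⟩ := h
    rw [List.mem_singleton.1 hs] at h
    exact ⟨_, (hl _).2 ⟨t, ht, rfl⟩, h⟩

theorem exists_petriLang_eq {k d : ℕ} (N : PetriNet (Fin k) d) : ∃ c, petriLang k c = N.lang := by
  obtain ⟨ts, hts⟩ := exists_list_forall_iff N.finite_trans
    fun t => (t.1.map Fin.val, List.ofFn t.2)
  obtain ⟨fs, hfs⟩ := exists_list_forall_iff N.finite_final List.ofFn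
  refine ⟨(d, ts, List.ofFn N.init, fs), ?_⟩
  rw [← renameLang_refl N.lang]
  refine (PetriNet.renameLang_lang (N' := petriOfCode k d ts (List.ofFn N.init) fs)
    (Equiv.refl _) ?_ (exists_vecOf_eq N.init).symm ?_).symm
  · intro x ν
    rw [Equiv.coe_refl, Option.map_id]
    constructor
    · exact fun h => ⟨_, (hts _).2 ⟨_, h, rfl⟩, rfl, (exists_vecOf_eq ν).symm⟩
    · rintro ⟨s, hs, h1, h2⟩
      obtain ⟨⟨y, ν'⟩, h, rfl⟩ := (hts s).1 hs
      simp only at h1 h2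
      rw [exists_vecOf_eq] at h2
      rw [h2, show x = y from Option.map_injective Fin.val_injective h1.symm]
      exact h
  · ext μ
    constructor
    · exact fun h => ⟨_, (hfs _).2 ⟨μ, h, rfl⟩, (exists_vecOf_eq μ).symm⟩
    · rintro ⟨l, hl, rfl⟩
      obtain ⟨μ, h, rfl⟩ := (hfs l).1 hl
      rwa [exists_vecOf_eq]

theorem parikh_map {X Y : Type} (e : X ≃ Y) (w : List X) : parikh (w.map e) = parikh w ∘ e.symm := by
  classical
  funext y
  obtain ⟨x, rfl⟩ := e.surjective y
  have h := List.count_map_of_injective w e e.injective x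
  simp only [parikh, Function.comp_apply, Equiv.symm_apply_apply]
  convert h

theorem homSLIImage_rename {X X' Y : Type} (e : X ≃ X') (h : X → List Y) (K : Language X)
    (S : Set (X → ℕ)) : homSLIImage (h ∘ e.symm) (renameLang e K) ((· ∘ e.symm) '' S) =
      homSLIImage h K S := by
  ext v
  constructor
  · rintro ⟨w, hw, ⟨f, hf, hS⟩, rfl⟩
    refine ⟨_, hw, ?_, by rw [List.flatMap_map]; rfl⟩
    have := parikh_map e.symm w
    rw [this, ← hS]
    convert hf using 1
    funext x
    simp
  · rintro ⟨w, hw, hS, rfl⟩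
    refine ⟨w.map e, ?_, ⟨_, hS, (parikh_map e w).symm⟩, ?_⟩
    · simpa [mem_renameLang, Function.comp_def] using hw
    · rw [List.flatMap_map]
      simp

theorem wordOf_map_val_self {k : ℕ} (w : List (Fin k)) : wordOf k (w.map Fin.val) = w := by
  refine List.map_injective_iff.2 Fin.val_injective ?_
  rw [wordOf_map_val, List.filter_eq_self]
  simp

theorem exists_fLang_eq {i k : ℕ} {L : Language (Fin k)} (h : L ∈ Flevel i (Fin k)) :
    ∃ c, fLang i k c = L := by
  induction i generalizing k L with
  | zero =>
    obtain ⟨d, N, rfl⟩ := h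
    obtain ⟨c, hc⟩ := exists_petriLang_eq N
    exact ⟨Encodable.encode c, by rw [fLang, Denumerable.ofNat_encode, hc]⟩
  | succ i ih =>
    obtain ⟨X, hX, h, K, S, ⟨N, hN, G, hG, rfl⟩, hS, rfl⟩ := h
    obtain ⟨m, ⟨eX⟩⟩ := Finite.exists_equiv_fin X
    obtain ⟨n, eN, hstart⟩ := exists_equiv_fin_of_point G.start
    let e : N ⊕ X ≃ Fin (n + 1 + m) := (eN.sumCongr eX).trans finSumFinEquiv
    have h1 : ∀ p ∈ G.prods, ∃ c, fLang i (n + 1 + m) c = renameLang e p.2 :=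
      fun p hp => ih (Flevel.rename e (hG p hp))
    choose! γ hγ using h1
    obtain ⟨prods, hprods⟩ := exists_list_forall_iff G.finite_prods
      fun p => ((eN p.1 : ℕ), γ p)
    -- Renaming the coordinates is linear and therefore preserves semilinearity.
    have hSim : IsSemilinearSet ((· ∘ eX.symm) '' S) :=
      hS.image (LinearMap.funLeft ℕ ℕ eX.symm)
    obtain ⟨l, hl⟩ := exists_semilinearOf_eq hSim
    let hs : List (List ℕ) := List.ofFn fun x : Fin m => (h (eX.symm x)).map Fin.val
    have hgram : grammarOfCode n m prods (fLang i (n + 1 + m)) = G.rename eN eX := by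
      have h2 : (grammarOfCode n m prods (fLang i (n + 1 + m))).prods = (G.rename eN eX).prods := by
        have h3 : ∀ p ∈ G.prods, ({w | w.map finSumFinEquiv ∈ fLang i (n + 1 + m) (γ p)} :
            Language (Fin (n + 1) ⊕ Fin m)) = renameLang (eN.sumCongr eX) p.2 := by
          intro p hp
          rw [hγ p hp]
          ext w
          change (w.map finSumFinEquiv).map e.symm ∈ p.2 ↔ w.map (eN.sumCongr eX).symm ∈ p.2
          rw [List.map_map]
          refine iff_of_eq (congrArg (· ∈ p.2) (List.map_congr_left fun x _ => ?_))
          simp [e]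
        ext ⟨A, K⟩
        constructor
        · rintro ⟨c, hc, hK⟩
          obtain ⟨p, hp, heq⟩ := (hprods _).1 hc
          simp only [Prod.mk.injEq] at heq hK
          obtain ⟨hA, rfl⟩ := heq
          exact ⟨p, hp, Prod.ext (Fin.val_injective hA) ((h3 p hp).symm.trans hK.symm)⟩
        · rintro ⟨p, hp, heq⟩
          simp only [Prod.mk.injEq] at heq
          obtain ⟨rfl, rfl⟩ := heq
          exact ⟨γ p, (hprods _).2 ⟨p, hp, rfl⟩, (h3 p hp).symm⟩
      have h4 : (grammarOfCode n m prods (fLang i (n + 1 + m))).start = (G.rename eN eX).start :=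
        hstart.symm
      -- A grammar is determined by its productions and its start symbol, since its third field is a
      -- proof.
      generalize grammarOfCode n m prods (fLang i (n + 1 + m)) = G₁ at h2 h4
      generalize G.rename eN eX = G₂ at h2 h4
      cases G₁
      cases G₂
      simp only at h2 h4
      subst h2 h4
      rfl
    have hh : (fun x : Fin m => wordOf k (hs.getD x [])) = h ∘ eX.symm := by
      funext x
      simp [hs, List.getD_eq_getElem?_getD, wordOf_map_val_self]
    refine ⟨Encodable.encode ((n, m, prods, hs, l) : StepCode), ?_⟩
    rw [fLang, Denumerable.ofNat_encode]
    simp only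
    rw [hh, hgram, hl, ← Grammar.renameLang_lang, homSLIImage_rename]

/-- After a renaming to `Fin k` a language of either class has a code. The translated code
represents the same language in the other class, and renaming back stays within that class. -/
theorem vaSCpm_eq_F (X : Type) [Finite X] (L : Language X) : L ∈ VASCpm X ↔ L ∈ F X := by
  obtain ⟨k, ⟨e⟩⟩ := Finite.exists_equiv_fin X
  constructor
  · intro h
    obtain ⟨c, hc⟩ := exists_vaLang_eq (VASCpm.rename e h)
    rw [← renameLang_symm e L, ← hc, ← fLang_levelCode]
    exact F.rename e.symm ⟨_, fLang_mem _ _ _⟩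
  · rintro ⟨i, h⟩
    obtain ⟨c, hc⟩ := exists_fLang_eq (Flevel.rename e h)
    rw [← renameLang_symm e L, ← hc, ← vaLang_autCode]
    exact VASCpm.rename e.symm (vaLang_mem _ _)

end ValenceLang

theorem mainTheorem8 :
    -- the two classes of languages are equal
    (∀ (X : Type) [Finite X] (L : Language X),
      L ∈ ValenceLang.VASCpm X ↔ L ∈ ValenceLang.F X) ∧
    -- the inclusion from left to right is effective
    (∃ f : ℕ × ValenceLang.VACode → ℕ × ℕ, Computable f ∧
      ∀ (k : ℕ) (c : ValenceLang.VACode),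
        ValenceLang.fLang (f (k, c)).1 k (f (k, c)).2 = ValenceLang.vaLang k c) ∧
    -- the inclusion from right to left is effective
    (∃ g : ℕ × (ℕ × ℕ) → ValenceLang.VACode, Computable g ∧
      ∀ k i c : ℕ, ValenceLang.vaLang k (g (k, (i, c))) = ValenceLang.fLang i k c) :=
  ⟨ValenceLang.vaSCpm_eq_F,
    ⟨fun p => ValenceLang.levelCode p.1 p.2, ValenceLang.primrec_levelCode.to_comp,
      ValenceLang.fLang_levelCode⟩,
    ⟨fun p => ValenceLang.autCode p.1 p.2.1 p.2.2, ValenceLang.primrec_autCode.to_comp,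
      ValenceLang.vaLang_autCode⟩⟩
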